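/- Let $G\subset \mathrm{SL}(n,\mathbb C)$ be a finite abelian subgroup of order $r$. Fix a primitive $r$-th root of unity $\varepsilon$ and a basis of $\mathbb C^n$ in which $G$ is diagonal. For $g=\operatorname{diag}(\varepsilon^{a_1},\dots,\varepsilon^{a_n})\in G$ with $0\le a_i<r$ put $\hat g=\frac1r(a_1,\dots,a_n)$; let $N=\mathbb Z^n+\sum_{g\in G}\mathbb Z\hat g\subset\mathbb R^n$ and $\sigma=\operatorname{Cone}(e_1,\dots,e_n)$, so that $\mathbb C^n/G=U_{\sigma,N}$. For $u\in\mathbb R^n$ let $\operatorname{age}(u)=u_1+\dots+u_n$. The Hilbert basis $\mathbf{Hlb}_N(\sigma)$ is the set of nonzero elements of $\sigma\cap N$ that are not a sum of two nonzero elements of $\sigma\cap N$. Let $\Xi$ be a fan in $(\mathbb R^n,N)$ defining a Hilbert basis resolution $X_\Xi\to\mathbb C^n/G$, that is: $\Xi$ refines $\sigma$, every cone of $\Xi$ is smooth, and the set of ray generators of $\Xi$ is $\mathbf{Hlb}_N(\sigma)$. Let $g\in G$ be a junior element, i.e. $\operatorname{age}(\hat g)=1$, let $\rho_g=\operatorname{Cone}(\hat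 g)$, let $E_g=V(\rho_g)\subset X_\Xi$ be the closure of the torus orbit of $\rho_g$, and let $\Xi_g$ be the set of all faces of the $n$-dimensional cones of $\Xi$ that have $\rho_g$ as a face. Then: 1. $\Xi_g$ is a fan, and the natural morphism $X_{\Xi_g}\to X_\Xi$ is an open immersion that maps the orbit closure of $\rho_g$ in $X_{\Xi_g}$ onto $E_g$; in particular $X_{\Xi_g}$ is an open subvariety of $X_\Xi$ containing $E_g$. 2. For each ray generator $u\neq\hat g$ of $\Xi_g$ with $\operatorname{Cone}(\hat g,u)\in\Xi_g$ (these correspond to the rays of the star fan of $\rho_g$, which is the fan of $E_g$) let $D_{\bar u}=V(\operatorname{Cone}(\hat g,u))\subset E_g$ be the corresponding torus-invariant prime divisor. The ages of these $u$ are integers, and with $D=-\sum_u\operatorname{age}(u)\,D_{\bar u}$ the variety $X_{\Xi_g}$ is isomorphic to the total space of the line bundle $\mathcal O_{E_g}(D)$, the inclusion $E_g\subset X_{\Xi_g}$ corresponding to the zero section; that is, there is a morphism $\pi:X_{\Xi_g}\to E_g$ which is a line bundle with sheaf of sections isomorphic to $\mathcal O_{E_g}(D)$ and with zero section the inclusion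 of $E_g$. 3. In the classical topology, $E_g$ is a strong deformation retract of $X_{\Xi_g}$. -/

import Mathlib

open scoped Topology

/-! ## Complex varieties as spaces with functions -/

/-- A space with functions over `ℂ`: a topology (the Zariski topology) together with, for every open
`U`, the algebra of regular functions on `U`. A regular function on `U` is represented by a function
on all of `X` whose values off `U` are irrelevant (`regular_congr`). -/
class SpaceWithFunctions (X : Type*) where
  zariski : TopologicalSpace X
  regular : Set X → Subalgebra ℂ (X → ℂ)
  regular_congr : ∀ {U : Set X} {f g : X → ℂ}, f ∈ regular U → Set.EqOn f g U → g ∈ regular U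
  regular_mono : ∀ {U W : Set X}, W ⊆ U → regular U ≤ regular W
  regular_local : ∀ {U : Set X} {f : X → ℂ},
    (∀ x ∈ U, ∃ W, IsOpen[zariski] W ∧ x ∈ W ∧ f ∈ regular (U ∩ W)) → f ∈ regular U
  regular_inv : ∀ {U : Set X} {f : X → ℂ}, IsOpen[zariski] U → f ∈ regular U →
    IsOpen[zariski] {x | x ∈ U ∧ f x ≠ 0} ∧ f⁻¹ ∈ regular {x | x ∈ U ∧ f x ≠ 0}

namespace SpaceWithFunctions

section Basic

variable {X Y : Type*} [SpaceWithFunctions X] [SpaceWithFunctions Y]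

/-- Zariski open subsets. -/
def ZOpen (U : Set X) : Prop := IsOpen[zariski] U

/-- Zariski closure. -/
def zclosure (A : Set X) : Set X := @closure X zariski A

/-- Morphisms: Zariski continuous maps that pull regular functions back to regular functions. -/
def IsMorphism (f : X → Y) : Prop :=
  ∀ W : Set Y, ZOpen W → ZOpen (f ⁻¹' W) ∧ ∀ k ∈ regular W, k ∘ f ∈ regular (f ⁻¹' W)

/-- Isomorphisms: morphisms with an inverse morphism. -/
def IsIsomorphism (f : X → Y) : Prop :=
  IsMorphism f ∧ ∃ g : Y → X, IsMorphism g ∧ Function.LeftInverse g f ∧ Function.RightInverse g f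

variable (X) in
/-- The classical (Euclidean) topology: the coarsest one in which Zariski open sets are open and
regular functions on them are continuous. -/
@[reducible] def classicalTopology : TopologicalSpace X :=
  TopologicalSpace.generateFrom
    {s | ∃ U : Set X, ZOpen U ∧ ∃ f ∈ regular U, ∃ O : Set ℂ, IsOpen O ∧ s = {x | x ∈ U ∧ f x ∈ O}}

end Basic

/-! ### Affine varieties -/

/-- The complex points of the maximal spectrum of the `ℂ`-algebra `A`. -/
abbrev Specm (A : Type*) [CommRing A] [Algebra ℂ A] : Type _ := A →ₐ[ℂ] ℂ

/-- The affine variety of `A`: the principal open sets `q ≠ 0` form a basis of the topology and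
regular functions are locally fractions `p / q`. -/
instance {A : Type*} [CommRing A] [Algebra ℂ A] : SpaceWithFunctions (Specm A) where
  zariski :=
    { IsOpen := fun s => ∀ γ ∈ s, ∃ q : A, γ q ≠ 0 ∧ ∀ δ : Specm A, δ q ≠ 0 → δ ∈ s
      isOpen_univ := fun γ _ => ⟨1, by simp, fun _ _ => trivial⟩
      isOpen_inter := fun s t hs ht γ hγ => by
        obtain ⟨p, hp, hp'⟩ := hs γ hγ.1
        obtain ⟨q, hq, hq'⟩ := ht γ hγ.2
        refine ⟨p * q, by simp [hp, hq], fun δ hδ => ?_⟩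
        rw [map_mul] at hδ
        exact ⟨hp' δ (left_ne_zero_of_mul hδ), hq' δ (right_ne_zero_of_mul hδ)⟩
      isOpen_sUnion := fun S hS γ hγ => by
        obtain ⟨s, hs, hγs⟩ := hγ
        obtain ⟨q, hq, hq'⟩ := hS s hs γ hγs
        exact ⟨q, hq, fun δ hδ => ⟨s, hs, hq' δ hδ⟩⟩ }
  regular U :=
    { carrier := {f | ∀ γ ∈ U, ∃ p q : A, γ q ≠ 0 ∧ ∀ δ ∈ U, δ q ≠ 0 → f δ = δ p / δ q}
      mul_mem' := fun {f g} hf hg γ hγ => by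
        obtain ⟨p, q, hq, h⟩ := hf γ hγ
        obtain ⟨p', q', hq', h'⟩ := hg γ hγ
        refine ⟨p * p', q * q', by simp [hq, hq'], fun δ hδ hn => ?_⟩
        rw [map_mul] at hn
        rw [Pi.mul_apply, h δ hδ (left_ne_zero_of_mul hn), h' δ hδ (right_ne_zero_of_mul hn),
          map_mul, map_mul, div_mul_div_comm]
      add_mem' := fun {f g} hf hg γ hγ => by
        obtain ⟨p, q, hq, h⟩ := hf γ hγ
        obtain ⟨p', q', hq', h'⟩ := hg γ hγ
        refine ⟨p * q' + q * p', q * q', by simp [hq, hq'], fun δ hδ hn => ?_⟩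
        rw [map_mul] at hn
        rw [Pi.add_apply, h δ hδ (left_ne_zero_of_mul hn), h' δ hδ (right_ne_zero_of_mul hn),
          map_add, map_mul, map_mul, map_mul,
          div_add_div _ _ (left_ne_zero_of_mul hn) (right_ne_zero_of_mul hn)]
      algebraMap_mem' := fun c γ _ => ⟨algebraMap ℂ A c, 1, by simp, fun δ _ _ => by simp⟩ }
  regular_congr := fun hf hfg γ hγ => by
    obtain ⟨p, q, hq, h⟩ := hf γ hγ
    exact ⟨p, q, hq, fun δ hδ hn => by rw [← hfg hδ, h δ hδ hn]⟩
  regular_mono := fun hWU f hf γ hγ => by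
    obtain ⟨p, q, hq, h⟩ := hf γ (hWU hγ)
    exact ⟨p, q, hq, fun δ hδ hn => h δ (hWU hδ) hn⟩
  regular_local := fun {U f} H γ hγ => by
    obtain ⟨W, hW, hγW, hf⟩ := H γ hγ
    obtain ⟨p, q, hq, h⟩ := hf γ ⟨hγ, hγW⟩
    obtain ⟨r, hr, hr'⟩ := hW γ hγW
    refine ⟨p * r, q * r, by simp [hq, hr], fun δ hδ hn => ?_⟩
    rw [map_mul] at hn
    rw [h δ ⟨hδ, hr' δ (right_ne_zero_of_mul hn)⟩ (left_ne_zero_of_mul hn), map_mul, map_mul,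
      mul_div_mul_right _ _ (right_ne_zero_of_mul hn)]
  regular_inv := fun {U f} hU hf => by
    constructor
    · intro γ hγ
      obtain ⟨p, q, hq, h⟩ := hf γ hγ.1
      obtain ⟨r, hr, hr'⟩ := hU γ hγ.1
      have hp : γ p ≠ 0 := fun h0 => hγ.2 (by rw [h γ hγ.1 hq, h0, zero_div])
      refine ⟨p * q * r, by simp [hp, hq, hr], fun δ hn => ?_⟩
      rw [map_mul, map_mul] at hn
      have hδ := hr' δ (right_ne_zero_of_mul hn)
      have hpq := left_ne_zero_of_mul hn
      refine ⟨hδ, ?_⟩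
      rw [h δ hδ (right_ne_zero_of_mul hpq)]
      exact div_ne_zero (left_ne_zero_of_mul hpq) (right_ne_zero_of_mul hpq)
    · intro γ hγ
      obtain ⟨p, q, hq, h⟩ := hf γ hγ.1
      have hp : γ p ≠ 0 := fun h0 => hγ.2 (by rw [h γ hγ.1 hq, h0, zero_div])
      refine ⟨q * q, p * q, by simp [hp, hq], fun δ hδ hn => ?_⟩
      rw [map_mul] at hn
      rw [Pi.inv_apply, h δ hδ.1 (right_ne_zero_of_mul hn), map_mul, map_mul, inv_div,
        mul_div_mul_right _ _ (right_ne_zero_of_mul hn)]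

/-! ### Gluing, subvarieties, products with the affine line -/

/-- The structure glued from charts `c i : Y i → X`: a subset is open, and a function on an open
subset is regular, if and only if this is so in every chart. -/
abbrev glued {ι : Type*} {Y : ι → Type*} {X : Type*} [∀ i, SpaceWithFunctions (Y i)]
    (c : ∀ i, Y i → X) : SpaceWithFunctions X where
  zariski :=
    { IsOpen := fun s => ∀ i, IsOpen[zariski] (c i ⁻¹' s)
      isOpen_univ := fun i => (zariski (X := Y i)).isOpen_univ
      isOpen_inter := fun s t hs ht i => (zariski (X := Y i)).isOpen_inter _ _ (hs i) (ht i)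
      isOpen_sUnion := fun S hS i => by
        rw [Set.preimage_sUnion]
        exact @isOpen_biUnion _ _ zariski _ _ fun s hs => hS s hs i }
  regular U :=
    { carrier := {f | ∀ i, f ∘ c i ∈ regular (c i ⁻¹' U)}
      mul_mem' := fun hf hg i => mul_mem (hf i) (hg i)
      add_mem' := fun hf hg i => add_mem (hf i) (hg i)
      algebraMap_mem' := fun r i => (regular (c i ⁻¹' U)).algebraMap_mem r }
  regular_congr := fun hf hfg i => regular_congr (hf i) fun y hy => hfg hy
  regular_mono := fun h f hf i => regular_mono (Set.preimage_mono h) (hf i)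
  regular_local := fun H i => regular_local fun y hy => by
    obtain ⟨W, hW, hyW, hf⟩ := H (c i y) hy
    exact ⟨c i ⁻¹' W, hW i, hyW, hf i⟩
  regular_inv := fun hU hf =>
    ⟨fun i => (regular_inv (hU i) (hf i)).1, fun i => (regular_inv (hU i) (hf i)).2⟩

/-- The induced structure on a (locally closed) subset: regular functions are those that locally
extend to regular functions of the ambient space. -/
instance {X : Type*} [SpaceWithFunctions X] (A : Set X) : SpaceWithFunctions A where
  zariski := TopologicalSpace.induced Subtype.val zariski
  regular U :=
    { carrier := {f | ∀ x ∈ U, ∃ W : Set X, IsOpen[zariski] W ∧ x.1 ∈ W ∧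
        ∃ F ∈ regular W, ∀ y ∈ U, y.1 ∈ W → f y = F y}
      mul_mem' := fun {f g} hf hg x hx => by
        obtain ⟨W, hW, hxW, F, hF, h⟩ := hf x hx
        obtain ⟨W', hW', hxW', F', hF', h'⟩ := hg x hx
        exact ⟨W ∩ W', zariski.isOpen_inter _ _ hW hW', ⟨hxW, hxW'⟩, F * F',
          mul_mem (regular_mono Set.inter_subset_left hF)
            (regular_mono Set.inter_subset_right hF'),
          fun y hy hyW => by simp [h y hy hyW.1, h' y hy hyW.2]⟩
      add_mem' := fun {f g} hf hg x hx => by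
        obtain ⟨W, hW, hxW, F, hF, h⟩ := hf x hx
        obtain ⟨W', hW', hxW', F', hF', h'⟩ := hg x hx
        exact ⟨W ∩ W', zariski.isOpen_inter _ _ hW hW', ⟨hxW, hxW'⟩, F + F',
          add_mem (regular_mono Set.inter_subset_left hF)
            (regular_mono Set.inter_subset_right hF'),
          fun y hy hyW => by simp [h y hy hyW.1, h' y hy hyW.2]⟩
      algebraMap_mem' := fun c x _ => ⟨Set.univ, zariski.isOpen_univ, trivial,
        algebraMap ℂ (X → ℂ) c, (regular Set.univ).algebraMap_mem c, fun _ _ _ => rfl⟩ }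
  regular_congr := fun hf hfg x hx => by
    obtain ⟨W, hW, hxW, F, hF, h⟩ := hf x hx
    exact ⟨W, hW, hxW, F, hF, fun y hy hyW => by rw [← hfg hy, h y hy hyW]⟩
  regular_mono := fun hWU f hf x hx => by
    obtain ⟨W, hW, hxW, F, hF, h⟩ := hf x (hWU hx)
    exact ⟨W, hW, hxW, F, hF, fun y hy hyW => h y (hWU hy) hyW⟩
  regular_local := fun H x hx => by
    obtain ⟨_, ⟨W, hW, rfl⟩, hxW, hf⟩ := H x hx
    obtain ⟨W', hW', hxW', F, hF, h⟩ := hf x ⟨hx, hxW⟩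
    exact ⟨W ∩ W', zariski.isOpen_inter _ _ hW hW', ⟨hxW, hxW'⟩, F,
      regular_mono Set.inter_subset_right hF, fun y hy hyW => h y ⟨hy, hyW.1⟩ hyW.2⟩
  regular_inv := fun {U f} hU hf => by
    obtain ⟨U', hU', rfl⟩ := hU
    constructor
    · refine (@isOpen_iff_forall_mem_open A
        (TopologicalSpace.induced Subtype.val zariski) _).2 fun x hx => ?_
      obtain ⟨W, hW, hxW, F, hF, h⟩ := hf x hx.1
      have hV := (regular_inv (zariski.isOpen_inter _ _ hU' hW)
        (regular_mono Set.inter_subset_right hF)).1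
      refine ⟨Subtype.val ⁻¹' {y | y ∈ U' ∩ W ∧ F y ≠ 0}, ?_, ⟨_, hV, rfl⟩, ⟨⟨hx.1, hxW⟩, ?_⟩⟩
      · intro y hy
        exact ⟨hy.1.1, by rw [h y hy.1.1 hy.1.2]; exact hy.2⟩
      · rw [← h x hx.1 hxW]
        exact hx.2
    · intro x hx
      obtain ⟨W, hW, hxW, F, hF, h⟩ := hf x hx.1
      have hV := regular_inv hW hF
      refine ⟨_, hV.1, ⟨hxW, ?_⟩, _, hV.2, fun y hy hyW => ?_⟩
      · rw [← h x hx.1 hxW]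
        exact hx.2
      · rw [Pi.inv_apply, Pi.inv_apply, h y hy.1 hyW.1]

/-- The value at `z = (x, t)` of a polynomial in `t` whose coefficients are regular on `W`. -/
noncomputable def polyVal {X : Type*} [SpaceWithFunctions X] {W : Set X}
    (p : Polynomial (regular W)) (z : X × ℂ) : ℂ :=
  p.eval₂ ((Pi.evalRingHom (fun _ : X => ℂ) z.1).comp (regular W).val.toRingHom) z.2

/-- Restriction of the coefficients to a smaller set. -/
noncomputable def polyRes {X : Type*} [SpaceWithFunctions X] {W W' : Set X} (h : W' ⊆ W)
    (p : Polynomial (regular W)) : Polynomial (regular W') :=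
  p.map (Subalgebra.inclusion (regular_mono h)).toRingHom

theorem polyVal_res {X : Type*} [SpaceWithFunctions X] {W W' : Set X} (h : W' ⊆ W)
    (p : Polynomial (regular W)) (z : X × ℂ) : polyVal (polyRes h p) z = polyVal p z := by
  simp only [polyVal, polyRes, Polynomial.eval₂_map]
  rfl

theorem polyVal_mul {X : Type*} [SpaceWithFunctions X] {W : Set X}
    (p q : Polynomial (regular W)) (z : X × ℂ) : polyVal (p * q) z = polyVal p z * polyVal q z :=
  Polynomial.eval₂_mul _ _

theorem polyVal_add {X : Type*} [SpaceWithFunctions X] {W : Set X}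
    (p q : Polynomial (regular W)) (z : X × ℂ) : polyVal (p + q) z = polyVal p z + polyVal q z :=
  Polynomial.eval₂_add _ _

theorem polyVal_one {X : Type*} [SpaceWithFunctions X] {W : Set X} (z : X × ℂ) :
    polyVal (1 : Polynomial (regular W)) z = 1 :=
  Polynomial.eval₂_one _ _

/-- The product `X × 𝔸¹`: the sets `{(x, t) | x ∈ W, q (x, t) ≠ 0}` with `W` open and `q` a
polynomial in `t` over the regular functions on `W` form a basis of the topology, and regular
functions are locally fractions `p / q` of such polynomials. -/
noncomputable instance {X : Type*} [SpaceWithFunctions X] : SpaceWithFunctions (X × ℂ) where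
  zariski :=
    { IsOpen := fun s => ∀ z ∈ s, ∃ W : Set X, IsOpen[zariski] W ∧ z.1 ∈ W ∧
        ∃ q : Polynomial (regular W), polyVal q z ≠ 0 ∧ ∀ w : X × ℂ, w.1 ∈ W → polyVal q w ≠ 0 → w ∈ s
      isOpen_univ := fun z _ => ⟨Set.univ, zariski.isOpen_univ, trivial, 1,
        by simp [polyVal_one], fun _ _ _ => trivial⟩
      isOpen_inter := fun s t hs ht z hz => by
        obtain ⟨W, hW, hzW, q, hq, h⟩ := hs z hz.1
        obtain ⟨W', hW', hzW', q', hq', h'⟩ := ht z hz.2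
        refine ⟨W ∩ W', zariski.isOpen_inter _ _ hW hW', ⟨hzW, hzW'⟩,
          polyRes Set.inter_subset_left q * polyRes Set.inter_subset_right q', ?_, ?_⟩
        · rw [polyVal_mul, polyVal_res, polyVal_res]
          exact mul_ne_zero hq hq'
        · intro w hw hn
          rw [polyVal_mul, polyVal_res, polyVal_res] at hn
          exact ⟨h w hw.1 (left_ne_zero_of_mul hn), h' w hw.2 (right_ne_zero_of_mul hn)⟩
      isOpen_sUnion := fun S hS z hz => by
        obtain ⟨s, hs, hzs⟩ := hz
        obtain ⟨W, hW, hzW, q, hq, h⟩ := hS s hs z hzs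
        exact ⟨W, hW, hzW, q, hq, fun w hw hn => ⟨s, hs, h w hw hn⟩⟩ }
  regular U :=
    { carrier := {f | ∀ z ∈ U, ∃ W : Set X, IsOpen[zariski] W ∧ z.1 ∈ W ∧
        ∃ p q : Polynomial (regular W), polyVal q z ≠ 0 ∧
          ∀ w ∈ U, w.1 ∈ W → polyVal q w ≠ 0 → f w = polyVal p w / polyVal q w}
      mul_mem' := fun {f g} hf hg z hz => by
        obtain ⟨W, hW, hzW, p, q, hq, h⟩ := hf z hz
        obtain ⟨W', hW', hzW', p', q', hq', h'⟩ := hg z hz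
        refine ⟨W ∩ W', zariski.isOpen_inter _ _ hW hW', ⟨hzW, hzW'⟩,
          polyRes Set.inter_subset_left p * polyRes Set.inter_subset_right p',
          polyRes Set.inter_subset_left q * polyRes Set.inter_subset_right q', ?_, ?_⟩
        · rw [polyVal_mul, polyVal_res, polyVal_res]
          exact mul_ne_zero hq hq'
        · intro w hw hwW hn
          rw [polyVal_mul, polyVal_res, polyVal_res] at hn
          rw [polyVal_mul, polyVal_mul, polyVal_res, polyVal_res, polyVal_res, polyVal_res,
            Pi.mul_apply, h w hw hwW.1 (left_ne_zero_of_mul hn),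
            h' w hw hwW.2 (right_ne_zero_of_mul hn), div_mul_div_comm]
      add_mem' := fun {f g} hf hg z hz => by
        obtain ⟨W, hW, hzW, p, q, hq, h⟩ := hf z hz
        obtain ⟨W', hW', hzW', p', q', hq', h'⟩ := hg z hz
        refine ⟨W ∩ W', zariski.isOpen_inter _ _ hW hW', ⟨hzW, hzW'⟩,
          polyRes Set.inter_subset_left p * polyRes Set.inter_subset_right q' +
            polyRes Set.inter_subset_left q * polyRes Set.inter_subset_right p',
          polyRes Set.inter_subset_left q * polyRes Set.inter_subset_right q', ?_, ?_⟩
        · rw [polyVal_mul, polyVal_res, polyVal_res]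
          exact mul_ne_zero hq hq'
        · intro w hw hwW hn
          rw [polyVal_mul, polyVal_res, polyVal_res] at hn
          rw [polyVal_add, polyVal_mul, polyVal_mul, polyVal_mul, polyVal_res, polyVal_res,
            polyVal_res, polyVal_res, Pi.add_apply, h w hw hwW.1 (left_ne_zero_of_mul hn),
            h' w hw hwW.2 (right_ne_zero_of_mul hn),
            div_add_div _ _ (left_ne_zero_of_mul hn) (right_ne_zero_of_mul hn)]
      algebraMap_mem' := fun c z _ => ⟨Set.univ, zariski.isOpen_univ, trivial,
        Polynomial.C (algebraMap ℂ _ c), 1, by simp [polyVal_one], fun w _ _ _ => by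
          rw [polyVal_one, div_one]
          simp only [polyVal, Polynomial.eval₂_C]
          rfl⟩ }
  regular_congr := fun hf hfg z hz => by
    obtain ⟨W, hW, hzW, p, q, hq, h⟩ := hf z hz
    exact ⟨W, hW, hzW, p, q, hq, fun w hw hwW hn => by rw [← hfg hw, h w hw hwW hn]⟩
  regular_mono := fun hWU f hf z hz => by
    obtain ⟨W, hW, hzW, p, q, hq, h⟩ := hf z (hWU hz)
    exact ⟨W, hW, hzW, p, q, hq, fun w hw hwW hn => h w (hWU hw) hwW hn⟩
  regular_local := fun {U f} H z hz => by
    obtain ⟨Ω, hΩ, hzΩ, hf⟩ := H z hz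
    obtain ⟨W, hW, hzW, p, q, hq, h⟩ := hf z ⟨hz, hzΩ⟩
    obtain ⟨W', hW', hzW', r, hr, h'⟩ := hΩ z hzΩ
    refine ⟨W ∩ W', zariski.isOpen_inter _ _ hW hW', ⟨hzW, hzW'⟩,
      polyRes Set.inter_subset_left p * polyRes Set.inter_subset_right r,
      polyRes Set.inter_subset_left q * polyRes Set.inter_subset_right r, ?_, ?_⟩
    · rw [polyVal_mul, polyVal_res, polyVal_res]
      exact mul_ne_zero hq hr
    · intro w hw hwW hn
      rw [polyVal_mul, polyVal_res, polyVal_res] at hn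
      rw [polyVal_mul, polyVal_mul, polyVal_res, polyVal_res, polyVal_res,
        mul_div_mul_right _ _ (right_ne_zero_of_mul hn)]
      exact h w ⟨hw, h' w hwW.2 (right_ne_zero_of_mul hn)⟩ hwW.1 (left_ne_zero_of_mul hn)
  regular_inv := fun {U f} hU hf => by
    constructor
    · intro z hz
      obtain ⟨W, hW, hzW, p, q, hq, h⟩ := hf z hz.1
      obtain ⟨W', hW', hzW', r, hr, h'⟩ := hU z hz.1
      have hp : polyVal p z ≠ 0 := fun h0 => hz.2 (by rw [h z hz.1 hzW hq, h0, zero_div])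
      refine ⟨W ∩ W', zariski.isOpen_inter _ _ hW hW', ⟨hzW, hzW'⟩,
        polyRes Set.inter_subset_left (p * q) * polyRes Set.inter_subset_right r, ?_, ?_⟩
      · rw [polyVal_mul, polyVal_res, polyVal_res, polyVal_mul]
        exact mul_ne_zero (mul_ne_zero hp hq) hr
      · intro w hwW hn
        rw [polyVal_mul, polyVal_res, polyVal_res, polyVal_mul] at hn
        have hw := h' w hwW.2 (right_ne_zero_of_mul hn)
        have hpq := left_ne_zero_of_mul hn
        refine ⟨hw, ?_⟩
        rw [h w hw hwW.1 (right_ne_zero_of_mul hpq)]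
        exact div_ne_zero (left_ne_zero_of_mul hpq) (right_ne_zero_of_mul hpq)
    · intro z hz
      obtain ⟨W, hW, hzW, p, q, hq, h⟩ := hf z hz.1
      have hp : polyVal p z ≠ 0 := fun h0 => hz.2 (by rw [h z hz.1 hzW hq, h0, zero_div])
      refine ⟨W, hW, hzW, q * q, p * q, ?_, fun w hw hwW hn => ?_⟩
      · rw [polyVal_mul]
        exact mul_ne_zero hp hq
      · rw [polyVal_mul] at hn
        rw [Pi.inv_apply, h w hw.1 hwW (right_ne_zero_of_mul hn), polyVal_mul, polyVal_mul, inv_div,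
          mul_div_mul_right _ _ (right_ne_zero_of_mul hn)]

section Bundles

variable {X Y E T ι : Type*} [SpaceWithFunctions X] [SpaceWithFunctions Y] [SpaceWithFunctions E]
  [SpaceWithFunctions T]

/-- Open immersions: isomorphisms onto a Zariski open subset. -/
def IsOpenImmersion (f : X → Y) : Prop :=
  ZOpen (Set.range f) ∧ IsIsomorphism (Set.rangeFactorization f)

/-! ### Divisors, the sheaf of a divisor and total spaces -/

/-- `h` is a local equation on the open set `W` of the closed subset `Z`: it generates the ideal
sheaf of `Z` over `W`. -/
def IsLocalEquation (W Z : Set E) (h : E → ℂ) : Prop :=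
  h ∈ regular W ∧ (∀ x ∈ W ∩ Z, h x = 0) ∧
    ∀ W' ⊆ W, ZOpen W' → ∀ k ∈ regular W', (∀ x ∈ W' ∩ Z, k x = 0) →
      ∃ q ∈ regular W', ∀ x ∈ W', k x = q x * h x

/-- `f` is a section over `U` of the sheaf `𝒪(D)`, `D = ∑ i, a i • Z i`, a finite formal sum of
prime divisors: a function on `U ∖ ⋃ i, Z i` (values elsewhere are irrelevant) such that locally
`f * ∏ i, h i ^ a i` extends to a regular function, where `h i` is a local equation of `Z i`. -/
def IsDivisorSection (Z : ι → Set E) (a : ι → ℤ) (U : Set E) (f : E → ℂ) : Prop :=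
  ∀ x ∈ U, ∃ W ⊆ U, ZOpen W ∧ x ∈ W ∧ ∃ h : ι → E → ℂ, (∀ i, IsLocalEquation W (Z i) (h i)) ∧
    ∃ k ∈ regular W, ∀ y ∈ W \ ⋃ i, Z i, f y * ∏ᶠ i, h i y ^ a i = k y

/-- `t` is a trivializing fibre coordinate of `π : T → E` over the open set `U`: the map `(π, t)` is
an isomorphism from the preimage of `U` to `U × 𝔸¹`. -/
def IsTrivialization (π : T → E) (U : Set E) (t : T → ℂ) : Prop :=
  ZOpen U ∧ IsIsomorphism (fun v : π ⁻¹' U => ((⟨π v.1, v.2⟩, t v.1) : U × ℂ))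

/-- An atlas making `π : T → E` a line bundle: trivializations over an open cover of `E`, any two
of which differ by multiplication with an invertible regular function on the base. -/
structure IsLineBundleAtlas (π : T → E) (A : Set (Set E × (T → ℂ))) : Prop where
  isMorphism : IsMorphism π
  trivialization : ∀ c ∈ A, IsTrivialization π c.1 c.2
  cover : ∀ x : E, ∃ c ∈ A, x ∈ c.1
  linear : ∀ c ∈ A, ∀ c' ∈ A, ∃ u ∈ regular (c.1 ∩ c'.1), (∀ x ∈ c.1 ∩ c'.1, u x ≠ 0) ∧
    ∀ v : T, π v ∈ c.1 ∩ c'.1 → c'.2 v = u (π v) * c.2 v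

/-- `s` is a regular section of `π` over `U`. -/
def IsSection (π : T → E) (U : Set E) (s : U → T) : Prop :=
  IsMorphism s ∧ ∀ x : U, π (s x) = x

/-- The sheaf of sections of the line bundle `π` with atlas `A` is isomorphic, as a sheaf of
`𝒪_E`-modules, to `𝒪_E(D)` with `D = ∑ i, a i • Z i`. Sections of `𝒪_E(D)` over `U` are identified
when they agree on `U ∖ ⋃ i, Z i`. -/
def HasSheafOfSections (π : T → E) (A : Set (Set E × (T → ℂ))) (Z : ι → Set E) (a : ι → ℤ) : Prop :=
  ∃ Φ : ∀ U : Set E, (U → T) → (E → ℂ),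
    (∀ U, ZOpen U → ∀ s, IsSection π U s → IsDivisorSection Z a U (Φ U s)) ∧
    (∀ U, ZOpen U → ∀ s s', IsSection π U s → IsSection π U s' →
      Set.EqOn (Φ U s) (Φ U s') (U \ ⋃ i, Z i) → s = s') ∧
    (∀ U, ZOpen U → ∀ f, IsDivisorSection Z a U f →
      ∃ s, IsSection π U s ∧ Set.EqOn (Φ U s) f (U \ ⋃ i, Z i)) ∧
    (∀ U W, ZOpen U → ZOpen W → ∀ hWU : W ⊆ U, ∀ s, IsSection π U s →
      Set.EqOn (Φ W (s ∘ Set.inclusion hWU)) (Φ U s) (W \ ⋃ i, Z i)) ∧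
    (∀ U, ZOpen U → ∀ s₁ s₂ s₃, IsSection π U s₁ → IsSection π U s₂ → IsSection π U s₃ →
      ∀ r ∈ regular U,
      (∀ c ∈ A, ∀ x : U, x.1 ∈ c.1 → c.2 (s₃ x) = r x * c.2 (s₁ x) + c.2 (s₂ x)) →
      Set.EqOn (Φ U s₃) (r * Φ U s₁ + Φ U s₂) (U \ ⋃ i, Z i))

/-- `π : T → E` is the total space of the line bundle `𝒪_E(D)`, `D = ∑ i, a i • Z i`, and the map
`z : E → T` is its zero section. -/
def IsTotalSpace (π : T → E) (z : E → T) (Z : ι → Set E) (a : ι → ℤ) : Prop :=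
  ∃ A : Set (Set E × (T → ℂ)), IsLineBundleAtlas π A ∧ HasSheafOfSections π A Z a ∧
    IsSection π Set.univ (fun x => z x.1) ∧ ∀ c ∈ A, ∀ x ∈ c.1, c.2 (z x) = 0

end Bundles

end SpaceWithFunctions

/-- `A` is a strong deformation retract of `X`. -/
def IsStrongDeformationRetract {X : Type*} [TopologicalSpace X] (A : Set X) : Prop :=
  ∃ r : C(X, X), (∀ x, r x ∈ A) ∧ (ContinuousMap.id X).HomotopicRel r A

/-! ## Toric varieties

`L` is a lattice in the real vector space `V`, and a fan is a set of cones in `V`. -/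

namespace Toric

open SpaceWithFunctions

section General

variable {V : Type*} [AddCommGroup V] [Module ℝ V] (L : AddSubgroup V)

/-- The dual lattice `M`, as a group of linear forms on `V`. -/
def dualLattice : AddSubgroup (Module.Dual ℝ V) where
  carrier := {m | ∀ u ∈ L, ∃ k : ℤ, m u = k}
  zero_mem' := fun _ _ => ⟨0, by simp⟩
  add_mem' := fun {m m'} hm hm' u hu => by
    obtain ⟨k, hk⟩ := hm u hu
    obtain ⟨k', hk'⟩ := hm' u hu
    exact ⟨k + k', by simp [hk, hk']⟩
  neg_mem' := fun {m} hm u hu => by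
    obtain ⟨k, hk⟩ := hm u hu
    exact ⟨-k, by simp [hk]⟩

/-- The monoid `σ^∨ ∩ M`. -/
def dualMonoid (σ : PointedCone ℝ V) : AddSubmonoid (Module.Dual ℝ V) where
  carrier := {m | m ∈ dualLattice L ∧ ∀ u ∈ σ, 0 ≤ m u}
  zero_mem' := ⟨zero_mem _, fun _ _ => le_rfl⟩
  add_mem' := fun hm hm' => ⟨add_mem hm.1 hm'.1, fun u hu => add_nonneg (hm.2 u hu) (hm'.2 u hu)⟩

/-- The coordinate ring `ℂ[σ^∨ ∩ M]`. -/
abbrev CoordRing (σ : PointedCone ℝ V) : Type _ := AddMonoidAlgebra ℂ (dualMonoid L σ)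

/-- The affine toric variety `U_σ = Specm ℂ[σ^∨ ∩ M]`. -/
abbrev AffineToric (σ : PointedCone ℝ V) : Type _ := Specm (CoordRing L σ)

/-- The character `χ^m` as an element of `ℂ[σ^∨ ∩ M]`. -/
noncomputable def character {σ : PointedCone ℝ V} (m : dualMonoid L σ) : CoordRing L σ :=
  AddMonoidAlgebra.single m 1

theorem dualMonoid_anti {τ σ : PointedCone ℝ V} (h : τ ≤ σ) : dualMonoid L σ ≤ dualMonoid L τ :=
  fun _ hm => ⟨hm.1, fun u hu => hm.2 u (h hu)⟩

/-- The toric morphism `U_τ → U_σ` for `τ ⊆ σ`: restriction along `ℂ[σ^∨ ∩ M] ⊆ ℂ[τ^∨ ∩ M]`. -/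
noncomputable def restrict {τ σ : PointedCone ℝ V} (h : τ ≤ σ) (γ : AffineToric L τ) :
    AffineToric L σ :=
  γ.comp (AddMonoidAlgebra.mapDomainAlgHom ℂ ℂ (AddSubmonoid.inclusion (dualMonoid_anti L h)))

/-- `F` is a fan: a finite, nonempty set of strongly convex rational polyhedral cones, closed under
faces, any two of which meet in a common face. -/
structure IsFan (F : Set (PointedCone ℝ V)) : Prop where
  finite : F.Finite
  nonempty : F.Nonempty
  rational : ∀ σ ∈ F, ∃ S : Set V, S.Finite ∧ S ⊆ L ∧ σ = PointedCone.hull ℝ S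
  stronglyConvex : ∀ σ ∈ F, ∀ u ∈ σ, -u ∈ σ → u = 0
  face_mem : ∀ σ ∈ F, ∀ τ : PointedCone ℝ V, τ.IsFaceOf σ → τ ∈ F
  inter_isFace : ∀ σ ∈ F, ∀ τ ∈ F, (σ ⊓ τ).IsFaceOf σ ∧ (σ ⊓ τ).IsFaceOf τ

/-- A cone is smooth if it is generated by a part of a basis of the lattice. -/
def IsSmoothCone (σ : PointedCone ℝ V) : Prop :=
  ∃ (k : ℕ) (b : Module.Basis (Fin k) ℤ L) (s : Set (Fin k)),
    σ = PointedCone.hull ℝ ((fun i => (b i : V)) '' s)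

/-- The fan `F` refines the cone `σ`. -/
def IsRefinement (F : Set (PointedCone ℝ V)) (σ : PointedCone ℝ V) : Prop :=
  IsFan L F ∧ (⋃ τ ∈ F, (τ : Set V)) = σ

/-- The ray generators of a fan: the primitive lattice vectors on its one-dimensional cones. -/
def rayGenerators (F : Set (PointedCone ℝ V)) : Set V :=
  {u | u ∈ L ∧ u ≠ 0 ∧ PointedCone.hull ℝ {u} ∈ F ∧
    ∀ v ∈ L, v ∈ PointedCone.hull ℝ {u} → ∃ k : ℕ, v = k • u}

/-- The Hilbert basis of a strongly convex cone: the nonzero irreducible elements of `σ ∩ L`. -/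
def hilbertBasis (σ : PointedCone ℝ V) : Set V :=
  {u | u ∈ L ∧ u ∈ σ ∧ u ≠ 0 ∧ ∀ v ∈ L, ∀ w ∈ L, v ∈ σ → w ∈ σ → u = v + w → v = 0 ∨ w = 0}

/-- The fan `F` defines a Hilbert basis resolution of the affine toric variety `U_σ`. -/
def IsHilbertBasisResolution (F : Set (PointedCone ℝ V)) (σ : PointedCone ℝ V) : Prop :=
  IsRefinement L F σ ∧ (∀ τ ∈ F, IsSmoothCone L τ) ∧ rayGenerators L F = hilbertBasis L σ

/-- The fan of all faces of those full-dimensional cones of `F` that have `ρ` as a face. -/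
def starNeighborhood (F : Set (PointedCone ℝ V)) (ρ : PointedCone ℝ V) : Set (PointedCone ℝ V) :=
  {τ | ∃ η ∈ F, Module.finrank ℝ (Submodule.span ℝ (η : Set V)) = Module.finrank ℝ V ∧
    ρ.IsFaceOf η ∧ τ.IsFaceOf η}

/-- Gluing of the affine charts `U_σ`, `σ ∈ F`, along `U_τ ⊆ U_σ` for `τ ⊆ σ` in `F`. -/
def Glue (F : Set (PointedCone ℝ V)) (x y : Σ σ : F, AffineToric L σ.1) : Prop :=
  ∃ h : x.1.1 ≤ y.1.1, restrict L h x.2 = y.2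

/-- The toric variety of the fan `F`. -/
def ToricVariety (F : Set (PointedCone ℝ V)) : Type _ := Quot (Glue L F)

variable (F : Set (PointedCone ℝ V))

/-- The affine chart `U_σ → X_F`. -/
def chart (σ : F) (γ : AffineToric L σ.1) : ToricVariety L F := Quot.mk _ ⟨σ, γ⟩

noncomputable instance : SpaceWithFunctions (ToricVariety L F) := glued (chart L F)

/-- The torus orbit `O(τ)`: the points of `U_τ` at which exactly the characters in `τ^⊥` do not
vanish. -/
def orbit (τ : PointedCone ℝ V) : Set (ToricVariety L F) :=
  {x | ∃ (h : τ ∈ F) (γ : AffineToric L τ), x = chart L F ⟨τ, h⟩ γ ∧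
    ∀ m : dualMonoid L τ, γ (character L m) ≠ 0 ↔ ∀ u ∈ τ, m.1 u = 0}

/-- The orbit closure `V(τ)`. -/
def orbitClosure (τ : PointedCone ℝ V) : Set (ToricVariety L F) := zclosure (orbit L F τ)

/-- The toric morphism (the identity on charts) `X_F → X_F'` for fans `F ⊆ F'`. -/
def inclusion {F F' : Set (PointedCone ℝ V)} (h : F ⊆ F') (x : ToricVariety L F) :
    ToricVariety L F' :=
  Quot.lift (r := Glue L F) (fun y => chart L F' ⟨y.1.1, h y.1.2⟩ y.2)
    (fun _ _ hxy => Quot.sound hxy) x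

end General

/-! ## Abelian quotient singularities -/

section Quotient

variable {n : ℕ}

/-- `v` is the fractional expression of `g` with respect to the primitive `r`-th root of unity `ε`
and the eigenbasis `b`: `g = diag(ε ^ a₁, …, ε ^ aₙ)` in the basis `b` with `0 ≤ aᵢ < r`, and
`v = (a₁, …, aₙ) / r`. -/
def IsFractionalExpression (r : ℕ) (ε : ℂ) (b : Module.Basis (Fin n) ℂ (Fin n → ℂ))
    (g : Matrix.SpecialLinearGroup (Fin n) ℂ) (v : Fin n → ℝ) : Prop :=
  ∃ a : Fin n → ℕ, ∀ i, a i < r ∧ g.1.mulVec (b i) = ε ^ a i • b i ∧ v i = (a i : ℝ) / r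

/-- The lattice `N = ℤⁿ + ∑ ℤ ĝ`, the sum being over `g ∈ G`. -/
def lattice (G : Subgroup (Matrix.SpecialLinearGroup (Fin n) ℂ)) (ε : ℂ)
    (b : Module.Basis (Fin n) ℂ (Fin n → ℂ)) : AddSubgroup (Fin n → ℝ) :=
  AddSubgroup.closure (Set.range (fun i => (Pi.single i 1 : Fin n → ℝ)) ∪
    {v | ∃ g ∈ G, IsFractionalExpression (Nat.card G) ε b g v})

variable (n) in
/-- The cone `σ = Cone(e₁, …, eₙ)`. -/
def orthant : PointedCone ℝ (Fin n → ℝ) :=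
  PointedCone.hull ℝ (Set.range fun i => (Pi.single i 1 : Fin n → ℝ))

/-- The age of a vector. -/
def age (v : Fin n → ℝ) : ℝ := ∑ i, v i

/-- The ray generators `u ≠ v` of `F` that span with `v` a cone of `F`. Their classes modulo `v` are
the ray generators of the star fan of `Cone(v)` when `F` is smooth. -/
def starRays (L : AddSubgroup (Fin n → ℝ)) (F : Set (PointedCone ℝ (Fin n → ℝ)))
    (v : Fin n → ℝ) : Set (Fin n → ℝ) :=
  {u | u ∈ rayGenerators L F ∧ u ≠ v ∧ PointedCone.hull ℝ {v, u} ∈ F}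

end Quotient

end Toric

/-!
The primitive vector `v` of the ray generates a one-parameter subgroup `λ` of the torus, and on the
star of the ray the limit `lim_{t → 0} λ(t) x` exists for every `x` and lies in the divisor `E`.
The map sending `x` to this limit is the bundle projection, and `λ` restricted to `0 ≤ t ≤ 1`
contracts the variety to `E`. In the chart of a smooth cone through `v`, the character dual to `v`
is a linear coordinate on the fibres. A character `χ^w` with `w(v) = 1` is a rational coordinate on
the fibres of the whole bundle; it vanishes to order `w(u)` along the divisor of each further ray
`u`, so the bundle is `𝒪_E(-∑ w(u) D_u)`. For a junior element, `w` can be the age.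
-/

namespace SpaceWithFunctions

section Morphisms

variable {X Y Z : Type*} [SpaceWithFunctions X] [SpaceWithFunctions Y] [SpaceWithFunctions Z]

theorem zOpen_univ : ZOpen (Set.univ : Set X) := zariski.isOpen_univ

theorem ZOpen.inter {U W : Set X} (hU : ZOpen U) (hW : ZOpen W) : ZOpen (U ∩ W) :=
  zariski.isOpen_inter _ _ hU hW

theorem zOpen_of_local {U : Set X} (h : ∀ x ∈ U, ∃ W, ZOpen W ∧ x ∈ W ∧ W ⊆ U) : ZOpen U :=
  (@isOpen_iff_forall_mem_open X zariski U).2 fun x hx => by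
    obtain ⟨W, hW, hxW, hWU⟩ := h x hx
    exact ⟨W, hWU, hW, hxW⟩

theorem regular_of_local {U : Set X} {f : X → ℂ}
    (h : ∀ x ∈ U, ∃ W, ZOpen W ∧ x ∈ W ∧ ∃ g ∈ regular W, Set.EqOn f g (U ∩ W)) :
    f ∈ regular U :=
  regular_local fun x hx => by
    obtain ⟨W, hW, hxW, g, hg, hfg⟩ := h x hx
    exact ⟨W, hW, hxW, regular_congr (regular_mono Set.inter_subset_right hg) hfg.symm⟩

theorem regular_inv_of_ne_zero {U : Set X} (hU : ZOpen U) {q : X → ℂ} (hq : q ∈ regular U)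
    (h : ∀ x ∈ U, q x ≠ 0) : q⁻¹ ∈ regular U := by
  have hset : {x | x ∈ U ∧ q x ≠ 0} = U := Set.ext fun x => and_iff_left_of_imp (h x)
  exact hset ▸ (regular_inv hU hq).2

theorem regular_zpow_of_ne_zero {U : Set X} (hU : ZOpen U) {q : X → ℂ} (hq : q ∈ regular U)
    (h : ∀ x ∈ U, q x ≠ 0) (k : ℤ) : q ^ k ∈ regular U := by
  cases k with
  | ofNat k => simpa using pow_mem hq k
  | negSucc k =>
    rw [zpow_negSucc, ← inv_pow]
    exact pow_mem (regular_inv_of_ne_zero hU hq h) _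

theorem IsMorphism.comp {g : Y → Z} {f : X → Y} (hg : IsMorphism g) (hf : IsMorphism f) :
    IsMorphism (g ∘ f) := fun W hW =>
  ⟨(hf _ (hg W hW).1).1, fun k hk => (hf _ (hg W hW).1).2 _ ((hg W hW).2 k hk)⟩

theorem isMorphism_val (A : Set X) : IsMorphism (Subtype.val : A → X) := fun W hW =>
  ⟨⟨W, hW, rfl⟩, fun k hk _ hx => ⟨W, hW, hx, k, hk, fun _ _ _ => rfl⟩⟩

theorem isMorphism_codRestrict {f : Y → X} (hf : IsMorphism f) {A : Set X} (h : ∀ y, f y ∈ A) :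
    IsMorphism (fun y => (⟨f y, h y⟩ : A)) := by
  rintro _ ⟨W, hW, rfl⟩
  refine ⟨(hf W hW).1, fun k hk => regular_of_local fun y hy => ?_⟩
  obtain ⟨W', hW', hyW', F, hF, hkF⟩ := hk ⟨f y, h y⟩ hy
  refine ⟨f ⁻¹' W', (hf W' hW').1, hyW', F ∘ f, (hf W' hW').2 F hF, fun y' hy' => ?_⟩
  exact hkF ⟨f y', h y'⟩ hy'.1 hy'.2

/-- Isomorphisms onto Zariski open subsets, expressed through images of open sets instead of an
inverse map on the range. -/
structure IsOpenEmb (f : X → Y) : Prop where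
  injective : Function.Injective f
  isMorphism : IsMorphism f
  zOpen_image : ∀ U, ZOpen U → ZOpen (f '' U)
  regular_image : ∀ U, ZOpen U → ∀ k : Y → ℂ, k ∘ f ∈ regular U → k ∈ regular (f '' U)

theorem IsOpenEmb.zOpen_range {f : X → Y} (hf : IsOpenEmb f) : ZOpen (Set.range f) := by
  rw [← Set.image_univ]
  exact hf.zOpen_image _ zOpen_univ

theorem IsOpenEmb.isOpenImmersion {f : X → Y} (hf : IsOpenEmb f) : IsOpenImmersion f := by
  refine ⟨hf.zOpen_range, isMorphism_codRestrict hf.isMorphism Set.mem_range_self,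
    fun y => y.2.choose, fun W hW => ?_, fun x => hf.injective (Set.mem_range_self x).choose_spec,
    fun y => Subtype.ext y.2.choose_spec⟩
  have hpre : (fun y : Set.range f => y.2.choose) ⁻¹' W = Subtype.val ⁻¹' (f '' W) := by
    ext y
    constructor
    · exact fun hy => ⟨_, hy, y.2.choose_spec⟩
    · rintro ⟨x, hx, hxy⟩
      rw [Set.mem_preimage, hf.injective (y.2.choose_spec.trans hxy.symm)]
      exact hx
  rw [hpre]
  refine ⟨⟨_, hf.zOpen_image W hW, rfl⟩, fun k hk y hy => ⟨f '' W, hf.zOpen_image W hW, hy,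
    Function.extend f k 0, hf.regular_image W hW _ ?_, fun z _ _ => ?_⟩⟩
  · rwa [Function.extend_comp hf.injective]
  · conv_rhs => rw [← z.2.choose_spec]
    rw [hf.injective.extend_apply]
    rfl

theorem isOpenEmb_val {A : Set X} (hA : ZOpen A) : IsOpenEmb (Subtype.val : A → X) where
  injective := Subtype.val_injective
  isMorphism := isMorphism_val A
  zOpen_image := by
    rintro _ ⟨W, hW, rfl⟩
    rw [Subtype.image_preimage_coe]
    exact hA.inter hW
  regular_image := by
    intro U _ k hk
    refine regular_of_local ?_
    rintro _ ⟨x, hx, rfl⟩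
    obtain ⟨W, hW, hxW, F, hF, h⟩ := hk x hx
    refine ⟨W, hW, hxW, F, hF, ?_⟩
    rintro _ ⟨⟨y, hy, rfl⟩, hyW⟩
    exact h y hy hyW

theorem isMorphism_of_cover {ι : Type*} {T : ι → Type*} [∀ i, SpaceWithFunctions (T i)]
    {c : ∀ i, T i → X} (hc : ∀ i, IsOpenEmb (c i)) (hcov : ∀ x, ∃ i, x ∈ Set.range (c i))
    {f : X → Y} (hf : ∀ i, IsMorphism (f ∘ c i)) : IsMorphism f := by
  intro W hW
  have himage : ∀ i, c i '' ((f ∘ c i) ⁻¹' W) ⊆ f ⁻¹' W := by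
    rintro i _ ⟨t, ht, rfl⟩
    exact ht
  refine ⟨zOpen_of_local fun x hx => ?_, fun k hk => regular_of_local fun x hx => ?_⟩
  · obtain ⟨i, t, rfl⟩ := hcov x
    exact ⟨_, (hc i).zOpen_image _ (hf i W hW).1, ⟨t, hx, rfl⟩, himage i⟩
  · obtain ⟨i, t, rfl⟩ := hcov x
    exact ⟨_, (hc i).zOpen_image _ (hf i W hW).1, ⟨t, hx, rfl⟩, k ∘ f,
      (hc i).regular_image _ (hf i W hW).1 _ ((hf i W hW).2 k hk), fun _ _ => rfl⟩

theorem regular_restrict {A : Set X} {W : Set X} (hW : ZOpen W) {k : X → ℂ} (hk : k ∈ regular W)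
    {U : Set A} (hU : ∀ x ∈ U, x.1 ∈ W) : (fun x : A => k x.1) ∈ regular U :=
  regular_mono hU ((isMorphism_val A W hW).2 k hk)

end Morphisms

section Affine

variable {A : Type*} [CommRing A] [Algebra ℂ A] {Y : Type*} [SpaceWithFunctions Y]

theorem regular_eval (a : A) (U : Set (Specm A)) : (fun γ : Specm A => γ a) ∈ regular U :=
  fun γ _ => ⟨a, 1, by simp, fun δ _ _ => by simp⟩

theorem zOpen_ne_zero (a : A) : ZOpen {γ : Specm A | γ a ≠ 0} :=
  fun _ hγ => ⟨a, hγ, fun _ hδ => hδ⟩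

theorem isMorphism_specm {f : Y → Specm A}
    (h : ∀ a : A, (fun y => f y a) ∈ regular (Set.univ : Set Y)) : IsMorphism f := by
  have hopen : ∀ a : A, ZOpen {y | f y a ≠ 0} := fun a => by
    have := (regular_inv zOpen_univ (h a)).1
    simp only [Set.mem_univ, true_and] at this
    exact this
  refine fun W hW => ⟨zOpen_of_local fun y hy => ?_, fun k hk => regular_of_local fun y hy => ?_⟩
  · obtain ⟨q, hq, hqW⟩ := hW (f y) hy
    exact ⟨_, hopen q, hq, fun y' hy' => hqW _ hy'⟩
  · obtain ⟨p, q, hq, hk⟩ := hk (f y) hy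
    refine ⟨_, hopen q, hq, (fun y => f y p) * (fun y => f y q)⁻¹, mul_mem ?_ ?_, fun y' hy' => ?_⟩
    · exact regular_mono (Set.subset_univ _) (h p)
    · exact regular_inv_of_ne_zero (hopen q) (regular_mono (Set.subset_univ _) (h q)) fun _ hx => hx
    · simp [hk (f y') hy'.1 hy'.2, div_eq_mul_inv]

end Affine

section Product

variable {X Y : Type*} [SpaceWithFunctions X] [SpaceWithFunctions Y]

theorem isMorphism_fst : IsMorphism (Prod.fst : X × ℂ → X) := fun W hW =>
  ⟨fun z hz => ⟨W, hW, hz, 1, by simp [polyVal_one], fun _ hw _ => hw⟩,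
    fun k hk z hz => ⟨W, hW, hz, Polynomial.C ⟨k, hk⟩, 1, by simp [polyVal_one], fun w _ _ _ => by
      rw [polyVal_one, div_one]
      simp only [polyVal, Polynomial.eval₂_C]
      rfl⟩⟩

theorem regular_snd (U : Set (X × ℂ)) : (Prod.snd : X × ℂ → ℂ) ∈ regular U := fun z _ =>
  ⟨Set.univ, zOpen_univ, trivial, Polynomial.X, 1, by simp [polyVal_one], fun w _ _ _ => by
    rw [polyVal_one, div_one]
    simp only [polyVal, Polynomial.eval₂_X]⟩

theorem regular_polyVal {f : Y → X} {t : Y → ℂ} (hf : IsMorphism f)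
    (ht : t ∈ regular (Set.univ : Set Y)) {W : Set X} (hW : ZOpen W)
    (p : Polynomial (regular W)) : (fun y => polyVal p (f y, t y)) ∈ regular (f ⁻¹' W) := by
  induction p using Polynomial.induction_on' with
  | add p q hp hq =>
    simp only [polyVal_add]
    exact add_mem hp hq
  | monomial k a =>
    have : (fun y => polyVal (Polynomial.monomial k a) (f y, t y)) = (a.1 ∘ f) * t ^ k := by
      ext y
      simp only [polyVal, Polynomial.eval₂_monomial]
      rfl
    rw [this]
    exact mul_mem ((hf W hW).2 _ a.2) (pow_mem (regular_mono (Set.subset_univ _) ht) k)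

theorem isMorphism_prodMk {f : Y → X} {t : Y → ℂ} (hf : IsMorphism f)
    (ht : t ∈ regular (Set.univ : Set Y)) : IsMorphism (fun y => (f y, t y)) := by
  have hopen : ∀ {W : Set X} (_ : ZOpen W) (q : Polynomial (regular W)),
      ZOpen {y | y ∈ f ⁻¹' W ∧ polyVal q (f y, t y) ≠ 0} := fun hW q =>
    (regular_inv (hf _ hW).1 (regular_polyVal hf ht hW q)).1
  refine fun S hS => ⟨zOpen_of_local fun y hy => ?_, fun k hk => regular_of_local fun y hy => ?_⟩
  · obtain ⟨W, hW, hyW, q, hq, h⟩ := hS _ hy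
    exact ⟨_, hopen hW q, ⟨hyW, hq⟩, fun y' hy' => h _ hy'.1 hy'.2⟩
  · obtain ⟨W, hW, hyW, p, q, hq, h⟩ := hk _ hy
    refine ⟨_, hopen hW q, ⟨hyW, hq⟩,
      (fun y => polyVal p (f y, t y)) * (fun y => polyVal q (f y, t y))⁻¹,
      mul_mem ?_ ?_, fun y' hy' => ?_⟩
    · exact regular_mono (fun _ h => h.1) (regular_polyVal hf ht hW p)
    · exact regular_inv_of_ne_zero (hopen hW q)
        (regular_mono (fun _ h => h.1) (regular_polyVal hf ht hW q)) fun _ hx => hx.2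
    · simp [h _ hy'.1 hy'.2.1 hy'.2.2, div_eq_mul_inv]

end Product

section Classical

variable {X Y : Type*} [SpaceWithFunctions X] [SpaceWithFunctions Y]

theorem IsMorphism.continuous {f : X → Y} (hf : IsMorphism f) :
    @Continuous _ _ (classicalTopology X) (classicalTopology Y) f := by
  let _ := classicalTopology X
  refine continuous_generateFrom_iff.2 ?_
  rintro _ ⟨U, hU, k, hk, O, hO, rfl⟩
  exact TopologicalSpace.isOpen_generateFrom_of_mem
    ⟨f ⁻¹' U, (hf U hU).1, k ∘ f, (hf U hU).2 k hk, O, hO, rfl⟩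

theorem ZOpen.isOpen_classical {U : Set X} (hU : ZOpen U) : IsOpen[classicalTopology X] U :=
  TopologicalSpace.isOpen_generateFrom_of_mem
    ⟨U, hU, 1, one_mem _, Set.univ, isOpen_univ, by simp⟩

theorem IsOpenEmb.isOpenMap {f : X → Y} (hf : IsOpenEmb f) :
    @IsOpenMap _ _ (classicalTopology X) (classicalTopology Y) f := by
  intro s hs
  induction hs with
  | basic s h =>
    obtain ⟨U, hU, k, hk, O, hO, rfl⟩ := h
    refine TopologicalSpace.isOpen_generateFrom_of_mem
      ⟨f '' U, hf.zOpen_image U hU, Function.extend f k 0, hf.regular_image U hU _ ?_, O, hO, ?_⟩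
    · rwa [Function.extend_comp hf.injective]
    · ext y
      constructor
      · rintro ⟨x, hx, rfl⟩
        refine ⟨⟨x, hx.1, rfl⟩, ?_⟩
        rw [hf.injective.extend_apply]
        exact hx.2
      · rintro ⟨⟨x, hx, rfl⟩, h⟩
        rw [hf.injective.extend_apply] at h
        exact ⟨x, ⟨hx, h⟩, rfl⟩
  | univ =>
    rw [Set.image_univ]
    exact hf.zOpen_range.isOpen_classical
  | inter s t _ _ hs ht =>
    rw [Set.image_inter hf.injective]
    exact (classicalTopology Y).isOpen_inter _ _ hs ht
  | sUnion S _ h =>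
    rw [Set.image_sUnion]
    refine @isOpen_sUnion _ (classicalTopology Y) _ ?_
    rintro _ ⟨s, hs, rfl⟩
    exact h s hs

theorem continuous_of_regular {k : X → ℂ} (hk : k ∈ regular (Set.univ : Set X)) :
    @Continuous _ _ (classicalTopology X) _ k := by
  let _ := classicalTopology X
  refine continuous_def.2 fun O hO => ?_
  exact TopologicalSpace.isOpen_generateFrom_of_mem ⟨Set.univ, zOpen_univ, k, hk, O, hO, by
    ext; simp⟩

theorem continuous_specm {A : Type*} [CommRing A] [Algebra ℂ A] {T : Type*} [TopologicalSpace T]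
    {f : T → Specm A} (h : ∀ a, Continuous fun t => f t a) :
    @Continuous _ _ _ (classicalTopology (Specm A)) f := by
  refine continuous_generateFrom_iff.2 ?_
  rintro _ ⟨U, hU, k, hk, O, hO, rfl⟩
  refine isOpen_iff_mem_nhds.2 fun t ht => ?_
  obtain ⟨p, q, hq, hpq⟩ := hk (f t) ht.1
  obtain ⟨r, hr, hrU⟩ := hU (f t) ht.1
  have hk' : ContinuousAt (fun t => f t p / f t q) t := (h p).continuousAt.div (h q).continuousAt hq
  have hO' : O ∈ 𝓝 (f t p / f t q) := by
    rw [← hpq _ ht.1 hq]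
    exact hO.mem_nhds ht.2
  filter_upwards [hk' hO', (h q).continuousAt.eventually_ne hq, (h r).continuousAt.eventually_ne hr]
    with t' h1 h2 h3
  have hU' := hrU _ h3
  exact ⟨hU', by rw [hpq _ hU' h2]; exact h1⟩

end Classical

section Gluing

variable {X E T ι : Type*} [SpaceWithFunctions X] [SpaceWithFunctions E] [SpaceWithFunctions T]

theorem exists_regular_glue {W : Set X} {N : ι → Set X} (hN : ∀ i, ZOpen (N i))
    (hW : W ⊆ ⋃ i, N i) {q : ι → X → ℂ} (hq : ∀ i, q i ∈ regular (N i))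
    (heq : ∀ i j, Set.EqOn (q i) (q j) (N i ∩ N j)) :
    ∃ k ∈ regular W, ∀ i, Set.EqOn k (q i) (N i) := by
  classical
  set k : X → ℂ := fun x => if h : ∃ i, x ∈ N i then q h.choose x else 0 with hk
  have hkq : ∀ i, Set.EqOn k (q i) (N i) := fun i x hx => by
    have h : ∃ i, x ∈ N i := ⟨i, hx⟩
    simp only [hk, dif_pos h]
    exact heq _ _ ⟨h.choose_spec, hx⟩
  refine ⟨k, regular_of_local fun x hx => ?_, hkq⟩
  obtain ⟨i, hi⟩ := Set.mem_iUnion.1 (hW hx)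
  exact ⟨N i, hN i, hi, q i, hq i, fun y hy => hkq i hy.2⟩

theorem regular_eval_mvPolynomial {U : Set X} {f : ι → X → ℂ} (hf : ∀ i, f i ∈ regular U)
    (P : MvPolynomial ι ℂ) : (fun x => MvPolynomial.eval (fun i => f i x) P) ∈ regular U := by
  induction P using MvPolynomial.induction_on with
  | C c =>
    simp only [MvPolynomial.eval_C]
    exact (regular U).algebraMap_mem c
  | add p q hp hq =>
    simp only [map_add]
    exact add_mem hp hq
  | mul_X p i hp =>
    simp only [map_mul, MvPolynomial.eval_X]
    exact mul_mem hp (hf i)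

theorem IsSection.restrict {π : T → E} {U W : Set E} {s : U → T} (hs : IsSection π U s)
    (h : W ⊆ U) : IsSection π W (s ∘ Set.inclusion h) :=
  ⟨hs.1.comp (isMorphism_codRestrict (isMorphism_val W) fun x => h x.2), fun _ => hs.2 _⟩

theorem exists_isSection_glue {π : T → E} {U : Set E} {N : ι → Set E} (hN : ∀ i, ZOpen (N i))
    (hU : U ⊆ ⋃ i, N i) {s : ∀ i, N i → T} (hs : ∀ i, IsSection π (N i) (s i))
    (heq : ∀ i j x (hi : x ∈ N i) (hj : x ∈ N j), s i ⟨x, hi⟩ = s j ⟨x, hj⟩) :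
    ∃ s' : U → T, IsSection π U s' ∧ ∀ i (x : U) (hi : x.1 ∈ N i), s' x = s i ⟨x.1, hi⟩ := by
  set s' : U → T := Set.iUnionLift N s heq U hU
  have hs's : ∀ i (x : U) (hi : x.1 ∈ N i), s' x = s i ⟨x.1, hi⟩ := fun i x hi =>
    Set.iUnionLift_of_mem x hi
  have hcov : ∀ x : U, ∃ i, x.1 ∈ N i := fun x => Set.mem_iUnion.1 (hU x.2)
  refine ⟨s', ⟨?_, fun x => ?_⟩, hs's⟩
  · refine isMorphism_of_cover (c := fun i (x : (Subtype.val ⁻¹' N i : Set U)) => x.1)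
      (fun i => isOpenEmb_val ⟨N i, hN i, rfl⟩) (fun x => ?_) fun i => ?_
    · obtain ⟨i, hi⟩ := hcov x
      exact ⟨i, ⟨x, hi⟩, rfl⟩
    · have hmor := (hs i).1.comp (isMorphism_codRestrict (A := N i)
        ((isMorphism_val U).comp (isMorphism_val (Subtype.val ⁻¹' N i))) fun x => x.2)
      convert! hmor using 1
      exact funext fun x => hs's i x.1 x.2
  · obtain ⟨i, hi⟩ := hcov x
    rw [hs's i x hi]
    exact (hs i).2 _

end Gluing

section LineBundles

/-- The pullback `f ∘ s` of a function along a section over `U`, as a function on all of `E`: it is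
extended by zero. -/
noncomputable def pullSection {E T : Type*} {U : Set E} (s : U → T) (f : T → ℂ) : E → ℂ :=
  Function.extend Subtype.val (f ∘ s) 0

theorem pullSection_apply {E T : Type*} {U : Set E} (s : U → T) (f : T → ℂ) (e : U) :
    pullSection s f e = f (s e) := Subtype.val_injective.extend_apply _ _ e

variable {E T ι : Type*} [SpaceWithFunctions E] {π : T → E} {A : Set (Set E × (T → ℂ))}

theorem IsLocalEquation.mono {W W' Z : Set E} {h : E → ℂ} (hh : IsLocalEquation W Z h)
    (hW : W' ⊆ W) : IsLocalEquation W' Z h :=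
  ⟨regular_mono hW hh.1, fun x hx => hh.2.1 x ⟨hW hx.1, hx.2⟩, fun N hN => hh.2.2 N (hN.trans hW)⟩

theorem IsLocalEquation.exists_unit_mul_eq {W Z : Set E} (hW : ZOpen W) {h h' : E → ℂ}
    (hh : IsLocalEquation W Z h) (hh' : IsLocalEquation W Z h')
    (hreg : ∀ f ∈ regular W, (∀ x ∈ W, f x * h x = 0) → ∀ x ∈ W, f x = 0) :
    ∃ q ∈ regular W, (∀ x ∈ W, q x ≠ 0) ∧ ∀ x ∈ W, h x = q x * h' x := by
  obtain ⟨q, hq, hhq⟩ := hh'.2.2 W subset_rfl hW h hh.1 hh.2.1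
  obtain ⟨p, hp, hhp⟩ := hh.2.2 W subset_rfl hW h' hh'.1 hh'.2.1
  have hqp := hreg (q * p - 1) (sub_mem (mul_mem hq hp) (one_mem _)) fun x hx => by
    rw [Pi.sub_apply, Pi.mul_apply, Pi.one_apply, sub_mul, one_mul, mul_assoc, ← hhp x hx,
      ← hhq x hx, sub_self]
  refine ⟨q, hq, fun x hx h0 => ?_, hhq⟩
  simpa [h0] using hqp x hx

/-- `ω` is a rational section of the dual of the line bundle `π`, that is, a rational function on
the total space which is linear on the fibres, whose poles and zeros on the base make
`s ↦ ω ∘ s` take values in `𝒪(D)`, `D = ∑ i, a i • Z i`: in each trivialization it is the fibre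
coordinate divided by `∏ i, h i ^ a i`, where `h i` is an equation of `Z i`. The first condition
expresses that the complement of `⋃ i, Z i` is schematically dense. -/
structure IsRationalCoordinate (π : T → E) (A : Set (Set E × (T → ℂ))) (Z : ι → Set E) (a : ι → ℤ)
    (ω : T → ℂ) : Prop where
  eq_zero_of_forall_notMem : ∀ W, ZOpen W → ∀ f ∈ regular W, (∀ e ∈ W \ ⋃ i, Z i, f e = 0) →
    ∀ e ∈ W, f e = 0
  exists_equations : ∀ c ∈ A, ∃ h : ι → E → ℂ, (∀ i, IsLocalEquation c.1 (Z i) (h i)) ∧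
    (∀ e ∈ c.1 \ ⋃ i, Z i, ∀ i, h i e ≠ 0) ∧
    ∀ x, π x ∈ c.1 \ ⋃ i, Z i → ω x * ∏ᶠ i, h i (π x) ^ a i = c.2 x

theorem IsRationalCoordinate.exists_coord_eq_iff [Finite ι] {Z : ι → Set E} {a : ι → ℤ}
    {ω : T → ℂ} (hω : IsRationalCoordinate π A Z a ω) {c : Set E × (T → ℂ)} (hc : c ∈ A)
    (hcW : ZOpen c.1) {U : Set E} {f : E → ℂ}
    (hf : IsDivisorSection Z a U f) {e : E} (heU : e ∈ U) (hec : e ∈ c.1) :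
    ∃ W ⊆ U ∩ c.1, ZOpen W ∧ e ∈ W ∧ ∃ κ ∈ regular W,
      ∀ x, π x ∈ W \ ⋃ i, Z i → (ω x = f (π x) ↔ c.2 x = κ (π x)) := by
  have := Fintype.ofFinite ι
  obtain ⟨W, hWU, hW, heW, h', hh', κ, hκ, hfκ⟩ := hf e heU
  obtain ⟨h, hh, hne, hmul⟩ := hω.exists_equations c hc
  have hN : ZOpen (W ∩ c.1) := hW.inter hcW
  choose q hq hq0 hhq using fun i => IsLocalEquation.exists_unit_mul_eq hN
    ((hh i).mono Set.inter_subset_right) ((hh' i).mono Set.inter_subset_left) fun k hk hk0 =>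
      hω.eq_zero_of_forall_notMem _ hN k hk fun y hy =>
        (mul_eq_zero.1 (hk0 y hy.1)).resolve_right (hne y ⟨hy.1.2, hy.2⟩ i)
  refine ⟨W ∩ c.1, Set.inter_subset_inter_left _ hWU, hN, ⟨heW, hec⟩, κ * ∏ i, q i ^ a i,
    mul_mem (regular_mono Set.inter_subset_left hκ)
      (prod_mem fun i _ => regular_zpow_of_ne_zero hN (hq i) (hq0 i) (a i)), fun x hx => ?_⟩
  have hprod : f (π x) * ∏ i, h i (π x) ^ a i = (κ * ∏ i, q i ^ a i) (π x) := by
    rw [Pi.mul_apply, Finset.prod_apply, ← hfκ _ ⟨hx.1.1, hx.2⟩, finprod_eq_prod_of_fintype,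
      mul_assoc, ← Finset.prod_mul_distrib]
    congr 1
    exact Finset.prod_congr rfl fun i _ => by rw [hhq i _ hx.1, mul_zpow, mul_comm, Pi.pow_apply]
  have hne0 : ∏ i, h i (π x) ^ a i ≠ 0 :=
    Finset.prod_ne_zero_iff.2 fun i _ => zpow_ne_zero _ (hne _ ⟨hx.1.2, hx.2⟩ i)
  rw [← hmul x ⟨hx.1.2, hx.2⟩, ← hprod, finprod_eq_prod_of_fintype, mul_left_inj' hne0]

variable [SpaceWithFunctions T]

theorem regular_pullSection {U : Set E} (hU : ZOpen U) {s : U → T} (hs : IsMorphism s) {W : Set T}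
    (hW : ZOpen W) {f : T → ℂ} (hf : f ∈ regular W) :
    pullSection s f ∈ regular (Subtype.val '' (s ⁻¹' W)) := by
  refine (isOpenEmb_val hU).regular_image _ (hs W hW).1 _ ?_
  rw [pullSection, Function.extend_comp Subtype.val_injective]
  exact (hs W hW).2 f hf

theorem IsTrivialization.regular_coord (hπ : IsMorphism π) {U : Set E} {t : T → ℂ}
    (h : IsTrivialization π U t) : t ∈ regular (π ⁻¹' U) := by
  have ht := (h.2.1 _ zOpen_univ).2 _ (regular_snd Set.univ)
  have := (isOpenEmb_val (hπ U h.1).1).regular_image _ zOpen_univ t ht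
  rwa [Set.image_univ, Subtype.range_coe] at this

theorem IsTrivialization.eq_of_coord_eq {U : Set E} {t : T → ℂ} (h : IsTrivialization π U t)
    {x y : T} (hx : π x ∈ U) (hxy : π x = π y) (ht : t x = t y) : x = y := by
  obtain ⟨-, g, -, hg, -⟩ := h.2
  exact congrArg Subtype.val (hg.injective (a₁ := ⟨x, hx⟩)
    (a₂ := ⟨y, by rw [Set.mem_preimage, ← hxy]; exact hx⟩) (Prod.ext (Subtype.ext hxy) ht))

theorem IsTrivialization.exists_isSection {U W : Set E} {t : T → ℂ} (h : IsTrivialization π U t)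
    (hWU : W ⊆ U) (hW : ZOpen W) {κ : E → ℂ} (hκ : κ ∈ regular W) :
    ∃ s, IsSection π W s ∧ ∀ x : W, t (s x) = κ x := by
  obtain ⟨-, g, hg, -, hr⟩ := h.2
  have hmor : IsMorphism fun x : W => ((⟨x, hWU x.2⟩, κ x) : U × ℂ) :=
    isMorphism_prodMk (isMorphism_codRestrict (isMorphism_val W) fun x => hWU x.2)
      (regular_restrict hW hκ fun x _ => x.2)
  refine ⟨fun x => (g (⟨x, hWU x.2⟩, κ x)).1, ⟨(isMorphism_val _).comp (hg.comp hmor), fun x => ?_⟩,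
    fun x => congrArg Prod.snd (hr _)⟩
  exact congrArg (fun p => p.1.1) (hr (⟨x, hWU x.2⟩, κ x))

theorem IsLineBundleAtlas.regular_pullSection (hA : IsLineBundleAtlas π A) {c : Set E × (T → ℂ)}
    (hc : c ∈ A) {U : Set E} (hU : ZOpen U) {s : U → T} (hs : IsSection π U s) :
    pullSection s c.2 ∈ regular (U ∩ c.1) := by
  have htriv := hA.trivialization c hc
  refine regular_mono ?_ (SpaceWithFunctions.regular_pullSection hU hs.1
    (hA.isMorphism _ htriv.1).1 (htriv.regular_coord hA.isMorphism))
  rintro e ⟨heU, he⟩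
  exact ⟨⟨e, heU⟩, by rwa [Set.mem_preimage, Set.mem_preimage, hs.2], rfl⟩

namespace IsRationalCoordinate

variable {Z : ι → Set E} {a : ι → ℤ} {ω : T → ℂ}

theorem section_ext (hω : IsRationalCoordinate π A Z a ω) (hA : IsLineBundleAtlas π A) {U : Set E}
    (hU : ZOpen U) {s s' : U → T} (hs : IsSection π U s) (hs' : IsSection π U s')
    (heq : ∀ e : U, e.1 ∉ ⋃ i, Z i → ω (s e) = ω (s' e)) : s = s' := by
  ext e
  obtain ⟨c, hc, hec⟩ := hA.cover e.1
  have htriv := hA.trivialization c hc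
  obtain ⟨h, -, -, hmul⟩ := hω.exists_equations c hc
  refine htriv.eq_of_coord_eq (by rwa [hs.2]) (by rw [hs.2, hs'.2]) (sub_eq_zero.1 ?_)
  rw [← pullSection_apply s c.2, ← pullSection_apply s' c.2]
  refine hω.eq_zero_of_forall_notMem (U ∩ c.1) (hU.inter htriv.1) _
    (sub_mem (hA.regular_pullSection hc hU hs) (hA.regular_pullSection hc hU hs'))
    (fun y hy => ?_) e.1 ⟨e.2, hec⟩
  obtain ⟨⟨hyU, hyc⟩, hyZ⟩ := hy
  have h₁ := pullSection_apply s c.2 ⟨y, hyU⟩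
  have h₂ := pullSection_apply s' c.2 ⟨y, hyU⟩
  rw [← hmul _ (by rw [hs.2]; exact ⟨hyc, hyZ⟩), hs.2] at h₁
  rw [← hmul _ (by rw [hs'.2]; exact ⟨hyc, hyZ⟩), hs'.2, ← heq ⟨y, hyU⟩ hyZ, ← h₁] at h₂
  exact sub_eq_zero.2 h₂.symm

theorem isDivisorSection_pullSection (hω : IsRationalCoordinate π A Z a ω)
    (hA : IsLineBundleAtlas π A) {U : Set E} (hU : ZOpen U) {s : U → T} (hs : IsSection π U s) :
    IsDivisorSection Z a U (pullSection s ω) := by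
  intro e he
  obtain ⟨c, hc, hec⟩ := hA.cover e
  obtain ⟨h, hh, -, hmul⟩ := hω.exists_equations c hc
  refine ⟨U ∩ c.1, Set.inter_subset_left, hU.inter (hA.trivialization c hc).1, ⟨he, hec⟩, h,
    fun i => (hh i).mono Set.inter_subset_right, _, hA.regular_pullSection hc hU hs, ?_⟩
  rintro y ⟨⟨hyU, hyc⟩, hyZ⟩
  have h₁ := hmul (s ⟨y, hyU⟩) (by rw [hs.2]; exact ⟨hyc, hyZ⟩)
  rw [hs.2] at h₁
  rw [pullSection_apply s ω ⟨y, hyU⟩, pullSection_apply s c.2 ⟨y, hyU⟩, h₁]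

theorem exists_isSection [Finite ι] (hω : IsRationalCoordinate π A Z a ω)
    (hA : IsLineBundleAtlas π A) {U : Set E} {f : E → ℂ} (hf : IsDivisorSection Z a U f) :
    ∃ s, IsSection π U s ∧ Set.EqOn (pullSection s ω) f (U \ ⋃ i, Z i) := by
  choose c hc hcx using hA.cover
  choose W hWU hW heW κ hκ hfκ using fun e : U =>
    hω.exists_coord_eq_iff (hc e) (hA.trivialization _ (hc e)).1 hf e.2 (hcx e)
  choose s hs hsκ using fun e : U => (hA.trivialization _ (hc e)).exists_isSection
    (fun y hy => (hWU e hy).2) (hW e) (hκ e)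
  have hsf : ∀ e (y : W e), y.1 ∉ ⋃ i, Z i → ω (s e y) = f y := fun e y hy => by
    have := (hfκ e (s e y) (by rw [(hs e).2]; exact ⟨y.2, hy⟩)).2 (by rw [hsκ, (hs e).2])
    rwa [(hs e).2] at this
  have heq : ∀ e e' y (he : y ∈ W e) (he' : y ∈ W e'), s e ⟨y, he⟩ = s e' ⟨y, he'⟩ :=
    fun e e' y he he' => congrFun (hω.section_ext hA ((hW e).inter (hW e'))
      ((hs e).restrict Set.inter_subset_left) ((hs e').restrict Set.inter_subset_right)
      fun z hz => (hsf e ⟨z, z.2.1⟩ hz).trans (hsf e' ⟨z, z.2.2⟩ hz).symm) ⟨y, he, he'⟩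
  obtain ⟨s', hs', hss'⟩ := exists_isSection_glue hW
    (fun y hy => Set.mem_iUnion.2 ⟨⟨y, hy⟩, heW ⟨y, hy⟩⟩) hs heq
  refine ⟨s', hs', fun y hy => ?_⟩
  have hyW := heW ⟨y, hy.1⟩
  rw [pullSection_apply s' ω ⟨y, hy.1⟩, hss' ⟨y, hy.1⟩ ⟨y, hy.1⟩ hyW]
  exact hsf _ ⟨y, hyW⟩ hy.2

theorem hasSheafOfSections [Finite ι] (hω : IsRationalCoordinate π A Z a ω)
    (hA : IsLineBundleAtlas π A) : HasSheafOfSections π A Z a := by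
  refine ⟨fun U s => pullSection s ω, fun U hU s => hω.isDivisorSection_pullSection hA hU,
    fun U hU s s' hs hs' heq => ?_, fun U _ f => hω.exists_isSection hA,
    fun U W _ _ hWU s _ e he => ?_, fun U _ s₁ s₂ s₃ h₁ h₂ h₃ r _ hadd e he => ?_⟩
  · refine hω.section_ext hA hU hs hs' fun e he => ?_
    rw [← pullSection_apply s ω, ← pullSection_apply s' ω]
    exact heq ⟨e.2, he⟩
  · exact (pullSection_apply (s ∘ Set.inclusion hWU) ω ⟨e, he.1⟩).trans
      (pullSection_apply s ω ⟨e, hWU he.1⟩).symm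
  · obtain ⟨c, hc, hec⟩ := hA.cover e
    obtain ⟨h, -, hne, hmul⟩ := hω.exists_equations c hc
    have hcoord : ∀ s : U → T, IsSection π U s →
        pullSection s ω e * ∏ᶠ i, h i e ^ a i = c.2 (s ⟨e, he.1⟩) := fun s hs => by
      have := hmul (s ⟨e, he.1⟩) (by rw [hs.2]; exact ⟨hec, he.2⟩)
      rwa [hs.2, ← pullSection_apply s ω] at this
    have hne0 : ∏ᶠ i, h i e ^ a i ≠ 0 := by
      have := Fintype.ofFinite ι
      rw [finprod_eq_prod_of_fintype]
      exact Finset.prod_ne_zero_iff.2 fun i _ => zpow_ne_zero _ (hne e ⟨hec, he.2⟩ i)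
    refine mul_right_cancel₀ hne0 ?_
    rw [hcoord s₃ h₃, hadd c hc ⟨e, he.1⟩ hec, ← hcoord s₁ h₁, ← hcoord s₂ h₂, Pi.add_apply,
      Pi.mul_apply]
    ring

end IsRationalCoordinate

end LineBundles

end SpaceWithFunctions

namespace Toric

open SpaceWithFunctions

section Cones

variable {V ι : Type*} [AddCommGroup V] [Module ℝ V] {L : AddSubgroup V}

/-- A real basis consisting of lattice vectors whose coordinate forms are integral on the
lattice, i.e. a basis of the lattice. -/
structure IsLatticeBasis (L : AddSubgroup V) (B : Module.Basis ι ℝ V) : Prop where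
  mem : ∀ i, B i ∈ L
  coord_mem : ∀ i, B.coord i ∈ dualLattice L

/-- A cone generated by finitely many lattice vectors. -/
def IsRationalCone (L : AddSubgroup V) (σ : PointedCone ℝ V) : Prop :=
  ∃ S : Set V, S.Finite ∧ S ⊆ L ∧ σ = PointedCone.hull ℝ S

/-- A cone generated by a part of a lattice basis of the ambient space. It differs from a smooth
cone in that the lattice basis is required to be a real basis of the ambient space. -/
def IsRegularCone (L : AddSubgroup V) (σ : PointedCone ℝ V) : Prop :=
  ∃ (k : ℕ) (B : Module.Basis (Fin k) ℝ V) (s : Set (Fin k)),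
    IsLatticeBasis L B ∧ σ = PointedCone.hull ℝ (B '' s)

/-- The linear form `m` cuts out the face `τ` of `σ`, and `τ^∨ ∩ M` is obtained from `σ^∨ ∩ M` by
adding `-m`. -/
structure IsFaceCut (L : AddSubgroup V) (τ σ : PointedCone ℝ V) (m : Module.Dual ℝ V) : Prop where
  mem : m ∈ dualMonoid L σ
  mem_iff : ∀ u ∈ σ, u ∈ τ ↔ m u = 0
  bound : ∀ m' ∈ dualMonoid L τ, ∃ k : ℕ, m' + k • m ∈ dualMonoid L σ

theorem apply_nonneg_of_mem_hull {S : Set V} {m : Module.Dual ℝ V} (h : ∀ u ∈ S, 0 ≤ m u) {u : V}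
    (hu : u ∈ PointedCone.hull ℝ S) : 0 ≤ m u := by
  induction hu using Submodule.span_induction with
  | mem x hx => exact h x hx
  | zero => exact (map_zero m).ge
  | add x y _ _ hx hy => exact (map_add m x y).symm ▸ add_nonneg hx hy
  | smul a x _ hx => exact (map_smul m (a : ℝ) x).symm ▸ mul_nonneg a.2 hx

theorem coord_nonneg_basis (B : Module.Basis ι ℝ V) (i j : ι) : 0 ≤ B.coord i (B j) := by
  classical
  rw [B.coord_apply, B.repr_self, Finsupp.single_apply]
  split_ifs <;> norm_num

theorem apply_eq_sum_coord [Fintype ι] (B : Module.Basis ι ℝ V) (m : Module.Dual ℝ V) (x : V) :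
    m x = ∑ i, B.coord i x * m (B i) := by
  conv_lhs => rw [← B.sum_repr x, map_sum]
  exact Finset.sum_congr rfl fun i _ => by rw [map_smul, smul_eq_mul, B.coord_apply]

theorem mem_of_forall_coord [Finite ι] (B : Module.Basis ι ℝ V) {τ : PointedCone ℝ V} {x : V}
    (hx : ∀ i, 0 ≤ B.coord i x) (h : ∀ i, B i ∈ τ ∨ B.coord i x = 0) : x ∈ τ := by
  cases nonempty_fintype ι
  rw [← B.sum_repr x]
  refine Submodule.sum_mem _ fun i _ => ?_
  rcases h i with hi | hi
  · exact PointedCone.smul_mem _ (hx i) hi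
  · rw [B.coord_apply] at hi
    rw [hi, zero_smul]
    exact zero_mem _

theorem mem_hull_basis [Finite ι] (B : Module.Basis ι ℝ V) (s : Set ι) {x : V} :
    x ∈ PointedCone.hull ℝ (B '' s) ↔ (∀ i, 0 ≤ B.coord i x) ∧ ∀ i ∉ s, B.coord i x = 0 := by
  classical
  refine ⟨fun hx => ⟨fun i => apply_nonneg_of_mem_hull ?_ hx, fun i hi => ?_⟩, fun h =>
    mem_of_forall_coord B h.1 fun i => or_iff_not_imp_right.2 fun hi =>
      PointedCone.subset_hull ⟨i, not_imp_comm.1 (h.2 i) hi, rfl⟩⟩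
  · rintro _ ⟨j, -, rfl⟩
    exact coord_nonneg_basis B i j
  · have hle : PointedCone.hull ℝ (B '' s) ≤
        (LinearMap.ker (B.coord i)).restrictScalars {c : ℝ // 0 ≤ c} := by
      refine Submodule.span_le.2 ?_
      rintro _ ⟨j, hj, rfl⟩
      simpa [Finsupp.single_apply] using fun h : j = i => hi (h ▸ hj)
    exact hle hx

theorem mem_face_iff [Finite ι] {B : Module.Basis ι ℝ V} {s : Set ι} {τ : PointedCone ℝ V}
    (hτ : τ.IsFaceOf (PointedCone.hull ℝ (B '' s))) {u : V}
    (hu : u ∈ PointedCone.hull ℝ (B '' s)) :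
    u ∈ τ ↔ ∀ i, B i ∉ τ → B.coord i u = 0 := by
  cases nonempty_fintype ι
  have hu' := (mem_hull_basis B s).1 hu
  refine ⟨fun huτ i hi => ?_, fun h =>
    mem_of_forall_coord B hu'.1 fun i => or_iff_not_imp_left.2 (h i)⟩
  have hterm : ∀ j, B.coord j u • B j ∈ PointedCone.hull ℝ (B '' s) := fun j => by
    by_cases hj : j ∈ s
    · exact PointedCone.smul_mem _ (hu'.1 j) (PointedCone.subset_hull ⟨j, hj, rfl⟩)
    · rw [hu'.2 j hj, zero_smul]
      exact zero_mem _
  have hmem : B.coord i u • B i ∈ τ :=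
    hτ.mem_of_sum_mem (f := fun j => B.coord j u • B j) hterm
      (by simpa [B.coord_apply, B.sum_repr] using huτ) i
  by_contra hne
  have h := PointedCone.smul_mem τ (inv_nonneg.2 (hu'.1 i)) hmem
  rw [inv_smul_smul₀ hne] at h
  exact hi h

theorem one_le_apply_of_ne_zero {σ : PointedCone ℝ V} {m : Module.Dual ℝ V}
    (hm : m ∈ dualMonoid L σ) {u : V} (huL : u ∈ L) (hu : u ∈ σ) (h : m u ≠ 0) : 1 ≤ m u := by
  obtain ⟨c, hc⟩ := hm.1 u huL
  have hpos := (hm.2 u hu).lt_of_ne' h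
  rw [hc] at hpos ⊢
  exact_mod_cast hpos

theorem IsRegularCone.isRationalCone {σ : PointedCone ℝ V} (hσ : IsRegularCone L σ) :
    IsRationalCone L σ := by
  obtain ⟨k, B, s, hB, rfl⟩ := hσ
  exact ⟨B '' s, s.toFinite.image B, Set.image_subset_iff.2 fun i _ => hB.mem i, rfl⟩

theorem IsRationalCone.isFaceCut {τ σ : PointedCone ℝ V} {m : Module.Dual ℝ V}
    (hσ : IsRationalCone L σ) (hm : m ∈ dualMonoid L σ) (h : ∀ u ∈ σ, u ∈ τ ↔ m u = 0) :
    IsFaceCut L τ σ m := by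
  refine ⟨hm, h, fun m' hm' => ?_⟩
  obtain ⟨S, hS, hSL, rfl⟩ := hσ
  refine ⟨∑ u ∈ hS.toFinset, ⌈|m' u|⌉₊, add_mem hm'.1 (nsmul_mem hm.1 _),
    fun u hu => apply_nonneg_of_mem_hull (fun u hu => ?_) hu⟩
  have huσ := PointedCone.subset_hull (R := ℝ) hu
  rw [LinearMap.add_apply, LinearMap.smul_apply, nsmul_eq_mul]
  by_cases h0 : m u = 0
  · rw [h0, mul_zero, add_zero]
    exact hm'.2 u ((h u huσ).2 h0)
  · have hle : (⌈|m' u|⌉₊ : ℝ) ≤ ((∑ u ∈ hS.toFinset, ⌈|m' u|⌉₊ : ℕ) : ℝ) := by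
      exact_mod_cast Finset.single_le_sum (f := fun u => ⌈|m' u|⌉₊) (fun _ _ => Nat.zero_le _)
        (hS.mem_toFinset.2 hu)
    have hmul := le_mul_of_one_le_right (Nat.cast_nonneg (α := ℝ) (∑ u ∈ hS.toFinset, ⌈|m' u|⌉₊))
      (one_le_apply_of_ne_zero hm (hSL hu) huσ h0)
    linarith [Nat.le_ceil |m' u|, neg_abs_le (m' u)]

theorem IsRegularCone.exists_isFaceCut {τ σ : PointedCone ℝ V} (hσ : IsRegularCone L σ)
    (hτ : τ.IsFaceOf σ) : ∃ m, IsFaceCut L τ σ m := by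
  classical
  have hrat := hσ.isRationalCone
  obtain ⟨k, B, s, hB, rfl⟩ := hσ
  have happly : ∀ u, (∑ i with B i ∉ τ, B.coord i) u = ∑ i with B i ∉ τ, B.coord i u :=
    fun u => LinearMap.sum_apply _ _ u
  refine ⟨∑ i with B i ∉ τ, B.coord i,
    hrat.isFaceCut ⟨sum_mem fun i _ => hB.coord_mem i, fun u hu => ?_⟩ fun u hu => ?_⟩
  · rw [happly]
    exact Finset.sum_nonneg fun i _ => ((mem_hull_basis B s).1 hu).1 i
  · rw [happly, Finset.sum_eq_zero_iff_of_nonneg fun i _ => ((mem_hull_basis B s).1 hu).1 i,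
      mem_face_iff hτ hu]
    simp only [Finset.mem_filter, Finset.mem_univ, true_and]

theorem IsFaceCut.inf {τ τ' σ : PointedCone ℝ V} {m m' : Module.Dual ℝ V}
    (hσ : IsRationalCone L σ) (hm : IsFaceCut L τ σ m) (hm' : IsFaceCut L τ' σ m') :
    IsFaceCut L (τ ⊓ τ') σ (m + m') :=
  hσ.isFaceCut (add_mem hm.mem hm'.mem) fun u hu => by
    rw [Submodule.mem_inf, hm.mem_iff u hu, hm'.mem_iff u hu, LinearMap.add_apply,
      add_eq_zero_iff_of_nonneg (hm.mem.2 u hu) (hm'.mem.2 u hu)]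

end Cones

section Affine

variable {V : Type*} [AddCommGroup V] [Module ℝ V] {L : AddSubgroup V} {σ τ : PointedCone ℝ V}

theorem character_zero : character L (0 : dualMonoid L σ) = 1 := rfl

theorem character_add (m m' : dualMonoid L σ) :
    character L (m + m') = character L m * character L m' := by
  simp [character, AddMonoidAlgebra.single_mul_single]

theorem character_nsmul (k : ℕ) (m : dualMonoid L σ) :
    character L (k • m) = character L m ^ k := by
  simp [character, AddMonoidAlgebra.single_pow]

theorem character_sum {ι : Type*} (s : Finset ι) (k : ι → ℕ) (f : ι → dualMonoid L σ) :
    character L (∑ i ∈ s, k i • f i) = ∏ i ∈ s, character L (f i) ^ k i := by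
  classical
  induction s using Finset.induction_on with
  | empty => rfl
  | insert i s hi ih =>
    rw [Finset.sum_insert hi, Finset.prod_insert hi, character_add, ih, character_nsmul]

theorem single_eq_smul_character (m : dualMonoid L σ) (c : ℂ) :
    (AddMonoidAlgebra.single m c : CoordRing L σ) = c • character L m := by
  simp [character]

theorem affineToric_ext {γ δ : AffineToric L σ}
    (h : ∀ m, γ (character L m) = δ (character L m)) : γ = δ :=
  AddMonoidAlgebra.algHom_ext (fun m => h m) (by ext)

/-- The point of `U_σ` with prescribed values of the characters. -/
noncomputable def mkPoint (f : dualMonoid L σ → ℂ) (h0 : f 0 = 1)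
    (hadd : ∀ m m', f (m + m') = f m * f m') : AffineToric L σ :=
  AddMonoidAlgebra.lift ℂ ℂ (dualMonoid L σ)
    { toFun := fun m => f m.toAdd, map_one' := h0, map_mul' := fun m m' => hadd m.toAdd m'.toAdd }

@[simp] theorem mkPoint_character (f : dualMonoid L σ → ℂ) (h0 : f 0 = 1)
    (hadd : ∀ m m', f (m + m') = f m * f m') (m : dualMonoid L σ) :
    mkPoint f h0 hadd (character L m) = f m := by
  simp [mkPoint, character]

theorem restrict_character (h : τ ≤ σ) (γ : AffineToric L τ) (m : dualMonoid L σ) :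
    restrict L h γ (character L m) = γ (character L ⟨m.1, dualMonoid_anti L h m.2⟩) := by
  simp [restrict, character]
  rfl

theorem restrict_restrict {υ : PointedCone ℝ V} (h : τ ≤ σ) (h' : υ ≤ τ) (γ : AffineToric L υ) :
    restrict L h (restrict L h' γ) = restrict L (h'.trans h) γ :=
  affineToric_ext fun m => by simp only [restrict_character]

theorem restrict_rfl (γ : AffineToric L σ) : restrict L le_rfl γ = γ :=
  affineToric_ext fun m => by simp only [restrict_character]

theorem isMorphism_restrict (h : τ ≤ σ) : IsMorphism (restrict L h) :=
  isMorphism_specm fun a => regular_eval (AddMonoidAlgebra.mapDomainAlgHom ℂ ℂ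
    (AddSubmonoid.inclusion (dualMonoid_anti L h)) a) Set.univ

theorem apply_character_add_nsmul_mul_pow (γ : AffineToric L σ) {m m' : Module.Dual ℝ V}
    (hm : m ∈ dualMonoid L σ) {a b : ℕ} (ha : m' + a • m ∈ dualMonoid L σ)
    (hb : m' + b • m ∈ dualMonoid L σ) :
    γ (character L ⟨_, ha⟩) * γ (character L ⟨m, hm⟩) ^ b =
      γ (character L ⟨_, hb⟩) * γ (character L ⟨m, hm⟩) ^ a := by
  simp only [← map_pow, ← map_mul, ← character_nsmul, ← character_add]
  congr 2
  exact Subtype.ext (add_right_comm m' (a • m) (b • m))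

theorem apply_character_ne_zero_of_forall_eq_zero {m : dualMonoid L σ} (hm : ∀ u ∈ σ, m.1 u = 0)
    (γ : AffineToric L σ) : γ (character L m) ≠ 0 := by
  have hneg : -m.1 ∈ dualMonoid L σ :=
    ⟨neg_mem m.2.1, fun u hu => by rw [LinearMap.neg_apply, hm u hu, neg_zero]⟩
  refine left_ne_zero_of_mul (b := γ (character L ⟨_, hneg⟩)) ?_
  rw [← map_mul, ← character_add, show m + ⟨_, hneg⟩ = 0 from Subtype.ext (add_neg_cancel m.1),
    character_zero, map_one]
  exact one_ne_zero

namespace IsFaceCut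

variable {m : Module.Dual ℝ V}

theorem restrict_ne_zero (hm : IsFaceCut L τ σ m) (h : τ ≤ σ) (δ : AffineToric L τ) :
    restrict L h δ (character L ⟨m, hm.mem⟩) ≠ 0 := by
  rw [restrict_character]
  exact apply_character_ne_zero_of_forall_eq_zero (fun u hu => (hm.mem_iff u (h hu)).1 hu) δ

theorem apply_mul_pow (hm : IsFaceCut L τ σ m) (h : τ ≤ σ) (δ : AffineToric L τ)
    {m' : Module.Dual ℝ V} (hm' : m' ∈ dualMonoid L τ) {k : ℕ}
    (hk : m' + k • m ∈ dualMonoid L σ) :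
    δ (character L ⟨m', hm'⟩) * δ (character L ⟨m, dualMonoid_anti L h hm.mem⟩) ^ k =
      restrict L h δ (character L ⟨m' + k • m, hk⟩) := by
  rw [restrict_character, ← map_pow, ← map_mul, ← character_nsmul, ← character_add]
  rfl

theorem restrict_injective (hm : IsFaceCut L τ σ m) (h : τ ≤ σ) :
    Function.Injective (restrict L h) := by
  intro δ δ' hδ
  refine affineToric_ext fun m' => ?_
  obtain ⟨k, hk⟩ := hm.bound m'.1 m'.2
  have h1 := hm.apply_mul_pow h δ m'.2 hk
  have h2 := hm.apply_mul_pow h δ' m'.2 hk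
  have h3 : δ (character L ⟨m, dualMonoid_anti L h hm.mem⟩) =
      δ' (character L ⟨m, dualMonoid_anti L h hm.mem⟩) := by
    have := congrArg (fun γ => γ (character L ⟨m, hm.mem⟩)) hδ
    simpa only [restrict_character] using this
  have h0 := hm.restrict_ne_zero h δ
  rw [restrict_character] at h0
  rw [← hδ, ← h1, ← h3] at h2
  exact (mul_right_cancel₀ (pow_ne_zero _ h0) h2).symm

theorem exists_restrict_eq (hm : IsFaceCut L τ σ m) (h : τ ≤ σ) (γ : AffineToric L σ)
    (hγ : γ (character L ⟨m, hm.mem⟩) ≠ 0) : ∃ δ, restrict L h δ = γ := by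
  choose k hk using fun m' : dualMonoid L τ => hm.bound m'.1 m'.2
  have hpow : ∀ a, γ (character L ⟨m, hm.mem⟩) ^ a ≠ 0 := fun a => pow_ne_zero a hγ
  have hval : ∀ (m' : dualMonoid L τ) (a : ℕ) (ha : m'.1 + a • m ∈ dualMonoid L σ),
      γ (character L ⟨_, hk m'⟩) / γ (character L ⟨m, hm.mem⟩) ^ k m' =
        γ (character L ⟨_, ha⟩) / γ (character L ⟨m, hm.mem⟩) ^ a := fun m' a ha =>
    (div_eq_div_iff (hpow _) (hpow _)).2 (apply_character_add_nsmul_mul_pow γ hm.mem (hk m') ha)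
  refine ⟨mkPoint (fun m' => γ (character L ⟨_, hk m'⟩) / γ (character L ⟨m, hm.mem⟩) ^ k m')
    ?_ fun m₁ m₂ => ?_, affineToric_ext fun m' => ?_⟩
  · rw [hval 0 0 (by simp), pow_zero, div_one, ← map_one γ, ← character_zero]
    congr 2
    exact Subtype.ext (by simp)
  · have hsum : (m₁ + m₂).1 + (k m₁ + k m₂) • m = (m₁.1 + k m₁ • m) + (m₂.1 + k m₂ • m) := by
      rw [add_smul, add_add_add_comm]
      rfl
    rw [hval (m₁ + m₂) _ (hsum ▸ add_mem (hk m₁) (hk m₂)), div_mul_div_comm, ← pow_add, ← map_mul,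
      ← character_add]
    congr 3
    exact Subtype.ext hsum
  · rw [restrict_character, mkPoint_character, hval _ 0 (by simp), pow_zero, div_one]
    congr 2
    exact Subtype.ext (by simp)

theorem exists_numerator (hm : IsFaceCut L τ σ m) (h : τ ≤ σ) (q : CoordRing L τ) :
    ∃ (K : ℕ) (q' : CoordRing L σ), ∀ δ : AffineToric L τ, restrict L h δ q' =
      δ q * restrict L h δ (character L ⟨m, hm.mem⟩) ^ K := by
  induction q using AddMonoidAlgebra.induction_linear with
  | zero => exact ⟨0, 0, by simp⟩
  | add p q hp hq =>
    obtain ⟨K, p', hp'⟩ := hp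
    obtain ⟨K', q', hq'⟩ := hq
    refine ⟨K + K', p' * character L ⟨m, hm.mem⟩ ^ K' + q' * character L ⟨m, hm.mem⟩ ^ K,
      fun δ => ?_⟩
    rw [map_add, map_mul, map_mul, map_pow, map_pow, hp', hq', map_add]
    ring
  | single m' c =>
    obtain ⟨k, hk⟩ := hm.bound m'.1 m'.2
    refine ⟨k, c • character L ⟨_, hk⟩, fun δ => ?_⟩
    rw [single_eq_smul_character, map_smul, map_smul, ← hm.apply_mul_pow h δ m'.2 hk,
      restrict_character, smul_mul_assoc]

theorem isOpenEmb_restrict (hm : IsFaceCut L τ σ m) (h : τ ≤ σ) : IsOpenEmb (restrict L h) where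
  injective := hm.restrict_injective h
  isMorphism := isMorphism_restrict h
  zOpen_image := by
    rintro U hU _ ⟨δ, hδ, rfl⟩
    obtain ⟨q, hq, hqU⟩ := hU δ hδ
    obtain ⟨K, q', hq'⟩ := hm.exists_numerator h q
    refine ⟨q' * character L ⟨m, hm.mem⟩, ?_, fun γ hγ => ?_⟩
    · rw [map_mul, hq']
      exact mul_ne_zero (mul_ne_zero hq (pow_ne_zero _ (hm.restrict_ne_zero h δ)))
        (hm.restrict_ne_zero h δ)
    · rw [map_mul] at hγ
      obtain ⟨δ', rfl⟩ := hm.exists_restrict_eq h γ (right_ne_zero_of_mul hγ)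
      rw [hq'] at hγ
      exact ⟨δ', hqU _ (left_ne_zero_of_mul (left_ne_zero_of_mul hγ)), rfl⟩
  regular_image := by
    rintro U _ k hk _ ⟨δ, hδ, rfl⟩
    obtain ⟨p, q, hq, hpq⟩ := hk δ hδ
    obtain ⟨K, p', hp'⟩ := hm.exists_numerator h p
    obtain ⟨K', q', hq'⟩ := hm.exists_numerator h q
    refine ⟨p' * character L ⟨m, hm.mem⟩ ^ K', q' * character L ⟨m, hm.mem⟩ ^ K, ?_, ?_⟩
    · rw [map_mul, hq', map_pow]
      have := hm.restrict_ne_zero h δ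
      exact mul_ne_zero (mul_ne_zero hq (pow_ne_zero _ this)) (pow_ne_zero _ this)
    · rintro _ ⟨δ', hδ', rfl⟩ hne
      rw [map_mul, hq', map_pow] at hne
      have hq0 := left_ne_zero_of_mul (left_ne_zero_of_mul hne)
      have hc := hm.restrict_ne_zero h δ'
      rw [map_mul, map_mul, hp', hq', map_pow, map_pow]
      have := hpq δ' hδ' hq0
      simp only [Function.comp_apply] at this
      rw [this]
      field_simp

end IsFaceCut

end Affine

section Fans

variable {V : Type*} [AddCommGroup V] [Module ℝ V] {L : AddSubgroup V}

/-- A fan of regular cones: the combinatorial form of smoothness of the toric variety. -/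
structure IsRegularFan (L : AddSubgroup V) (F : Set (PointedCone ℝ V)) : Prop
    extends IsFan L F where
  regular : ∀ σ ∈ F, IsRegularCone L σ

variable {F : Set (PointedCone ℝ V)}

theorem IsFan.inf_mem (hF : IsFan L F) {σ τ : PointedCone ℝ V} (hσ : σ ∈ F) (hτ : τ ∈ F) :
    σ ⊓ τ ∈ F :=
  hF.face_mem σ hσ _ (hF.inter_isFace σ hσ τ hτ).1

theorem IsFan.isFaceOf_of_le (hF : IsFan L F) {σ τ : PointedCone ℝ V} (hσ : σ ∈ F) (hτ : τ ∈ F)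
    (h : τ ≤ σ) : τ.IsFaceOf σ := by
  have := (hF.inter_isFace σ hσ τ hτ).1
  rwa [inf_eq_right.2 h] at this

theorem IsRegularFan.exists_cut (hF : IsRegularFan L F) {σ τ : PointedCone ℝ V} (hσ : σ ∈ F)
    (hτ : τ ∈ F) (h : τ ≤ σ) : ∃ m, IsFaceCut L τ σ m :=
  (hF.regular σ hσ).exists_isFaceCut (hF.isFaceOf_of_le hσ hτ h)

theorem chart_restrict {σ τ : F} (h : τ.1 ≤ σ.1) (δ : AffineToric L τ.1) :
    chart L F σ (restrict L h δ) = chart L F τ δ :=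
  (Quot.sound ⟨h, rfl⟩ : Quot.mk (Glue L F) ⟨τ, δ⟩ = Quot.mk (Glue L F) ⟨σ, restrict L h δ⟩).symm

theorem exists_chart (x : ToricVariety L F) : ∃ (σ : F) (γ : AffineToric L σ.1),
    chart L F σ γ = x := by
  obtain ⟨⟨σ, γ⟩, rfl⟩ := Quot.exists_rep x
  exact ⟨σ, γ, rfl⟩

theorem IsRegularFan.exists_restrict_inf_eq (hF : IsRegularFan L F) {σ τ υ : PointedCone ℝ V}
    (hσ : σ ∈ F) (hτ : τ ∈ F) (hυ : υ ∈ F) {α : AffineToric L (σ ⊓ τ)} {β : AffineToric L (τ ⊓ υ)}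
    (h : restrict L inf_le_right α = restrict L inf_le_left β) :
    ∃ δ : AffineToric L (σ ⊓ υ), restrict L inf_le_left δ = restrict L inf_le_left α ∧
      restrict L inf_le_right δ = restrict L inf_le_right β := by
  obtain ⟨m, hm⟩ := hF.exists_cut hτ (hF.inf_mem hσ hτ) inf_le_right
  obtain ⟨m', hm'⟩ := hF.exists_cut hτ (hF.inf_mem hτ hυ) inf_le_left
  have hcut := hm.inf (hF.rational τ hτ) hm'
  have hne : restrict L inf_le_right α (character L ⟨m + m', hcut.mem⟩) ≠ 0 := by
    rw [show (⟨m + m', hcut.mem⟩ : dualMonoid L τ) = ⟨m, hm.mem⟩ + ⟨m', hm'.mem⟩ from rfl,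
      character_add, map_mul]
    exact mul_ne_zero (hm.restrict_ne_zero _ α) (h ▸ hm'.restrict_ne_zero _ β)
  obtain ⟨ε, hε⟩ := hcut.exists_restrict_eq (inf_le_left.trans inf_le_right) _ hne
  have hα : restrict L inf_le_left ε = α :=
    hm.restrict_injective inf_le_right (by rw [restrict_restrict, hε])
  have hβ : restrict L inf_le_right ε = β :=
    hm'.restrict_injective inf_le_left (by rw [restrict_restrict, hε, h])
  refine ⟨restrict L (le_inf (inf_le_left.trans inf_le_left) (inf_le_right.trans inf_le_right)) ε,
    ?_, ?_⟩
  · rw [restrict_restrict, ← hα, restrict_restrict]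
  · rw [restrict_restrict, ← hβ, restrict_restrict]

theorem IsRegularFan.exists_restrict_of_eqvGen (hF : IsRegularFan L F)
    {x y : Σ σ : F, AffineToric L σ.1} (h : Relation.EqvGen (Glue L F) x y) :
    ∃ α : AffineToric L (x.1.1 ⊓ y.1.1),
      restrict L inf_le_left α = x.2 ∧ restrict L inf_le_right α = y.2 := by
  induction h with
  | rel x y h =>
    obtain ⟨hle, h⟩ := h
    refine ⟨restrict L (le_inf le_rfl hle) x.2, ?_, ?_⟩
    · rw [restrict_restrict, restrict_rfl]
    · rw [restrict_restrict, h]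
  | refl x =>
    refine ⟨restrict L (le_inf le_rfl le_rfl) x.2, ?_, ?_⟩ <;> rw [restrict_restrict, restrict_rfl]
  | symm x y _ ih =>
    obtain ⟨α, hx, hy⟩ := ih
    refine ⟨restrict L (le_inf inf_le_right inf_le_left) α, ?_, ?_⟩
    · rw [restrict_restrict, hy]
    · rw [restrict_restrict, hx]
  | trans x y z _ _ ihxy ihyz =>
    obtain ⟨α, hx, hy⟩ := ihxy
    obtain ⟨β, hy', hz⟩ := ihyz
    rw [← hx, ← hz]
    exact hF.exists_restrict_inf_eq x.1.2 y.1.2 z.1.2 (hy.trans hy'.symm)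

theorem IsRegularFan.chart_eq_iff (hF : IsRegularFan L F) {σ τ : F} {γ : AffineToric L σ.1}
    {δ : AffineToric L τ.1} : chart L F σ γ = chart L F τ δ ↔
      ∃ α : AffineToric L (σ.1 ⊓ τ.1),
        restrict L inf_le_left α = γ ∧ restrict L inf_le_right α = δ := by
  refine ⟨fun h => hF.exists_restrict_of_eqvGen (x := ⟨σ, γ⟩) (y := ⟨τ, δ⟩)
    (Quot.eqvGen_exact h), ?_⟩
  rintro ⟨α, rfl, rfl⟩
  have hσ := chart_restrict (τ := ⟨σ.1 ⊓ τ.1, hF.inf_mem σ.2 τ.2⟩) (σ := σ) inf_le_left α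
  have hτ := chart_restrict (τ := ⟨σ.1 ⊓ τ.1, hF.inf_mem σ.2 τ.2⟩) (σ := τ) inf_le_right α
  exact hσ.trans hτ.symm

theorem isMorphism_chart (σ : F) : IsMorphism (chart L F σ) :=
  fun _ hW => ⟨hW σ, fun _ hk => hk σ⟩

theorem IsRegularFan.chart_injective (hF : IsRegularFan L F) (σ : F) :
    Function.Injective (chart L F σ) := by
  intro γ δ h
  obtain ⟨α, rfl, rfl⟩ := hF.chart_eq_iff.1 h
  rfl

theorem IsRegularFan.preimage_image_chart (hF : IsRegularFan L F) (σ τ : F)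
    (U : Set (AffineToric L σ.1)) : chart L F τ ⁻¹' (chart L F σ '' U) =
      restrict L (inf_le_right : σ.1 ⊓ τ.1 ≤ τ.1) ''
        (restrict L (inf_le_left : σ.1 ⊓ τ.1 ≤ σ.1) ⁻¹' U) := by
  ext δ
  constructor
  · rintro ⟨γ, hγ, h⟩
    obtain ⟨α, rfl, rfl⟩ := hF.chart_eq_iff.1 h
    exact ⟨α, hγ, rfl⟩
  · rintro ⟨α, hα, rfl⟩
    exact ⟨_, hα, hF.chart_eq_iff.2 ⟨α, rfl, rfl⟩⟩

theorem IsRegularFan.isOpenEmb_chart (hF : IsRegularFan L F) (σ : F) :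
    IsOpenEmb (chart L F σ) where
  injective := hF.chart_injective σ
  isMorphism := isMorphism_chart σ
  zOpen_image U hU τ := by
    rw [hF.preimage_image_chart]
    obtain ⟨m, hm⟩ := hF.exists_cut τ.2 (hF.inf_mem σ.2 τ.2) inf_le_right
    exact (hm.isOpenEmb_restrict _).zOpen_image _ (isMorphism_restrict _ U hU).1
  regular_image U hU k hk τ := by
    rw [hF.preimage_image_chart]
    obtain ⟨m, hm⟩ := hF.exists_cut τ.2 (hF.inf_mem σ.2 τ.2) inf_le_right
    refine (hm.isOpenEmb_restrict _).regular_image _ (isMorphism_restrict _ U hU).1 _ ?_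
    have h := (isMorphism_restrict (L := L) (inf_le_left : σ.1 ⊓ τ.1 ≤ σ.1) U hU).2 _ hk
    convert! h using 1
    ext α
    simp only [Function.comp_apply]
    rw [hF.chart_eq_iff.2 ⟨α, rfl, rfl⟩]

theorem IsRegularFan.isOpenEmb_inclusion {F' : Set (PointedCone ℝ V)} (hF : IsRegularFan L F)
    (hF' : IsRegularFan L F') (h : F ⊆ F') : IsOpenEmb (inclusion L h) := by
  have himage : ∀ (U : Set (ToricVariety L F)) (σ : F),
      chart L F' ⟨σ.1, h σ.2⟩ '' (chart L F σ ⁻¹' U) ⊆ inclusion L h '' U := by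
    rintro U σ _ ⟨γ, hγ, rfl⟩
    exact ⟨_, hγ, rfl⟩
  refine ⟨?_, ?_, fun U hU => zOpen_of_local ?_, fun U hU k hk => regular_of_local ?_⟩
  · intro x y hxy
    obtain ⟨σ, γ, rfl⟩ := exists_chart x
    obtain ⟨τ, δ, rfl⟩ := exists_chart y
    exact hF.chart_eq_iff.2
      ((hF'.chart_eq_iff (σ := ⟨σ.1, h σ.2⟩) (τ := ⟨τ.1, h τ.2⟩)).1 hxy)
  · exact isMorphism_of_cover hF.isOpenEmb_chart exists_chart
      fun σ => isMorphism_chart (F := F') ⟨σ.1, h σ.2⟩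
  · rintro _ ⟨x, hx, rfl⟩
    obtain ⟨σ, γ, rfl⟩ := exists_chart x
    exact ⟨_, (hF'.isOpenEmb_chart ⟨σ.1, h σ.2⟩).zOpen_image _ (hU σ), ⟨γ, hx, rfl⟩, himage U σ⟩
  · rintro _ ⟨x, hx, rfl⟩
    obtain ⟨σ, γ, rfl⟩ := exists_chart x
    exact ⟨_, (hF'.isOpenEmb_chart ⟨σ.1, h σ.2⟩).zOpen_image _ (hU σ), ⟨γ, hx, rfl⟩, k,
      (hF'.isOpenEmb_chart ⟨σ.1, h σ.2⟩).regular_image _ (hU σ) _ (hk σ), fun _ _ => rfl⟩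

theorem IsRegularFan.chart_mem_orbit_iff (hF : IsRegularFan L F) {σ τ : F} (h : τ.1 ≤ σ.1)
    {γ : AffineToric L σ.1} : chart L F σ γ ∈ orbit L F τ.1 ↔ ∃ δ : AffineToric L τ.1,
      restrict L h δ = γ ∧
        ∀ m : dualMonoid L τ.1, δ (character L m) ≠ 0 ↔ ∀ u ∈ τ.1, m.1 u = 0 := by
  constructor
  · rintro ⟨hτ, δ, hx, hδ⟩
    refine ⟨δ, hF.chart_injective σ ?_, hδ⟩
    rw [hx, chart_restrict]
  · rintro ⟨δ, rfl, hδ⟩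
    exact ⟨τ.2, δ, chart_restrict h δ, hδ⟩

theorem mem_orbitClosure_iff {τ : PointedCone ℝ V} {x : ToricVariety L F} :
    x ∈ orbitClosure L F τ ↔ ∀ W : Set (ToricVariety L F), ZOpen W → x ∈ W →
      ∃ y ∈ W, y ∈ orbit L F τ :=
  @mem_closure_iff _ zariski _ _

theorem IsRegularFan.le_of_chart_mem_orbit (hF : IsRegularFan L F) {σ : F} {τ : PointedCone ℝ V}
    {γ : AffineToric L σ.1} (h : chart L F σ γ ∈ orbit L F τ) : τ ≤ σ.1 := by
  obtain ⟨hτ, δ, hx, hδ⟩ := h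
  obtain ⟨α, -, rfl⟩ := (hF.chart_eq_iff (τ := ⟨τ, hτ⟩)).1 hx
  obtain ⟨m, hm⟩ := hF.exists_cut hτ (hF.inf_mem σ.2 hτ) inf_le_right
  intro u hu
  have := (hδ ⟨m, hm.mem⟩).1 (hm.restrict_ne_zero _ α) u hu
  exact ((hm.mem_iff u hu).2 this).1

theorem IsRegularFan.le_of_chart_mem_orbitClosure (hF : IsRegularFan L F) {σ : F}
    {τ : PointedCone ℝ V} {γ : AffineToric L σ.1} (h : chart L F σ γ ∈ orbitClosure L F τ) :
    τ ≤ σ.1 := by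
  obtain ⟨_, ⟨δ, rfl⟩, hδ⟩ :=
    mem_orbitClosure_iff.1 h _ (hF.isOpenEmb_chart σ).zOpen_range ⟨γ, rfl⟩
  exact hF.le_of_chart_mem_orbit hδ

theorem IsRegularFan.inclusion_mem_orbit_iff {F' : Set (PointedCone ℝ V)} (hF : IsRegularFan L F)
    (hF' : IsRegularFan L F') (h : F ⊆ F') {τ : PointedCone ℝ V} (hτ : τ ∈ F)
    {x : ToricVariety L F} : inclusion L h x ∈ orbit L F' τ ↔ x ∈ orbit L F τ := by
  constructor
  · rintro ⟨hτ', δ, hx, hδ⟩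
    exact ⟨hτ, δ, (hF.isOpenEmb_inclusion hF' h).injective hx, hδ⟩
  · rintro ⟨hτ, δ, rfl, hδ⟩
    exact ⟨h hτ, δ, rfl, hδ⟩

theorem IsRegularFan.inclusion_image_orbitClosure {F' : Set (PointedCone ℝ V)}
    (hF : IsRegularFan L F) (hF' : IsRegularFan L F') (h : F ⊆ F') {τ : PointedCone ℝ V}
    (hτ : τ ∈ F) (hstar : ∀ σ ∈ F', τ ≤ σ → σ ∈ F) :
    inclusion L h '' orbitClosure L F τ = orbitClosure L F' τ := by
  have hemb := hF.isOpenEmb_inclusion hF' h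
  ext y
  constructor
  · rintro ⟨x, hx, rfl⟩
    refine mem_orbitClosure_iff.2 fun W hW hxW => ?_
    obtain ⟨x', hx', hx'τ⟩ := mem_orbitClosure_iff.1 hx _ (hemb.isMorphism W hW).1 hxW
    exact ⟨_, hx', (hF.inclusion_mem_orbit_iff hF' h hτ).2 hx'τ⟩
  · intro hy
    obtain ⟨σ, γ, rfl⟩ := exists_chart y
    have hσ := hstar σ.1 σ.2 (hF'.le_of_chart_mem_orbitClosure hy)
    refine ⟨chart L F ⟨σ.1, hσ⟩ γ, mem_orbitClosure_iff.2 fun W hW hγ => ?_, rfl⟩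
    obtain ⟨_, ⟨x, hx, rfl⟩, hxτ⟩ :=
      mem_orbitClosure_iff.1 hy _ (hemb.zOpen_image W hW) ⟨_, hγ, rfl⟩
    exact ⟨x, hx, (hF.inclusion_mem_orbit_iff hF' h hτ).1 hxτ⟩

end Fans

section Exponents

variable {V : Type*} [AddCommGroup V] [Module ℝ V] {L : AddSubgroup V} {σ : PointedCone ℝ V}

theorem cast_floor_apply {m : Module.Dual ℝ V} (hm : m ∈ dualLattice L) {u : V} (hu : u ∈ L) :
    (⌊m u⌋ : ℝ) = m u := by
  obtain ⟨k, hk⟩ := hm u hu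
  rw [hk, Int.floor_intCast]

theorem cast_natFloor_apply {m : Module.Dual ℝ V} (hm : m ∈ dualMonoid L σ) {u : V} (hu : u ∈ L)
    (huσ : u ∈ σ) : (⌊m u⌋₊ : ℝ) = m u := by
  rw [natCast_floor_eq_intCast_floor (hm.2 u huσ), cast_floor_apply hm.1 hu]

theorem natFloor_add_apply {m m' : Module.Dual ℝ V} (hm : m ∈ dualMonoid L σ)
    (hm' : m' ∈ dualMonoid L σ) {u : V} (hu : u ∈ L) (huσ : u ∈ σ) :
    ⌊(m + m') u⌋₊ = ⌊m u⌋₊ + ⌊m' u⌋₊ := by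
  have h : (⌊(m + m') u⌋₊ : ℝ) = ⌊m u⌋₊ + ⌊m' u⌋₊ := by
    rw [cast_natFloor_apply (add_mem hm hm') hu huσ, cast_natFloor_apply hm hu huσ,
      cast_natFloor_apply hm' hu huσ, LinearMap.add_apply]
  exact_mod_cast h

theorem floor_apply_eq_zero_iff {m : Module.Dual ℝ V} (hm : m ∈ dualLattice L) {u : V}
    (hu : u ∈ L) : ⌊m u⌋ = 0 ↔ m u = 0 := by
  rw [← Int.cast_eq_zero (α := ℝ), cast_floor_apply hm hu]

theorem natFloor_apply_eq_zero_iff {m : Module.Dual ℝ V} (hm : m ∈ dualMonoid L σ) {u : V}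
    (hu : u ∈ L) (huσ : u ∈ σ) : ⌊m u⌋₊ = 0 ↔ m u = 0 := by
  rw [← Nat.cast_eq_zero (R := ℝ), cast_natFloor_apply hm hu huσ]

end Exponents

section Polynomials

variable {ι : Type*}

theorem exists_eval_ne_zero [Finite ι] (S : Set ι) {P : MvPolynomial ι ℂ} {z : ι → ℂ}
    (hz : ∀ i ∈ S, z i = 0) (hP : MvPolynomial.eval z P ≠ 0) :
    ∃ w : ι → ℂ, (∀ i, w i = 0 ↔ i ∈ S) ∧ MvPolynomial.eval w P ≠ 0 := by
  classical
  have := Fintype.ofFinite ι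
  set f : ι → MvPolynomial ι ℂ := fun i => if i ∈ S then 0 else MvPolynomial.X i with hf
  have heval : ∀ w : ι → ℂ, MvPolynomial.eval w (MvPolynomial.bind₁ f P) =
      MvPolynomial.eval (fun i => if i ∈ S then 0 else w i) P := fun w => by
    rw [← MvPolynomial.coe_aeval_eq_eval, RingHom.coe_coe, MvPolynomial.aeval_bind₁,
      ← MvPolynomial.coe_aeval_eq_eval, RingHom.coe_coe]
    congr 2
    ext i
    simp only [hf]
    split_ifs <;> simp
  have hne : MvPolynomial.bind₁ f P * ∏ i, MvPolynomial.X i ≠ 0 := by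
    refine mul_ne_zero (fun h0 => hP ?_)
      (Finset.prod_ne_zero_iff.2 fun i _ => MvPolynomial.X_ne_zero i)
    have := heval z
    rw [h0, map_zero] at this
    rw [this]
    congr 2
    ext i
    split_ifs with hi
    · exact hz i hi
    · rfl
  obtain ⟨w, hw⟩ :
      ∃ w, MvPolynomial.eval w (MvPolynomial.bind₁ f P * ∏ i, MvPolynomial.X i) ≠ 0 := by
    by_contra! h
    exact hne (MvPolynomial.funext fun w => by rw [h w, map_zero])
  rw [map_mul, heval, map_prod] at hw
  refine ⟨_, fun i => ?_, left_ne_zero_of_mul hw⟩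
  have h0 := Finset.prod_ne_zero_iff.1 (right_ne_zero_of_mul hw) i (Finset.mem_univ i)
  rw [MvPolynomial.eval_X] at h0
  by_cases hi : i ∈ S <;> simp [hi, h0]

theorem eval_eq_zero_of_forall_ne_zero [Finite ι] {P : MvPolynomial ι ℂ}
    (h : ∀ w : ι → ℂ, (∀ i, w i ≠ 0) → MvPolynomial.eval w P = 0) (z : ι → ℂ) :
    MvPolynomial.eval z P = 0 := by
  by_contra hz
  obtain ⟨w, hw, hwP⟩ := exists_eval_ne_zero ∅ (fun _ h => h.elim) hz
  exact hwP (h w fun i => by simp [hw])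

theorem exists_eq_X_mul {P : MvPolynomial ι ℂ} {i : ι}
    (h : ∀ z : ι → ℂ, z i = 0 → MvPolynomial.eval z P = 0) :
    ∃ Q : MvPolynomial ι ℂ, ∀ z, MvPolynomial.eval z P = z i * MvPolynomial.eval z Q := by
  classical
  set f : ι → MvPolynomial ι ℂ := fun j => if j = i then 0 else MvPolynomial.X j with hf
  have hdvd : P - MvPolynomial.bind₁ f P ∈ Ideal.span {(MvPolynomial.X i : MvPolynomial ι ℂ)} := by
    rw [← Ideal.Quotient.eq]
    have : (Ideal.Quotient.mkₐ ℂ (Ideal.span {(MvPolynomial.X i : MvPolynomial ι ℂ)})) =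
        (Ideal.Quotient.mkₐ ℂ (Ideal.span {(MvPolynomial.X i : MvPolynomial ι ℂ)})).comp
          (MvPolynomial.bind₁ f) := by
      refine MvPolynomial.algHom_ext fun j => ?_
      simp only [AlgHom.comp_apply, MvPolynomial.bind₁_X_right, hf]
      split_ifs with hj
      · subst hj
        rw [map_zero]
        exact Ideal.Quotient.eq_zero_iff_mem.2 (Ideal.mem_span_singleton_self _)
      · rfl
    exact congrArg (fun φ => φ P) this
  obtain ⟨Q, hQ⟩ := Ideal.mem_span_singleton'.1 hdvd
  refine ⟨Q, fun z => ?_⟩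
  have h0 : MvPolynomial.eval z (MvPolynomial.bind₁ f P) = 0 := by
    rw [← MvPolynomial.coe_aeval_eq_eval, RingHom.coe_coe, MvPolynomial.aeval_bind₁]
    refine h _ ?_
    simp [hf]
  have := congrArg (MvPolynomial.eval z) hQ
  rw [map_mul, map_sub, h0, sub_zero, MvPolynomial.eval_X, mul_comm] at this
  exact this.symm

end Polynomials

section Coordinates

variable {V : Type*} [AddCommGroup V] [Module ℝ V] {L : AddSubgroup V}
  {ι : Type*} {B : Module.Basis ι ℝ V} {η : PointedCone ℝ V}

/-- The cone `η` is generated by the lattice basis `B`. -/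
structure IsBasisCone (L : AddSubgroup V) (B : Module.Basis ι ℝ V) (η : PointedCone ℝ V) : Prop
    extends IsLatticeBasis L B where
  eq_hull : η = PointedCone.hull ℝ (Set.range B)

namespace IsBasisCone

theorem basis_mem (hη : IsBasisCone L B η) (i : ι) : B i ∈ η := by
  rw [hη.eq_hull]
  exact PointedCone.subset_hull ⟨i, rfl⟩

theorem natFloor_coord [DecidableEq ι] (i j : ι) :
    ⌊B.coord i (B j)⌋₊ = if j = i then 1 else 0 := by
  simp only [Module.Basis.coord_apply, Module.Basis.repr_self, Finsupp.single_apply]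
  split_ifs <;> simp

theorem mem_iff [Finite ι] (hη : IsBasisCone L B η) {x : V} : x ∈ η ↔ ∀ i, 0 ≤ B.coord i x := by
  rw [hη.eq_hull, ← Set.image_univ, mem_hull_basis]
  simp

theorem mem_face_iff [Finite ι] (hη : IsBasisCone L B η) {τ : PointedCone ℝ V}
    (hτ : τ.IsFaceOf η) {u : V} (hu : u ∈ η) : u ∈ τ ↔ ∀ i, B i ∉ τ → B.coord i u = 0 := by
  rw [hη.eq_hull, ← Set.image_univ] at hτ hu
  exact Toric.mem_face_iff hτ hu

theorem forall_mem_face_apply_eq_zero_iff [Finite ι] (hη : IsBasisCone L B η) {τ : PointedCone ℝ V}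
    (hτ : τ.IsFaceOf η) (m : Module.Dual ℝ V) :
    (∀ u ∈ τ, m u = 0) ↔ ∀ i, B i ∈ τ → m (B i) = 0 := by
  cases nonempty_fintype ι
  refine ⟨fun h i hi => h _ hi, fun h u hu => ?_⟩
  rw [apply_eq_sum_coord B]
  refine Finset.sum_eq_zero fun i _ => ?_
  by_cases hi : B i ∈ τ
  · rw [h i hi, mul_zero]
  · rw [(hη.mem_face_iff hτ (hτ.le hu)).1 hu i hi, zero_mul]

theorem mem_dualMonoid (hη : IsBasisCone L B η) {m : Module.Dual ℝ V} (hm : m ∈ dualLattice L)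
    (h : ∀ i, 0 ≤ m (B i)) : m ∈ dualMonoid L η := by
  refine ⟨hm, fun u hu => apply_nonneg_of_mem_hull (S := Set.range B) ?_ (hη.eq_hull ▸ hu)⟩
  rintro _ ⟨i, rfl⟩
  exact h i

theorem coord_mem_dualMonoid (hη : IsBasisCone L B η) (i : ι) : B.coord i ∈ dualMonoid L η :=
  hη.mem_dualMonoid (hη.coord_mem i) fun j => coord_nonneg_basis B i j

/-- The character of the `i`-th coordinate form. -/
noncomputable def coordChar (hη : IsBasisCone L B η) (i : ι) : dualMonoid L η :=
  ⟨B.coord i, hη.coord_mem_dualMonoid i⟩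

/-- The coordinates of a point of `U_η`. -/
noncomputable def coords (hη : IsBasisCone L B η) (γ : AffineToric L η) (i : ι) : ℂ :=
  γ (character L (hη.coordChar i))

/-- The point of `U_η` with coordinates `z`. -/
noncomputable def point [Fintype ι] (hη : IsBasisCone L B η) (z : ι → ℂ) : AffineToric L η :=
  mkPoint (fun m => ∏ i, z i ^ ⌊m.1 (B i)⌋₊) (by simp) fun m m' => by
    rw [← Finset.prod_mul_distrib]
    refine Finset.prod_congr rfl fun i _ => ?_
    rw [← pow_add, ← natFloor_add_apply m.2 m'.2 (hη.mem i) (hη.basis_mem i)]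
    rfl

theorem point_character [Fintype ι] (hη : IsBasisCone L B η) (z : ι → ℂ) (m : dualMonoid L η) :
    hη.point z (character L m) = ∏ i, z i ^ ⌊m.1 (B i)⌋₊ :=
  mkPoint_character _ _ _ m

@[simp] theorem point_coordChar [Fintype ι] (hη : IsBasisCone L B η) (z : ι → ℂ) (i : ι) :
    hη.point z (character L (hη.coordChar i)) = z i := by
  classical
  rw [point_character]
  simp only [coordChar, natFloor_coord, pow_ite, pow_one, pow_zero]
  simp

theorem eq_sum_nsmul_coordChar [Fintype ι] (hη : IsBasisCone L B η) (m : dualMonoid L η) :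
    m = ∑ i, ⌊m.1 (B i)⌋₊ • hη.coordChar i := by
  refine Subtype.ext (LinearMap.ext fun u => ?_)
  rw [AddSubmonoid.coe_finsetSum, LinearMap.sum_apply, apply_eq_sum_coord B]
  refine Finset.sum_congr rfl fun i _ => ?_
  change _ = (⌊m.1 (B i)⌋₊ • B.coord i) u
  rw [LinearMap.smul_apply, nsmul_eq_mul, cast_natFloor_apply m.2 (hη.mem i) (hη.basis_mem i),
    mul_comm]

theorem apply_character [Fintype ι] (hη : IsBasisCone L B η) (γ : AffineToric L η)
    (m : dualMonoid L η) :
    γ (character L m) = ∏ i, hη.coords γ i ^ ⌊m.1 (B i)⌋₊ := by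
  conv_lhs => rw [hη.eq_sum_nsmul_coordChar m, character_sum, map_prod]
  exact Finset.prod_congr rfl fun i _ => map_pow γ _ _

theorem point_coords [Fintype ι] (hη : IsBasisCone L B η) (γ : AffineToric L η) :
    hη.point (hη.coords γ) = γ :=
  affineToric_ext fun m => by rw [point_character, hη.apply_character]

theorem coords_point [Fintype ι] (hη : IsBasisCone L B η) (z : ι → ℂ) :
    hη.coords (hη.point z) = z :=
  funext fun i => hη.point_coordChar z i

theorem apply_character_ne_zero_iff [Finite ι] (hη : IsBasisCone L B η) (γ : AffineToric L η)
    (m : dualMonoid L η) :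
    γ (character L m) ≠ 0 ↔ ∀ i, hη.coords γ i = 0 → m.1 (B i) = 0 := by
  cases nonempty_fintype ι
  simp only [hη.apply_character, Finset.prod_ne_zero_iff, Finset.mem_univ, true_imp_iff, ne_eq,
    pow_eq_zero_iff', not_and_not_right, natFloor_apply_eq_zero_iff m.2 (hη.mem _) (hη.basis_mem _)]

theorem exists_mvPolynomial [Fintype ι] (hη : IsBasisCone L B η) (q : CoordRing L η) :
    ∃ P : MvPolynomial ι ℂ, ∀ z, hη.point z q = MvPolynomial.eval z P := by
  induction q using AddMonoidAlgebra.induction_linear with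
  | zero => exact ⟨0, by simp⟩
  | add p q hp hq =>
    obtain ⟨P, hP⟩ := hp
    obtain ⟨Q, hQ⟩ := hq
    exact ⟨P + Q, fun z => by rw [map_add, map_add, hP, hQ]⟩
  | single m c =>
    refine ⟨MvPolynomial.C c * ∏ i, MvPolynomial.X i ^ ⌊m.1 (B i)⌋₊, fun z => ?_⟩
    rw [single_eq_smul_character, map_smul, point_character, smul_eq_mul]
    simp

theorem coords_restrict_ne_zero [Finite ι] (hη : IsBasisCone L B η) {τ : PointedCone ℝ V}
    {m : Module.Dual ℝ V} (hm : IsFaceCut L τ η m) (h : τ ≤ η) (δ : AffineToric L τ) {i : ι}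
    (hi : B i ∉ τ) : hη.coords (restrict L h δ) i ≠ 0 := fun h0 =>
  hi ((hm.mem_iff _ (hη.basis_mem i)).2
    ((hη.apply_character_ne_zero_iff _ _).1 (hm.restrict_ne_zero h δ) i h0))

theorem apply_character_of_isFaceCut [Fintype ι] (hη : IsBasisCone L B η) {τ : PointedCone ℝ V}
    {m : Module.Dual ℝ V} (hm : IsFaceCut L τ η m) (h : τ ≤ η) (δ : AffineToric L τ)
    (m' : dualMonoid L τ) :
    δ (character L m') = ∏ i, hη.coords (restrict L h δ) i ^ ⌊m'.1 (B i)⌋ := by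
  obtain ⟨k, hk⟩ := hm.bound m'.1 m'.2
  refine mul_right_cancel₀ (pow_ne_zero k (hm.restrict_ne_zero h δ)) ?_
  conv_lhs => rw [restrict_character, hm.apply_mul_pow h δ m'.2 hk]
  rw [hη.apply_character, hη.apply_character, ← Finset.prod_pow, ← Finset.prod_mul_distrib]
  refine Finset.prod_congr rfl fun i _ => ?_
  have hexp : (⌊(m'.1 + k • m) (B i)⌋₊ : ℤ) = ⌊m'.1 (B i)⌋ + (⌊m (B i)⌋₊ * k : ℕ) := by
    have : (⌊(m'.1 + k • m) (B i)⌋₊ : ℝ) = ⌊m'.1 (B i)⌋ + (⌊m (B i)⌋₊ * k : ℕ) := by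
      rw [cast_natFloor_apply hk (hη.mem i) (hη.basis_mem i), cast_floor_apply m'.2.1 (hη.mem i),
        Nat.cast_mul, cast_natFloor_apply hm.mem (hη.mem i) (hη.basis_mem i), LinearMap.add_apply,
        LinearMap.smul_apply, nsmul_eq_mul, mul_comm (k : ℝ)]
    exact_mod_cast this
  rw [← pow_mul, ← zpow_natCast, hexp, ← zpow_natCast]
  by_cases h0 : hη.coords (restrict L h δ) i = 0
  · have hi := not_imp_comm.1 (hη.coords_restrict_ne_zero hm h δ) (not_not.2 h0)
    rw [(natFloor_apply_eq_zero_iff hm.mem (hη.mem i) (hη.basis_mem i)).2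
      ((hm.mem_iff _ (hη.basis_mem i)).1 hi), zero_mul, Nat.cast_zero, add_zero, zpow_zero, mul_one]
  · exact zpow_add₀ h0 _ _

section Fan

variable {F : Set (PointedCone ℝ V)} {σ τ : F}

theorem chart_mem_orbit [Finite ι] (hF : IsRegularFan L F) (hσ : IsBasisCone L B σ.1)
    (h : τ.1 ≤ σ.1) {γ : AffineToric L σ.1} (hγ : ∀ i, hσ.coords γ i = 0 ↔ B i ∈ τ.1) :
    chart L F σ γ ∈ orbit L F τ.1 := by
  cases nonempty_fintype ι
  obtain ⟨m, hm⟩ := hF.exists_cut σ.2 τ.2 h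
  obtain ⟨δ, rfl⟩ := hm.exists_restrict_eq h γ ((hσ.apply_character_ne_zero_iff _ _).2 fun i hi =>
    (hm.mem_iff _ (hσ.basis_mem i)).1 ((hγ i).1 hi))
  refine (hF.chart_mem_orbit_iff h).2 ⟨δ, rfl, fun m' => ?_⟩
  rw [hσ.apply_character_of_isFaceCut hm h, Finset.prod_ne_zero_iff,
    hσ.forall_mem_face_apply_eq_zero_iff (hF.isFaceOf_of_le σ.2 τ.2 h)]
  refine ⟨fun h0 i hi => (floor_apply_eq_zero_iff m'.2.1 (hσ.mem i)).1 ?_, fun h0 i _ => ?_⟩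
  · by_contra hne
    exact h0 i (Finset.mem_univ i) (by rw [(hγ i).2 hi, zero_zpow _ hne])
  · by_cases hi : B i ∈ τ.1
    · rw [(floor_apply_eq_zero_iff m'.2.1 (hσ.mem i)).2 (h0 i hi), zpow_zero]
      exact one_ne_zero
    · exact zpow_ne_zero _ (mt (hγ i).1 hi)

theorem coords_eq_zero_of_chart_mem_orbitClosure (hF : IsRegularFan L F)
    (hσ : IsBasisCone L B σ.1) (h : τ.1 ≤ σ.1) {γ : AffineToric L σ.1}
    (hγ : chart L F σ γ ∈ orbitClosure L F τ.1) {i : ι} (hi : B i ∈ τ.1) :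
    hσ.coords γ i = 0 := by
  by_contra hne
  obtain ⟨_, ⟨γ', hγ', rfl⟩, hδ⟩ := mem_orbitClosure_iff.1 hγ _
    ((hF.isOpenEmb_chart σ).zOpen_image _ (zOpen_ne_zero (character L (hσ.coordChar i))))
    ⟨γ, hne, rfl⟩
  obtain ⟨δ, rfl, hδ'⟩ := (hF.chart_mem_orbit_iff h).1 hδ
  rw [Set.mem_ofPred_eq, restrict_character] at hγ'
  have := (hδ' _).1 hγ' (B i) hi
  simp [coordChar] at this

theorem chart_mem_orbitClosure_iff [Finite ι] (hF : IsRegularFan L F) (hσ : IsBasisCone L B σ.1)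
    (h : τ.1 ≤ σ.1) (γ : AffineToric L σ.1) :
    chart L F σ γ ∈ orbitClosure L F τ.1 ↔ ∀ i, B i ∈ τ.1 → hσ.coords γ i = 0 := by
  cases nonempty_fintype ι
  refine ⟨fun hγ i => coords_eq_zero_of_chart_mem_orbitClosure hF hσ h hγ, fun hγ =>
    mem_orbitClosure_iff.2 fun W hW hγW => ?_⟩
  obtain ⟨q, hq, hqW⟩ := hW σ γ hγW
  obtain ⟨P, hP⟩ := hσ.exists_mvPolynomial q
  rw [← hσ.point_coords γ, hP] at hq
  obtain ⟨w, hw, hwP⟩ := exists_eval_ne_zero {i | B i ∈ τ.1} hγ hq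
  rw [← hP] at hwP
  exact ⟨_, hqW _ hwP, chart_mem_orbit hF hσ h fun i => by rw [hσ.coords_point]; exact hw i⟩

end Fan

end IsBasisCone

end Coordinates

section Scaling

variable {V : Type*} [AddCommGroup V] [Module ℝ V] {L : AddSubgroup V} {v : V}
  {σ τ : PointedCone ℝ V}

/-- The action of `t` by the one-parameter subgroup of `v`, extended to `t = 0`, on `U_σ` for a cone
`σ` that contains `v`. -/
noncomputable def scale (hv : v ∈ L) (hσ : v ∈ σ) (t : ℂ) (γ : AffineToric L σ) : AffineToric L σ :=
  mkPoint (fun m => t ^ ⌊m.1 v⌋₊ * γ (character L m)) (by simp [character_zero]) fun m m' => by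
    rw [character_add, map_mul, AddSubmonoid.coe_add, natFloor_add_apply m.2 m'.2 hv hσ, pow_add]
    ring

theorem scale_character (hv : v ∈ L) (hσ : v ∈ σ) (t : ℂ) (γ : AffineToric L σ)
    (m : dualMonoid L σ) :
    scale hv hσ t γ (character L m) = t ^ ⌊m.1 v⌋₊ * γ (character L m) :=
  mkPoint_character _ _ _ m

theorem scale_one (hv : v ∈ L) (hσ : v ∈ σ) (γ : AffineToric L σ) : scale hv hσ 1 γ = γ :=
  affineToric_ext fun m => by rw [scale_character, one_pow, one_mul]

theorem restrict_scale (hv : v ∈ L) (h : τ ≤ σ) (hτ : v ∈ τ) (t : ℂ) (γ : AffineToric L τ) :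
    restrict L h (scale hv hτ t γ) = scale hv (h hτ) t (restrict L h γ) :=
  affineToric_ext fun m => by
    rw [restrict_character, scale_character, scale_character, restrict_character]

theorem isMorphism_scale (hv : v ∈ L) (hσ : v ∈ σ) (t : ℂ) : IsMorphism (scale hv hσ t) := by
  refine isMorphism_specm fun a => ?_
  induction a using AddMonoidAlgebra.induction_linear with
  | zero =>
    simp only [map_zero]
    exact zero_mem _
  | add p q hp hq =>
    simp only [map_add]
    exact add_mem hp hq
  | single m c =>
    simp only [single_eq_smul_character, map_smul, scale_character]
    exact Subalgebra.smul_mem _ (Subalgebra.smul_mem _ (regular_eval _ _) (t ^ ⌊m.1 v⌋₊)) c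

theorem continuous_scale (hv : v ∈ L) (hσ : v ∈ σ) :
    @Continuous (ℂ × AffineToric L σ) _
      (@instTopologicalSpaceProd _ _ _ (classicalTopology (AffineToric L σ)))
      (classicalTopology (AffineToric L σ)) (fun p => scale hv hσ p.1 p.2) := by
  let _ : TopologicalSpace (AffineToric L σ) := classicalTopology (AffineToric L σ)
  refine continuous_specm fun a => ?_
  induction a using AddMonoidAlgebra.induction_linear with
  | zero =>
    simp only [map_zero]
    exact continuous_const
  | add p q hp hq =>
    simp only [map_add]
    exact hp.add hq
  | single m c =>
    simp only [single_eq_smul_character, map_smul, scale_character]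
    have hev : Continuous fun γ : AffineToric L σ => γ (character L m) :=
      continuous_of_regular (regular_eval _ _)
    exact ((continuous_fst.pow _).mul (hev.comp continuous_snd)).const_smul c

end Scaling

section FacesOfBasisCones

variable {V : Type*} [AddCommGroup V] [Module ℝ V] {L : AddSubgroup V} {ι : Type*} [Finite ι]
  {B : Module.Basis ι ℝ V}

theorem IsBasisCone.hull_isFaceOf {η : PointedCone ℝ V} (hη : IsBasisCone L B η) (s : Set ι) :
    (PointedCone.hull ℝ (B '' s)).IsFaceOf η := by
  refine ⟨fun x hx => hη.mem_iff.2 ((mem_hull_basis B s).1 hx).1, fun {x y a} hx hy ha h => ?_⟩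
  refine (mem_hull_basis B s).2 ⟨hη.mem_iff.1 hx, fun i hi => ?_⟩
  have h0 := ((mem_hull_basis B s).1 h).2 i hi
  rw [map_add, map_smul, smul_eq_mul] at h0
  have : a * B.coord i x = 0 := by
    linarith [mul_nonneg ha.le (hη.mem_iff.1 hx i), hη.mem_iff.1 hy i]
  exact (mul_eq_zero.1 this).resolve_left ha.ne'

theorem basis_mem_hull_iff {s : Set ι} {i : ι} :
    B i ∈ PointedCone.hull ℝ (B '' s) ↔ i ∈ s := by
  refine ⟨fun h => ?_, fun h => PointedCone.subset_hull ⟨i, h, rfl⟩⟩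
  by_contra hi
  simpa using ((mem_hull_basis B s).1 h).2 i hi

end FacesOfBasisCones

section StarFan

variable {V : Type*} [AddCommGroup V] [Module ℝ V] {L : AddSubgroup V} {v : V}
  {F : Set (PointedCone ℝ V)}

/-- A cone of the fan `F` generated by a lattice basis with `v` among its members; it gives a chart
of the toric variety with coordinates indexed by `Fin rank`, in which `V(Cone(v))` is the hyperplane
of the coordinate `vertex`. -/
structure StarChart (L : AddSubgroup V) (F : Set (PointedCone ℝ V)) (v : V) where
  cone : F
  rank : ℕ
  basis : Module.Basis (Fin rank) ℝ V
  vertex : Fin rank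
  isBasisCone : IsBasisCone L basis cone.1
  basis_vertex : basis vertex = v

/-- A fan in which every cone is contained in a cone generated by a lattice basis containing `v`. -/
structure IsStarFan (L : AddSubgroup V) (F : Set (PointedCone ℝ V)) (v : V) : Prop
    extends IsRegularFan L F where
  exists_le_cone : ∀ σ ∈ F, ∃ c : StarChart L F v, σ ≤ c.cone.1

/-- The divisor `E = V(Cone(v))`. -/
abbrev rayDivisor (L : AddSubgroup V) (F : Set (PointedCone ℝ V)) (v : V) :
    Set (ToricVariety L F) := orbitClosure L F (PointedCone.hull ℝ {v})

namespace StarChart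

variable (c : StarChart L F v)

theorem vertex_mem_cone : v ∈ c.cone.1 := by
  simpa only [c.basis_vertex] using c.isBasisCone.basis_mem c.vertex

theorem vertex_mem_lattice (c : StarChart L F v) : v ∈ L := by
  simpa only [c.basis_vertex] using c.isBasisCone.mem c.vertex

theorem hull_eq : PointedCone.hull ℝ {v} = PointedCone.hull ℝ (c.basis '' {c.vertex}) := by
  rw [Set.image_singleton, c.basis_vertex]

theorem hull_isFaceOf : (PointedCone.hull ℝ {v}).IsFaceOf c.cone.1 := by
  rw [c.hull_eq]
  exact c.isBasisCone.hull_isFaceOf _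

theorem coords_scale (t : ℂ) (γ : AffineToric L c.cone.1) (i : Fin c.rank) :
    c.isBasisCone.coords (scale c.vertex_mem_lattice c.vertex_mem_cone t γ) i =
      if i = c.vertex then t * c.isBasisCone.coords γ i else c.isBasisCone.coords γ i := by
  have hfloor : ⌊(c.isBasisCone.coordChar i).1 v⌋₊ = if c.vertex = i then 1 else 0 := by
    rw [← IsBasisCone.natFloor_coord (B := c.basis) i c.vertex, c.basis_vertex]
    rfl
  rw [IsBasisCone.coords, scale_character, hfloor]
  simp only [eq_comm (a := c.vertex)]
  split_ifs <;> simp [IsBasisCone.coords]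

theorem chart_mem_rayDivisor_iff (hF : IsStarFan L F v) (γ : AffineToric L c.cone.1) :
    chart L F c.cone γ ∈ rayDivisor L F v ↔ c.isBasisCone.coords γ c.vertex = 0 := by
  have hray : PointedCone.hull ℝ {v} ∈ F := hF.face_mem _ c.cone.2 _ c.hull_isFaceOf
  rw [rayDivisor, IsBasisCone.chart_mem_orbitClosure_iff hF.toIsRegularFan (τ := ⟨_, hray⟩)
    c.isBasisCone c.hull_isFaceOf.le]
  simp only [c.hull_eq, basis_mem_hull_iff, Set.mem_singleton_iff, forall_eq]

end StarChart

namespace IsStarFan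

theorem nonempty_starChart (hF : IsStarFan L F v) : Nonempty (StarChart L F v) :=
  let ⟨σ, hσ⟩ := hF.nonempty
  ⟨(hF.exists_le_cone σ hσ).choose⟩

theorem vertex_mem (hF : IsStarFan L F v) : v ∈ L :=
  let ⟨c⟩ := hF.nonempty_starChart
  c.vertex_mem_lattice

theorem ray_mem (hF : IsStarFan L F v) : PointedCone.hull ℝ {v} ∈ F :=
  let ⟨c⟩ := hF.nonempty_starChart
  hF.face_mem _ c.cone.2 _ c.hull_isFaceOf

theorem exists_starChart (hF : IsStarFan L F v) (x : ToricVariety L F) :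
    ∃ (c : StarChart L F v) (γ : AffineToric L c.cone.1), chart L F c.cone γ = x := by
  obtain ⟨σ, γ, rfl⟩ := exists_chart x
  obtain ⟨c, hle⟩ := hF.exists_le_cone σ.1 σ.2
  exact ⟨c, restrict L hle γ, chart_restrict hle γ⟩

/-- The action of `t` by the one-parameter subgroup of `v`, extended to `t = 0`. -/
noncomputable def scaling (hF : IsStarFan L F v) (t : ℂ) (x : ToricVariety L F) :
    ToricVariety L F :=
  chart L F (hF.exists_starChart x).choose.cone
    (scale hF.vertex_mem (hF.exists_starChart x).choose.vertex_mem_cone t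
      (hF.exists_starChart x).choose_spec.choose)

theorem scaling_chart (hF : IsStarFan L F v) (t : ℂ) (σ : F) (hσ : v ∈ σ.1)
    (γ : AffineToric L σ.1) :
    hF.scaling t (chart L F σ γ) = chart L F σ (scale hF.vertex_mem hσ t γ) := by
  obtain ⟨α, h1, h2⟩ := hF.chart_eq_iff.1
    (hF.exists_starChart (chart L F σ γ)).choose_spec.choose_spec
  have hv := (hF.exists_starChart (chart L F σ γ)).choose.vertex_mem_cone
  refine hF.chart_eq_iff.2 ⟨scale hF.vertex_mem (Submodule.mem_inf.2 ⟨hv, hσ⟩) t α, ?_, ?_⟩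
  · rw [restrict_scale, h1]
  · rw [restrict_scale, h2]

theorem scaling_one (hF : IsStarFan L F v) (x : ToricVariety L F) : hF.scaling 1 x = x := by
  obtain ⟨c, γ, rfl⟩ := hF.exists_starChart x
  rw [hF.scaling_chart 1 c.cone c.vertex_mem_cone, scale_one]

theorem isMorphism_scaling (hF : IsStarFan L F v) (t : ℂ) : IsMorphism (hF.scaling t) := by
  refine isMorphism_of_cover (ι := StarChart L F v) (c := fun c => chart L F c.cone)
    (fun c => hF.isOpenEmb_chart c.cone) hF.exists_starChart fun c => ?_
  have : hF.scaling t ∘ chart L F c.cone =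
      chart L F c.cone ∘ scale hF.vertex_mem c.vertex_mem_cone t :=
    funext fun γ => hF.scaling_chart t c.cone c.vertex_mem_cone γ
  rw [this]
  exact (isMorphism_chart c.cone).comp (isMorphism_scale _ _ _)

theorem continuous_scaling (hF : IsStarFan L F v) :
    @Continuous (ℂ × ToricVariety L F) _
      (@instTopologicalSpaceProd _ _ _ (classicalTopology (ToricVariety L F)))
      (classicalTopology (ToricVariety L F)) (fun p => hF.scaling p.1 p.2) := by
  let _ : TopologicalSpace (ToricVariety L F) := classicalTopology (ToricVariety L F)
  refine continuous_iff_continuousAt.2 fun ⟨t, x⟩ => ?_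
  obtain ⟨c, γ, rfl⟩ := hF.exists_starChart x
  let _ : TopologicalSpace (AffineToric L c.cone.1) := classicalTopology (AffineToric L c.cone.1)
  have hchart : Topology.IsOpenEmbedding (chart L F c.cone) :=
    .of_continuous_injective_isOpenMap (isMorphism_chart c.cone).continuous
      (hF.chart_injective c.cone) (hF.isOpenEmb_chart c.cone).isOpenMap
  have hcomp : (fun p : ℂ × ToricVariety L F => hF.scaling p.1 p.2) ∘
      Prod.map id (chart L F c.cone) =
        fun q => chart L F c.cone (scale hF.vertex_mem c.vertex_mem_cone q.1 q.2) :=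
    funext fun q => hF.scaling_chart q.1 c.cone c.vertex_mem_cone q.2
  refine ((Topology.IsOpenEmbedding.id.prodMap hchart).continuousAt_iff (x := (t, γ))).1 ?_
  rw [hcomp]
  exact (hchart.continuous.comp (continuous_scale _ _)).continuousAt

theorem scaling_zero_mem (hF : IsStarFan L F v) (x : ToricVariety L F) :
    hF.scaling 0 x ∈ rayDivisor L F v := by
  obtain ⟨c, γ, rfl⟩ := hF.exists_starChart x
  rw [hF.scaling_chart 0 c.cone c.vertex_mem_cone, c.chart_mem_rayDivisor_iff hF, c.coords_scale,
    if_pos rfl, zero_mul]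

theorem scaling_of_mem (hF : IsStarFan L F v) (t : ℂ) {x : ToricVariety L F}
    (hx : x ∈ rayDivisor L F v) : hF.scaling t x = x := by
  obtain ⟨c, γ, rfl⟩ := hF.exists_starChart x
  rw [c.chart_mem_rayDivisor_iff hF] at hx
  have hcoords : c.isBasisCone.coords (scale hF.vertex_mem c.vertex_mem_cone t γ) =
      c.isBasisCone.coords γ := by
    ext i
    rw [c.coords_scale]
    split_ifs with h
    · rw [h, hx, mul_zero]
    · rfl
  rw [hF.scaling_chart t c.cone c.vertex_mem_cone, ← c.isBasisCone.point_coords (scale _ _ t γ),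
    hcoords, c.isBasisCone.point_coords]

theorem isStrongDeformationRetract (hF : IsStarFan L F v) :
    @IsStrongDeformationRetract (ToricVariety L F) (classicalTopology _) (rayDivisor L F v) := by
  let _ : TopologicalSpace (ToricVariety L F) := classicalTopology (ToricVariety L F)
  have hc : Continuous fun p : ℂ × ToricVariety L F => hF.scaling p.1 p.2 := hF.continuous_scaling
  refine ⟨⟨hF.scaling 0, hc.comp (Continuous.prodMk_right 0)⟩, hF.scaling_zero_mem, ⟨⟨⟨⟨
    fun p => hF.scaling (1 - (p.1 : ℝ)) p.2, ?_⟩, fun x => ?_, fun x => ?_⟩, fun t x hx => ?_⟩⟩⟩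
  · exact hc.comp ((continuous_const.sub (Complex.continuous_ofReal.comp
      (continuous_subtype_val.comp continuous_fst))).prodMk continuous_snd)
  · simp [hF.scaling_one]
  · simp
  · exact hF.scaling_of_mem _ hx

end IsStarFan

end StarFan

section CharacterFunctions

variable {V : Type*} [AddCommGroup V] [Module ℝ V] {L : AddSubgroup V} {v : V}
  {F : Set (PointedCone ℝ V)}

theorem IsRegularFan.exists_chart_inf (hF : IsRegularFan L F) {σ τ : F} {x : ToricVariety L F}
    (hσ : x ∈ Set.range (chart L F σ)) (hτ : x ∈ Set.range (chart L F τ)) :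
    x ∈ Set.range (chart L F ⟨σ.1 ⊓ τ.1, hF.inf_mem σ.2 τ.2⟩) := by
  obtain ⟨γ, rfl⟩ := hσ
  obtain ⟨δ, hδ⟩ := hτ
  obtain ⟨α, rfl, -⟩ := hF.chart_eq_iff.1 hδ.symm
  exact ⟨α, (chart_restrict (τ := ⟨_, hF.inf_mem σ.2 τ.2⟩) inf_le_left α).symm⟩

/-- The character `m` of `U_σ` as a function on the whole toric variety: it is extended by zero. -/
noncomputable def charFun (σ : F) (m : dualMonoid L σ.1) : ToricVariety L F → ℂ :=
  Function.extend (chart L F σ) (fun γ => γ (character L m)) 0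

theorem charFun_chart (hF : IsRegularFan L F) {σ τ : F} (h : τ.1 ≤ σ.1) (m : dualMonoid L σ.1)
    (δ : AffineToric L τ.1) :
    charFun σ m (chart L F τ δ) = δ (character L ⟨m.1, dualMonoid_anti L h m.2⟩) := by
  rw [← chart_restrict h, charFun, (hF.chart_injective σ).extend_apply, restrict_character]

theorem regular_charFun (hF : IsRegularFan L F) (σ : F) (m : dualMonoid L σ.1) :
    charFun σ m ∈ regular (Set.range (chart L F σ)) := by
  rw [← Set.image_univ]
  refine (hF.isOpenEmb_chart σ).regular_image _ zOpen_univ _ ?_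
  rw [charFun, Function.extend_comp (hF.chart_injective σ)]
  exact regular_eval _ _

theorem charFun_scaling (hF : IsStarFan L F v) {σ τ : F} (h : τ.1 ≤ σ.1) (hτ : v ∈ τ.1)
    (m : dualMonoid L σ.1) (t : ℂ) (δ : AffineToric L τ.1) :
    charFun σ m (hF.scaling t (chart L F τ δ)) =
      t ^ ⌊m.1 v⌋₊ * charFun σ m (chart L F τ δ) := by
  rw [hF.scaling_chart t τ hτ, charFun_chart hF.toIsRegularFan h,
    charFun_chart hF.toIsRegularFan h, scale_character]

end CharacterFunctions

section StarCoordinates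

variable {V : Type*} [AddCommGroup V] [Module ℝ V] {L : AddSubgroup V} {v : V}
  {F : Set (PointedCone ℝ V)}

/-- The projection `x ↦ lim_{t → 0} t • x` to the divisor `E = V(Cone(v))`. -/
noncomputable def IsStarFan.proj (hF : IsStarFan L F v) (x : ToricVariety L F) :
    rayDivisor L F v :=
  ⟨hF.scaling 0 x, hF.scaling_zero_mem x⟩

theorem IsStarFan.isMorphism_proj (hF : IsStarFan L F v) : IsMorphism hF.proj :=
  isMorphism_codRestrict (hF.isMorphism_scaling 0) hF.scaling_zero_mem

theorem IsStarFan.proj_val (hF : IsStarFan L F v) (e : rayDivisor L F v) : hF.proj e.1 = e :=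
  Subtype.ext (hF.scaling_of_mem 0 e.2)

namespace StarChart

/-- The part of the divisor `E` in the chart `c`. -/
def patch (c : StarChart L F v) : Set (rayDivisor L F v) :=
  {e | e.1 ∈ Set.range (chart L F c.cone)}

/-- The `i`-th coordinate function of the chart `c`. -/
noncomputable def coordFun (c : StarChart L F v) (i : Fin c.rank) : ToricVariety L F → ℂ :=
  charFun c.cone (c.isBasisCone.coordChar i)

/-- The restriction of the `i`-th coordinate function to the divisor `E`. -/
noncomputable def divCoord (c : StarChart L F v) (i : Fin c.rank) (e : rayDivisor L F v) : ℂ :=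
  c.coordFun i e.1

/-- The point with coordinates `z` in the chart `c`. -/
noncomputable def point (c : StarChart L F v) (z : Fin c.rank → ℂ) : ToricVariety L F :=
  chart L F c.cone (c.isBasisCone.point z)

/-- The point of the divisor `E` with coordinates `z` in the chart `c`; the coordinate of `v` is
ignored. -/
noncomputable def divPoint (hF : IsStarFan L F v) (c : StarChart L F v) (z : Fin c.rank → ℂ) :
    rayDivisor L F v :=
  hF.proj (c.point z)

variable {c : StarChart L F v}

theorem zOpen_patch (hF : IsStarFan L F v) (c : StarChart L F v) : ZOpen c.patch :=
  (isMorphism_val _ _ (hF.isOpenEmb_chart c.cone).zOpen_range).1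

theorem proj_mem_patch_iff (hF : IsStarFan L F v) {x : ToricVariety L F} :
    hF.proj x ∈ c.patch ↔ x ∈ Set.range (chart L F c.cone) := by
  constructor
  · rintro ⟨γ, hγ⟩
    obtain ⟨c', δ, rfl⟩ := hF.exists_starChart x
    change chart L F c.cone γ = hF.scaling 0 (chart L F c'.cone δ) at hγ
    rw [hF.scaling_chart 0 c'.cone c'.vertex_mem_cone] at hγ
    obtain ⟨α, -, hα⟩ := hF.chart_eq_iff.1 hγ
    obtain ⟨m, hm⟩ := hF.exists_cut c'.cone.2 (hF.inf_mem c.cone.2 c'.cone.2) inf_le_right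
    have h0 := hm.restrict_ne_zero inf_le_right α
    rw [hα, scale_character] at h0
    obtain ⟨β, rfl⟩ := hm.exists_restrict_eq inf_le_right δ (right_ne_zero_of_mul h0)
    exact ⟨restrict L inf_le_left β, hF.chart_eq_iff.2 ⟨β, rfl, rfl⟩⟩
  · rintro ⟨γ, rfl⟩
    exact ⟨_, (hF.scaling_chart 0 c.cone c.vertex_mem_cone γ).symm⟩

theorem coordFun_chart (hF : IsStarFan L F v) (i : Fin c.rank) (γ : AffineToric L c.cone.1) :
    c.coordFun i (chart L F c.cone γ) = c.isBasisCone.coords γ i :=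
  charFun_chart hF.toIsRegularFan le_rfl _ γ

theorem regular_coordFun (hF : IsStarFan L F v) (c : StarChart L F v) (i : Fin c.rank) :
    c.coordFun i ∈ regular (Set.range (chart L F c.cone)) :=
  regular_charFun hF.toIsRegularFan _ _

theorem regular_divCoord (hF : IsStarFan L F v) (c : StarChart L F v) (i : Fin c.rank) :
    c.divCoord i ∈ regular c.patch :=
  regular_restrict (hF.isOpenEmb_chart c.cone).zOpen_range (c.regular_coordFun hF i) fun _ h => h

theorem coordFun_point (hF : IsStarFan L F v) (z : Fin c.rank → ℂ) (i : Fin c.rank) :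
    c.coordFun i (c.point z) = z i := by
  rw [point, coordFun_chart hF, c.isBasisCone.coords_point]

theorem point_coordFun (hF : IsStarFan L F v) {x : ToricVariety L F}
    (hx : x ∈ Set.range (chart L F c.cone)) : c.point (fun i => c.coordFun i x) = x := by
  obtain ⟨γ, rfl⟩ := hx
  simp only [coordFun_chart hF]
  exact congrArg _ (c.isBasisCone.point_coords γ)

theorem divCoord_proj (hF : IsStarFan L F v) {x : ToricVariety L F}
    (hx : x ∈ Set.range (chart L F c.cone)) (i : Fin c.rank) :
    c.divCoord i (hF.proj x) = if i = c.vertex then 0 else c.coordFun i x := by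
  obtain ⟨γ, rfl⟩ := hx
  refine (congrArg _ (hF.scaling_chart 0 c.cone c.vertex_mem_cone γ)).trans ?_
  rw [coordFun_chart hF, coordFun_chart hF, c.coords_scale, zero_mul]

theorem divCoord_proj_of_ne (hF : IsStarFan L F v) {x : ToricVariety L F}
    (hx : x ∈ Set.range (chart L F c.cone)) {i : Fin c.rank} (hi : i ≠ c.vertex) :
    c.divCoord i (hF.proj x) = c.coordFun i x := by
  rw [divCoord_proj hF hx, if_neg hi]

theorem divPoint_mem_patch (hF : IsStarFan L F v) (z : Fin c.rank → ℂ) :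
    c.divPoint hF z ∈ c.patch :=
  (proj_mem_patch_iff hF).2 ⟨_, rfl⟩

theorem divCoord_divPoint_of_ne (hF : IsStarFan L F v) (z : Fin c.rank → ℂ) {i : Fin c.rank}
    (hi : i ≠ c.vertex) : c.divCoord i (c.divPoint hF z) = z i := by
  rw [divPoint, divCoord_proj_of_ne hF (x := c.point z) ⟨_, rfl⟩ hi, coordFun_point hF]

theorem divPoint_divCoord (hF : IsStarFan L F v) {e : rayDivisor L F v} (he : e ∈ c.patch) :
    c.divPoint hF (fun i => c.divCoord i e) = e :=
  (congrArg hF.proj (point_coordFun hF he)).trans (hF.proj_val e)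

theorem isMorphism_divPoint (hF : IsStarFan L F v) (c : StarChart L F v) :
    IsMorphism (fun γ : Specm (MvPolynomial (Fin c.rank) ℂ) =>
      c.divPoint hF fun i => γ (MvPolynomial.X i)) := by
  refine hF.isMorphism_proj.comp ((isMorphism_chart c.cone).comp
    (f := fun γ : Specm (MvPolynomial (Fin c.rank) ℂ) =>
      c.isBasisCone.point fun i => γ (MvPolynomial.X i))
    (isMorphism_specm fun a => ?_))
  obtain ⟨P, hP⟩ := c.isBasisCone.exists_mvPolynomial a
  simp only [hP]
  exact regular_eval_mvPolynomial (fun i => regular_eval _ _) P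

theorem exists_fraction (hF : IsStarFan L F v) {W : Set (rayDivisor L F v)} (hW : ZOpen W)
    {f : rayDivisor L F v → ℂ} (hf : f ∈ regular W) {z : Fin c.rank → ℂ}
    (hz : c.divPoint hF z ∈ W) :
    ∃ P Q : MvPolynomial (Fin c.rank) ℂ, MvPolynomial.eval z Q ≠ 0 ∧
      ∀ w, MvPolynomial.eval w Q ≠ 0 → c.divPoint hF w ∈ W ∧
        f (c.divPoint hF w) = MvPolynomial.eval w P / MvPolynomial.eval w Q := by
  obtain ⟨hopen, hreg⟩ := c.isMorphism_divPoint hF W hW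
  set ev : (Fin c.rank → ℂ) → Specm (MvPolynomial (Fin c.rank) ℂ) := MvPolynomial.aeval with hev
  have hevP : ∀ w P, ev w P = MvPolynomial.eval w P := fun w P => by
    rw [hev, ← MvPolynomial.coe_aeval_eq_eval]
    rfl
  have hevX : ∀ w, (fun i => ev w (MvPolynomial.X i)) = w := fun w => by
    simp only [hevP, MvPolynomial.eval_X]
  have hz' : ev z ∈ (fun γ : Specm (MvPolynomial (Fin c.rank) ℂ) =>
      c.divPoint hF fun i => γ (MvPolynomial.X i)) ⁻¹' W := by
    rwa [Set.mem_preimage, hevX]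
  obtain ⟨r, hr, hrW⟩ := hopen _ hz'
  obtain ⟨p, q, hq, hpq⟩ := hreg f hf _ hz'
  rw [hevP] at hr hq
  refine ⟨p * r, q * r, by rw [map_mul]; exact mul_ne_zero hq hr, fun w hw => ?_⟩
  rw [map_mul] at hw
  have hwW := hrW (ev w) (by rw [hevP]; exact right_ne_zero_of_mul hw)
  have hfw := hpq _ hwW (by rw [hevP]; exact left_ne_zero_of_mul hw)
  rw [Set.mem_preimage, hevX] at hwW
  rw [Function.comp_apply, hevX, hevP, hevP] at hfw
  exact ⟨hwW, by rw [hfw, map_mul, map_mul, mul_div_mul_right _ _ (right_ne_zero_of_mul hw)]⟩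

theorem eq_zero_of_forall_divCoord_ne_zero (hF : IsStarFan L F v) {W : Set (rayDivisor L F v)}
    (hW : ZOpen W) (hWc : W ⊆ c.patch) {f : rayDivisor L F v → ℂ} (hf : f ∈ regular W)
    (h0 : ∀ e ∈ W, (∀ i ≠ c.vertex, c.divCoord i e ≠ 0) → f e = 0) : ∀ e ∈ W, f e = 0 := by
  intro e he
  have hpt := divPoint_divCoord hF (hWc he)
  rw [← hpt] at he ⊢
  obtain ⟨P, Q, hQ, hPQ⟩ := exists_fraction hF hW hf he
  have hzero := eval_eq_zero_of_forall_ne_zero (P := P * Q) (fun w hw => ?_)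
    fun i => c.divCoord i e
  · rw [map_mul] at hzero
    rw [(hPQ _ hQ).2, (mul_eq_zero.1 hzero).resolve_right hQ, zero_div]
  · rw [map_mul]
    by_cases hQw : MvPolynomial.eval w Q = 0
    · rw [hQw, mul_zero]
    · have h1 := h0 _ (hPQ w hQw).1 fun i hi => by
        rw [divCoord_divPoint_of_ne hF w hi]
        exact hw i
      rw [(hPQ w hQw).2, div_eq_zero_iff] at h1
      rw [h1.resolve_right hQw, zero_mul]

theorem exists_eq_mul_divCoord (hF : IsStarFan L F v) {W : Set (rayDivisor L F v)} (hW : ZOpen W)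
    (hWc : W ⊆ c.patch) {i : Fin c.rank} (hi : i ≠ c.vertex) {f : rayDivisor L F v → ℂ}
    (hf : f ∈ regular W) (hf0 : ∀ e ∈ W, c.divCoord i e = 0 → f e = 0) {e : rayDivisor L F v}
    (he : e ∈ W) :
    ∃ N ⊆ W, ZOpen N ∧ e ∈ N ∧ ∃ q ∈ regular N, ∀ y ∈ N, f y = q y * c.divCoord i y := by
  obtain ⟨P, Q, hQ, hPQ⟩ := exists_fraction hF hW hf ((divPoint_divCoord hF (hWc he)).symm ▸ he)
  -- `P * Q` vanishes on the whole hyperplane, also where `Q = 0` and `f` is not controlled.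
  obtain ⟨R, hR⟩ := exists_eq_X_mul (P := P * Q) (i := i) fun z hz => by
    rw [map_mul]
    by_cases hQz : MvPolynomial.eval z Q = 0
    · rw [hQz, mul_zero]
    · have h1 := hf0 _ (hPQ z hQz).1 (by rw [divCoord_divPoint_of_ne hF z hi, hz])
      rw [(hPQ z hQz).2, div_eq_zero_iff] at h1
      rw [h1.resolve_right hQz, zero_mul]
  have hreg : ∀ S : MvPolynomial (Fin c.rank) ℂ,
      (fun y => MvPolynomial.eval (fun i => c.divCoord i y) S) ∈ regular W := fun S =>
    regular_eval_mvPolynomial (fun i => regular_mono hWc (c.regular_divCoord hF i)) S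
  obtain ⟨hopen, hinv⟩ := regular_inv hW (hreg Q)
  refine ⟨_, fun y hy => hy.1, hopen, ⟨he, hQ⟩, _,
    mul_mem (regular_mono (fun y hy => hy.1) (hreg R)) (pow_mem hinv 2), fun y hy => ?_⟩
  have hfy := (hPQ _ hy.2).2
  rw [divPoint_divCoord hF (hWc hy.1)] at hfy
  have hRy := hR fun i => c.divCoord i y
  rw [map_mul] at hRy
  have hQy := hy.2
  simp only [Pi.mul_apply, Pi.pow_apply, Pi.inv_apply]
  rw [hfy]
  field_simp
  rw [hRy]
  ring

theorem isLocalEquation_divCoord (hF : IsStarFan L F v) {i : Fin c.rank} (hi : i ≠ c.vertex)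
    {Z : Set (rayDivisor L F v)} (hZ : ∀ e ∈ c.patch, e ∈ Z ↔ c.divCoord i e = 0) :
    IsLocalEquation c.patch Z (c.divCoord i) := by
  refine ⟨c.regular_divCoord hF i, fun e he => (hZ e he.1).1 he.2,
    fun W hWc hW f hf hfZ => ?_⟩
  choose N hNW hN heN q hq hfq using fun e : W => exists_eq_mul_divCoord hF hW hWc hi hf
    (fun e he h0 => hfZ e ⟨he, (hZ e (hWc he)).2 h0⟩) e.2
  obtain ⟨k, hk, hkq⟩ := exists_regular_glue hN
    (fun e he => Set.mem_iUnion.2 ⟨⟨e, he⟩, heN ⟨e, he⟩⟩) hq fun a b y hy => sub_eq_zero.1 <|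
      eq_zero_of_forall_divCoord_ne_zero hF ((hN a).inter (hN b))
        (Set.inter_subset_left.trans ((hNW a).trans hWc))
        (sub_mem (regular_mono Set.inter_subset_left (hq a))
          (regular_mono Set.inter_subset_right (hq b)))
        (fun x hx hne => sub_eq_zero.2 (mul_right_cancel₀ (hne i hi)
          ((hfq a x hx.1).symm.trans (hfq b x hx.2)))) y hy
  exact ⟨k, hk, fun e he => by rw [hkq ⟨e, he⟩ (heN ⟨e, he⟩), ← hfq _ _ (heN ⟨e, he⟩)]⟩

end StarChart

end StarCoordinates

section LineBundle

variable {V : Type*} [AddCommGroup V] [Module ℝ V] {L : AddSubgroup V} {v : V}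
  {F : Set (PointedCone ℝ V)}

namespace StarChart

/-- The point over `e` with fibre coordinate `t` in the chart `c`. -/
noncomputable def lift (c : StarChart L F v) (e : rayDivisor L F v) (t : ℂ) : ToricVariety L F :=
  c.point (Function.update (fun i => c.divCoord i e) c.vertex t)

variable {c : StarChart L F v}

theorem coordFun_lift (hF : IsStarFan L F v) (e : rayDivisor L F v) (t : ℂ) :
    c.coordFun c.vertex (c.lift e t) = t := by
  rw [lift, coordFun_point hF, Function.update_self]

theorem proj_lift (hF : IsStarFan L F v) {e : rayDivisor L F v} (he : e ∈ c.patch) (t : ℂ) :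
    hF.proj (c.lift e t) = e := by
  have hmem : hF.proj (c.lift e t) ∈ c.patch := divPoint_mem_patch hF _
  have hcoord : ∀ i, c.divCoord i (hF.proj (c.lift e t)) = c.divCoord i e := fun i => by
    have h0 := divCoord_proj hF (c := c) (x := c.lift e t) ⟨_, rfl⟩ i
    have h1 := divCoord_proj hF (c := c) (x := e.1) he i
    rw [hF.proj_val] at h1
    rw [h0, h1]
    split_ifs with hi
    · rfl
    · rw [lift, coordFun_point hF, Function.update_of_ne hi, divCoord]
  rw [← divPoint_divCoord hF hmem, ← divPoint_divCoord hF he]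
  simp only [hcoord, divPoint_divCoord hF he]

theorem lift_proj (hF : IsStarFan L F v) {x : ToricVariety L F}
    (hx : x ∈ Set.range (chart L F c.cone)) : c.lift (hF.proj x) (c.coordFun c.vertex x) = x := by
  conv_rhs => rw [← point_coordFun hF hx]
  rw [lift]
  congr 1
  ext i
  by_cases hi : i = c.vertex
  · rw [hi, Function.update_self]
  · rw [Function.update_of_ne hi, divCoord_proj_of_ne hF hx hi]

theorem isMorphism_lift (hF : IsStarFan L F v) (c : StarChart L F v) :
    IsMorphism (fun p : c.patch × ℂ => c.lift p.1.1 p.2) := by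
  refine (isMorphism_chart c.cone).comp
    (f := fun p : c.patch × ℂ =>
      c.isBasisCone.point (Function.update (fun i => c.divCoord i p.1.1) c.vertex p.2))
    (isMorphism_specm fun a => ?_)
  obtain ⟨P, hP⟩ := c.isBasisCone.exists_mvPolynomial a
  simp only [hP]
  refine regular_eval_mvPolynomial (f := fun i (p : c.patch × ℂ) =>
    Function.update (fun i => c.divCoord i p.1.1) c.vertex p.2 i) (fun i => ?_) P
  by_cases hi : i = c.vertex
  · simp only [hi, Function.update_self]
    exact regular_snd _
  · simp only [Function.update_of_ne hi]
    have hreg : (fun e : c.patch => c.divCoord i e.1) ∈ regular Set.univ :=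
      regular_restrict (c.zOpen_patch hF) (c.regular_divCoord hF i) fun e _ => e.2
    exact (isMorphism_fst _ zOpen_univ).2 _ hreg

theorem isTrivialization (hF : IsStarFan L F v) (c : StarChart L F v) :
    IsTrivialization hF.proj c.patch (c.coordFun c.vertex) := by
  have hmem : ∀ x : hF.proj ⁻¹' c.patch, x.1 ∈ Set.range (chart L F c.cone) := fun x =>
    (proj_mem_patch_iff hF).1 x.2
  have hproj : ∀ p : c.patch × ℂ, hF.proj (c.lift p.1.1 p.2) = p.1.1 := fun p =>
    proj_lift hF p.1.2 p.2
  have hlift : ∀ p : c.patch × ℂ, c.lift p.1.1 p.2 ∈ hF.proj ⁻¹' c.patch := fun p => by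
    rw [Set.mem_preimage, hproj]
    exact p.1.2
  refine ⟨c.zOpen_patch hF, isMorphism_prodMk
    (isMorphism_codRestrict (hF.isMorphism_proj.comp (isMorphism_val _)) fun x => x.2)
    (regular_restrict (hF.isOpenEmb_chart c.cone).zOpen_range (c.regular_coordFun hF c.vertex)
      fun x _ => hmem x),
    fun p => ⟨c.lift p.1.1 p.2, hlift p⟩,
    isMorphism_codRestrict (c.isMorphism_lift hF) hlift, fun x => ?_, fun p => ?_⟩
  · exact Subtype.ext (lift_proj hF (hmem x))
  · exact Prod.ext (Subtype.ext (hproj p)) (coordFun_lift hF _ _)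

theorem coord_apply_vertex (c : StarChart L F v) (i : Fin c.rank) :
    c.basis.coord i v = if i = c.vertex then 1 else 0 := by
  have h : c.basis.coord i (c.basis c.vertex) = if i = c.vertex then 1 else 0 := by
    simp only [Module.Basis.coord_apply, Module.Basis.repr_self_apply, eq_comm]
  simpa only [c.basis_vertex] using h

theorem coord_vertex_le (hF : IsStarFan L F v) (c c' : StarChart L F v) {x : V}
    (hx : x ∈ c.cone.1) (hx' : x ∈ c'.cone.1) :
    c.basis.coord c.vertex x ≤ c'.basis.coord c'.vertex x := by
  -- Subtracting the `v`-component of `x` in the first cone stays inside both cones.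
  have hmem : x - c.basis.coord c.vertex x • v ∈ c.cone.1 := c.isBasisCone.mem_iff.2 fun i => by
    rw [map_sub, map_smul, smul_eq_mul, coord_apply_vertex, sub_nonneg]
    split_ifs with h
    · rw [h, mul_one]
    · rw [mul_zero]
      exact c.isBasisCone.mem_iff.1 hx i
  have hmem' : x - c.basis.coord c.vertex x • v ∈ c.cone.1 ⊓ c'.cone.1 := by
    refine (hF.inter_isFace _ c.cone.2 _ c'.cone.2).1.mem_of_add_mem_left hmem
      (PointedCone.smul_mem _ (c.isBasisCone.mem_iff.1 hx c.vertex) c.vertex_mem_cone) ?_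
    rw [sub_add_cancel]
    exact ⟨hx, hx'⟩
  have hnonneg := c'.isBasisCone.mem_iff.1 hmem'.2 c'.vertex
  rwa [map_sub, map_smul, smul_eq_mul, coord_apply_vertex, if_pos rfl, mul_one,
    sub_nonneg] at hnonneg

theorem coord_vertex_eq (hF : IsStarFan L F v) (c c' : StarChart L F v) {x : V}
    (hx : x ∈ c.cone.1) (hx' : x ∈ c'.cone.1) :
    c.basis.coord c.vertex x = c'.basis.coord c'.vertex x :=
  le_antisymm (coord_vertex_le hF c c' hx hx') (coord_vertex_le hF c' c hx' hx)

theorem exists_transition (hF : IsStarFan L F v) (c c' : StarChart L F v) :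
    ∃ u ∈ regular (c.patch ∩ c'.patch), (∀ e ∈ c.patch ∩ c'.patch, u e ≠ 0) ∧
      ∀ x, hF.proj x ∈ c.patch ∩ c'.patch →
        c'.coordFun c'.vertex x = u (hF.proj x) * c.coordFun c.vertex x := by
  set τ : F := ⟨c.cone.1 ⊓ c'.cone.1, hF.inf_mem c.cone.2 c'.cone.2⟩
  have hv : v ∈ τ.1 := ⟨c.vertex_mem_cone, c'.vertex_mem_cone⟩
  have hm0 : ∀ x ∈ τ.1, (c'.basis.coord c'.vertex - c.basis.coord c.vertex) x = 0 := fun x hx => by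
    rw [LinearMap.sub_apply, coord_vertex_eq hF c c' hx.1 hx.2, sub_self]
  set m : dualMonoid L τ.1 := ⟨c'.basis.coord c'.vertex - c.basis.coord c.vertex,
    sub_mem (c'.isBasisCone.coord_mem _) (c.isBasisCone.coord_mem _), fun x hx => (hm0 x hx).ge⟩
  have hmτ : ∀ {e}, e ∈ c.patch ∩ c'.patch → e.1 ∈ Set.range (chart L F τ) := fun he =>
    hF.exists_chart_inf he.1 he.2
  refine ⟨fun e => charFun τ m e.1, regular_restrict (hF.isOpenEmb_chart τ).zOpen_range
    (regular_charFun hF.toIsRegularFan τ m) fun e he => hmτ he, fun e he => ?_, fun x hx => ?_⟩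
  · obtain ⟨δ, hδ⟩ := hmτ he
    beta_reduce
    rw [← hδ, charFun_chart hF.toIsRegularFan le_rfl]
    exact apply_character_ne_zero_of_forall_eq_zero hm0 δ
  · obtain ⟨δ, rfl⟩ : x ∈ Set.range (chart L F τ) := hF.exists_chart_inf
      ((proj_mem_patch_iff hF).1 hx.1) ((proj_mem_patch_iff hF).1 hx.2)
    have hu : charFun τ m (hF.proj (chart L F τ δ)).1 = charFun τ m (chart L F τ δ) := by
      refine (charFun_scaling hF le_rfl hv m 0 δ).trans ?_
      rw [hm0 v hv, Nat.floor_zero, pow_zero, one_mul]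
    beta_reduce
    rw [hu, coordFun, coordFun, charFun_chart hF.toIsRegularFan (σ := c'.cone) inf_le_right,
      charFun_chart hF.toIsRegularFan (σ := c.cone) inf_le_left,
      charFun_chart hF.toIsRegularFan le_rfl, ← map_mul, ← character_add]
    congr 2
    exact Subtype.ext (sub_add_cancel _ _).symm

end StarChart

/-- The bundle atlas of `hF.proj` whose fibre coordinates are the coordinates of `v` in the
charts. -/
def starAtlas (L : AddSubgroup V) (F : Set (PointedCone ℝ V)) (v : V) :
    Set (Set (rayDivisor L F v) × (ToricVariety L F → ℂ)) :=
  Set.range fun c : StarChart L F v => (c.patch, c.coordFun c.vertex)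

theorem IsStarFan.exists_mem_patch (hF : IsStarFan L F v) (e : rayDivisor L F v) :
    ∃ c : StarChart L F v, e ∈ c.patch :=
  let ⟨c, γ, h⟩ := hF.exists_starChart e.1
  ⟨c, γ, h⟩

theorem IsStarFan.isLineBundleAtlas (hF : IsStarFan L F v) :
    IsLineBundleAtlas hF.proj (starAtlas L F v) where
  isMorphism := hF.isMorphism_proj
  trivialization := by
    rintro _ ⟨c, rfl⟩
    exact c.isTrivialization hF
  cover e :=
    let ⟨c, hc⟩ := hF.exists_mem_patch e
    ⟨_, ⟨c, rfl⟩, hc⟩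
  linear := by
    rintro _ ⟨c, rfl⟩ _ ⟨c', rfl⟩
    exact c.exists_transition hF c'

end LineBundle

section Boundary

variable {V : Type*} [AddCommGroup V] [Module ℝ V] {L : AddSubgroup V} {v : V}
  {F : Set (PointedCone ℝ V)}

theorem charFun_chart_eq_prod {ι : Type*} [Fintype ι] {B : Module.Basis ι ℝ V}
    (hF : IsRegularFan L F) {σ τ : F} (h : τ.1 ≤ σ.1) (hσ : IsBasisCone L B σ.1)
    (m : dualMonoid L τ.1) {γ : AffineToric L σ.1} (hγ : ∀ i, B i ∉ τ.1 → hσ.coords γ i ≠ 0) :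
    charFun τ m (chart L F σ γ) = ∏ i, hσ.coords γ i ^ ⌊m.1 (B i)⌋ := by
  obtain ⟨k, hk⟩ := hF.exists_cut σ.2 τ.2 h
  obtain ⟨δ, rfl⟩ := hk.exists_restrict_eq h γ <|
    (hσ.apply_character_ne_zero_iff _ _).2 fun i hi =>
      (hk.mem_iff _ (hσ.basis_mem i)).1 (not_imp_comm.1 (hγ i) (not_not.2 hi))
  rw [chart_restrict h, charFun_chart hF le_rfl, hσ.apply_character_of_isFaceCut hk h]

/-- The rational function `χ^w` on the toric variety, for an integral form `w` with `w v = 1`; it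
is regular on the chart of the ray of `v`, and extended by zero. -/
noncomputable def IsStarFan.rayChar (hF : IsStarFan L F v) {w : Module.Dual ℝ V}
    (hw : w ∈ dualLattice L) (hwv : w v = 1) : ToricVariety L F → ℂ :=
  charFun ⟨_, hF.ray_mem⟩ ⟨w, hw, fun _ hx => apply_nonneg_of_mem_hull
    (by rintro _ rfl; exact hwv ▸ zero_le_one) hx⟩

/-- In each chart of the star of `v`, the sets `Z j` are the coordinate hyperplanes of `E`, and
`a j` is minus the value of `w` on the corresponding basis vector. -/
def IsBoundary {J : Type*} (w : Module.Dual ℝ V) (Z : J → Set (rayDivisor L F v)) (a : J → ℤ) :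
    Prop :=
  ∀ c : StarChart L F v, ∃ f : {i // i ≠ c.vertex} → J, Function.Injective f ∧
    (∀ i, ∀ e ∈ c.patch, e ∈ Z (f i) ↔ c.divCoord i.1 e = 0) ∧
    (∀ j ∉ Set.range f, ∀ e ∈ c.patch, e ∉ Z j) ∧ ∀ i, (a (f i) : ℝ) = -w (c.basis i.1)

theorem StarChart.rayChar_eq_mul_prod (hF : IsStarFan L F v) (c : StarChart L F v)
    {w : Module.Dual ℝ V} (hw : w ∈ dualLattice L) (hwv : w v = 1) {x : ToricVariety L F}
    (hx : hF.proj x ∈ c.patch) (hne : ∀ i ≠ c.vertex, c.divCoord i (hF.proj x) ≠ 0) :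
    hF.rayChar hw hwv x = c.coordFun c.vertex x *
      ∏ i : {i // i ≠ c.vertex}, c.divCoord i.1 (hF.proj x) ^ ⌊w (c.basis i.1)⌋ := by
  rw [proj_mem_patch_iff hF] at hx
  have hcoord : ∀ i ≠ c.vertex, c.divCoord i (hF.proj x) = c.coordFun i x := fun i hi =>
    divCoord_proj_of_ne hF hx hi
  have hprod : ∏ i : {i // i ≠ c.vertex}, c.divCoord i.1 (hF.proj x) ^ ⌊w (c.basis i.1)⌋ =
      ∏ i ∈ Finset.univ.erase c.vertex, c.coordFun i x ^ ⌊w (c.basis i)⌋ := by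
    rw [Finset.prod_subtype (Finset.univ.erase c.vertex) (p := (· ≠ c.vertex)) (by simp)]
    exact Finset.prod_congr rfl fun i _ => by rw [hcoord i i.2]
  obtain ⟨γ, rfl⟩ := hx
  simp only [coordFun_chart hF] at hprod hcoord ⊢
  rw [IsStarFan.rayChar, charFun_chart_eq_prod hF.toIsRegularFan c.hull_isFaceOf.le c.isBasisCone,
    hprod, ← Finset.mul_prod_erase _ _ (Finset.mem_univ c.vertex)]
  · simp only [c.basis_vertex, hwv, Int.floor_one, zpow_one]
  · intro i hi
    simp only [c.hull_eq, basis_mem_hull_iff, Set.mem_singleton_iff] at hi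
    rw [← hcoord i hi]
    exact hne i hi

namespace IsBoundary

variable {J : Type*} {Z : J → Set (rayDivisor L F v)} {a : J → ℤ} {w : Module.Dual ℝ V}

theorem notMem_iUnion_iff (hZ : IsBoundary w Z a) {c : StarChart L F v} {e : rayDivisor L F v}
    (he : e ∈ c.patch) : e ∉ ⋃ j, Z j ↔ ∀ i ≠ c.vertex, c.divCoord i e ≠ 0 := by
  obtain ⟨f, -, hf, hf', -⟩ := hZ c
  rw [Set.mem_iUnion, not_exists]
  constructor
  · exact fun h i hi h0 => h (f ⟨i, hi⟩) ((hf ⟨i, hi⟩ e he).2 h0)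
  · intro h j hj
    by_cases hjf : j ∈ Set.range f
    · obtain ⟨i, rfl⟩ := hjf
      exact h i.1 i.2 ((hf i e he).1 hj)
    · exact hf' j hjf e he hj

theorem exists_equations [Finite J] (hF : IsStarFan L F v) (hZ : IsBoundary w Z a)
    (c : StarChart L F v) : ∃ h : J → rayDivisor L F v → ℂ,
      (∀ j, IsLocalEquation c.patch (Z j) (h j)) ∧
      (∀ e ∈ c.patch \ ⋃ j, Z j, ∀ j, h j e ≠ 0) ∧
      ∀ e, ∏ᶠ j, h j e ^ a j =
        ∏ i : {i // i ≠ c.vertex}, c.divCoord i.1 e ^ (-⌊w (c.basis i.1)⌋) := by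
  have := Fintype.ofFinite J
  obtain ⟨f, hinj, hf, hf', ha⟩ := id (hZ c)
  set h : J → rayDivisor L F v → ℂ := Function.extend f (fun i => c.divCoord i.1) 1
  have hmem : ∀ i, h (f i) = c.divCoord i.1 := hinj.extend_apply _ _
  have hnotMem : ∀ j ∉ Set.range f, h j = 1 := fun j hj => Function.extend_apply' _ _ _ hj
  refine ⟨h, fun j => ?_, fun e he j => ?_, fun e => ?_⟩
  · by_cases hj : j ∈ Set.range f
    · obtain ⟨i, rfl⟩ := hj
      rw [hmem]
      exact StarChart.isLocalEquation_divCoord hF i.2 (hf i)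
    · rw [hnotMem j hj]
      exact ⟨one_mem _, fun e he => absurd he.2 (hf' j hj e he.1),
        fun W _ _ q hq _ => ⟨q, hq, fun e _ => (mul_one _).symm⟩⟩
  · by_cases hj : j ∈ Set.range f
    · obtain ⟨i, rfl⟩ := hj
      rw [hmem]
      exact (hZ.notMem_iUnion_iff he.1).1 he.2 i.1 i.2
    · rw [hnotMem j hj]
      exact one_ne_zero
  · rw [finprod_eq_prod_of_fintype]
    refine (Fintype.prod_of_injective f hinj _ _
      (fun j hj => by rw [hnotMem j hj, Pi.one_apply, one_zpow]) fun i => ?_).symm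
    have hfloor : ⌊w (c.basis i.1)⌋ = -a (f i) := by
      rw [← neg_eq_iff_eq_neg.2 (ha i), ← Int.cast_neg, Int.floor_intCast]
    rw [hmem, hfloor, neg_neg]

theorem isRationalCoordinate [Finite J] (hF : IsStarFan L F v) (hZ : IsBoundary w Z a)
    (hw : w ∈ dualLattice L) (hwv : w v = 1) :
    IsRationalCoordinate hF.proj (starAtlas L F v) Z a (hF.rayChar hw hwv) where
  eq_zero_of_forall_notMem W hW f hf h0 e he := by
    obtain ⟨c, hc⟩ := hF.exists_mem_patch e
    exact StarChart.eq_zero_of_forall_divCoord_ne_zero hF (hW.inter (c.zOpen_patch hF))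
      Set.inter_subset_right (regular_mono Set.inter_subset_left hf)
      (fun y hy hne => h0 y ⟨hy.1, (hZ.notMem_iUnion_iff hy.2).2 hne⟩) e ⟨he, hc⟩
  exists_equations := by
    rintro _ ⟨c, rfl⟩
    obtain ⟨h, hh, hne, hprod⟩ := hZ.exists_equations hF c
    refine ⟨h, hh, hne, fun x hx => ?_⟩
    have hx0 := (hZ.notMem_iUnion_iff hx.1).1 hx.2
    rw [c.rayChar_eq_mul_prod hF hw hwv hx.1 hx0, hprod, mul_assoc, ← Finset.prod_mul_distrib,
      Finset.prod_eq_one fun i _ => ?_, mul_one]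
    rw [← zpow_add₀ (hx0 i i.2), add_neg_cancel, zpow_zero]

theorem isTotalSpace [Finite J] (hF : IsStarFan L F v) (hZ : IsBoundary w Z a)
    (hw : w ∈ dualLattice L) (hwv : w v = 1) : IsTotalSpace hF.proj Subtype.val Z a := by
  refine ⟨starAtlas L F v, hF.isLineBundleAtlas,
    (hZ.isRationalCoordinate hF hw hwv).hasSheafOfSections hF.isLineBundleAtlas,
    ⟨(isMorphism_val _).comp (isMorphism_val _), fun e => hF.proj_val e.1⟩, ?_⟩
  rintro _ ⟨c, rfl⟩ ⟨_, he⟩ ⟨γ, rfl⟩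
  exact (StarChart.coordFun_chart hF _ γ).trans ((c.chart_mem_rayDivisor_iff hF γ).1 he)

end IsBoundary

end Boundary

section Rays

variable {V ι : Type*} [AddCommGroup V] [Module ℝ V] [Finite ι] {L : AddSubgroup V}
  {F : Set (PointedCone ℝ V)} {B : Module.Basis ι ℝ V} {η : PointedCone ℝ V} {u : V}

theorem IsBasisCone.exists_basis_eq (hη : IsBasisCone L B η) (hF : IsFan L F) (hηF : η ∈ F)
    (hu : u ∈ rayGenerators L F) (huη : u ∈ η) : ∃ i, B i = u := by
  obtain ⟨huL, hu0, huF, hprim⟩ := hu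
  have hface : (PointedCone.hull ℝ {u}).IsFaceOf η :=
    hF.isFaceOf_of_le hηF huF (Submodule.span_le.2 (Set.singleton_subset_iff.2 huη))
  obtain ⟨i, hi⟩ : ∃ i, B i ∈ PointedCone.hull ℝ {u} := by
    by_contra! h
    exact hu0 (B.forall_coord_eq_zero_iff.1 fun i =>
      (hη.mem_face_iff hface huη).1 (PointedCone.subset_hull rfl) i (h i))
  obtain ⟨K, hK⟩ := hprim _ (hη.mem i) hi
  obtain ⟨c, hc⟩ := hη.coord_mem i u huL
  have hmul : (K : ℝ) * c = 1 := by
    rw [← hc, ← nsmul_eq_mul, ← map_nsmul, ← hK, B.coord_apply, B.repr_self, Finsupp.single_eq_same]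
  have hK1 : K = 1 := Nat.dvd_one.1 (Int.natCast_dvd_natCast.1 ⟨c, by exact_mod_cast hmul.symm⟩)
  exact ⟨i, by rw [hK, hK1, one_smul]⟩

theorem IsBasisCone.basis_mem_rayGenerators (hη : IsBasisCone L B η) (hF : IsFan L F) (hηF : η ∈ F)
    (i : ι) : B i ∈ rayGenerators L F := by
  cases nonempty_fintype ι
  have himage : PointedCone.hull ℝ {B i} = PointedCone.hull ℝ (B '' {i}) := by
    rw [Set.image_singleton]
  refine ⟨hη.mem i, B.ne_zero i, ?_, fun x hxL hx => ⟨⌊B.coord i x⌋₊, ?_⟩⟩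
  · rw [himage]
    exact hF.face_mem η hηF _ (hη.hull_isFaceOf _)
  · obtain ⟨hnonneg, hzero⟩ := (mem_hull_basis B {i}).1 (himage ▸ hx)
    rw [← Nat.cast_smul_eq_nsmul ℝ, cast_natFloor_apply (hη.coord_mem_dualMonoid i) hxL
      (hη.mem_iff.2 hnonneg)]
    conv_lhs => rw [← B.sum_repr x]
    exact Finset.sum_eq_single i (fun j _ hj => by rw [← B.coord_apply, hzero j hj, zero_smul])
      fun h => absurd (Finset.mem_univ i) h

theorem injOn_hull_rayGenerators :
    Set.InjOn (fun u => PointedCone.hull ℝ {u}) (rayGenerators L F) := by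
  intro u hu u' hu' (h : PointedCone.hull ℝ {u} = PointedCone.hull ℝ {u'})
  obtain ⟨K, hK⟩ := hu.2.2.2 u' hu'.1 (h ▸ PointedCone.subset_hull rfl)
  obtain ⟨K', hK'⟩ := hu'.2.2.2 u hu.1 (h ▸ PointedCone.subset_hull rfl)
  have hsmul : ((K' * K : ℕ) : ℝ) • u = (1 : ℝ) • u := by
    rw [Nat.cast_smul_eq_nsmul, one_smul, mul_smul, ← hK, ← hK']
  have hmul : K' * K = 1 := by exact_mod_cast smul_left_injective ℝ hu.2.1 hsmul
  rw [hK, Nat.eq_one_of_mul_eq_one_left hmul, one_smul]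

theorem finite_rayGenerators (hF : F.Finite) : (rayGenerators L F).Finite :=
  Set.Finite.of_finite_image (hF.subset (Set.image_subset_iff.2 fun _ hu => hu.2.2.1))
    injOn_hull_rayGenerators

end Rays

section FullDimensional

variable {V : Type*} [AddCommGroup V] [Module ℝ V] {L : AddSubgroup V} {η : PointedCone ℝ V}

theorem IsRegularCone.exists_isBasisCone (hη : IsRegularCone L η)
    (h : Submodule.span ℝ (η : Set V) = ⊤) :
    ∃ (k : ℕ) (B : Module.Basis (Fin k) ℝ V), IsBasisCone L B η := by
  obtain ⟨k, B, s, hB, rfl⟩ := hη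
  refine ⟨k, B, hB, ?_⟩
  suffices hs : s = Set.univ by rw [hs, Set.image_univ]
  refine Set.eq_univ_of_forall fun i => ?_
  by_contra hi
  have hle : Submodule.span ℝ (PointedCone.hull ℝ (B '' s) : Set V) ≤ LinearMap.ker (B.coord i) :=
    Submodule.span_le.2 fun x hx => ((mem_hull_basis B s).1 hx).2 i hi
  have hcoord : B.coord i (B i) = 0 := hle (h ▸ Submodule.mem_top)
  simp at hcoord

theorem IsRegularCone.finiteDimensional (hη : IsRegularCone L η) : FiniteDimensional ℝ V := by
  obtain ⟨k, B, -⟩ := hη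
  exact Module.Finite.of_basis B

theorem eventually_add_smul_notMem {W : Submodule ℝ V} {p y : V} (h : p ∈ W → y ∉ W) :
    ∀ᶠ t in 𝓝[>] (0 : ℝ), p + t • y ∉ W := by
  have hsub : {t : ℝ | p + t • y ∈ W}.Subsingleton := by
    intro t ht t' ht'
    by_contra hne
    have hy : y ∈ W := by
      have hdiff := W.sub_mem ht ht'
      rw [add_sub_add_left_eq_sub, ← sub_smul] at hdiff
      exact (W.smul_mem_iff (sub_ne_zero.2 hne)).1 hdiff
    exact h ((W.add_mem_iff_left (W.smul_mem t hy)).1 ht) hy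
  exact ((nhdsWithin_mono 0 fun _ ht => ne_of_gt ht).trans (nhdsNE_le_cofinite 0))
    hsub.finite.compl_mem_cofinite

theorem exists_mem_forall_notMem {σ : PointedCone ℝ V} (hσ : Submodule.span ℝ (σ : Set V) = ⊤)
    {S : Set (Submodule ℝ V)} (hS : S.Finite) (htop : ⊤ ∉ S) : ∃ y ∈ σ, ∀ W ∈ S, y ∉ W := by
  induction S, hS using Set.Finite.induction_on with
  | empty => exact ⟨0, zero_mem σ, fun _ h => absurd h (Set.notMem_empty _)⟩
  | @insert W S _ hS ih =>
    obtain ⟨y, hy, hyS⟩ := ih fun h => htop (Set.mem_insert_of_mem W h)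
    obtain ⟨z, hz, hzW⟩ : ∃ z ∈ σ, z ∉ W := by
      by_contra! h
      exact htop (Or.inl (top_le_iff.1 (hσ ▸ Submodule.span_le.2 h)).symm)
    have hev : ∀ᶠ t in 𝓝[>] (0 : ℝ), ∀ W' ∈ insert W S, y + t • z ∉ W' :=
      ((hS.insert W).eventually_all).2 fun W' hW' => eventually_add_smul_notMem <|
        hW'.elim (fun h _ => h ▸ hzW) fun h hyW' => absurd hyW' (hyS W' h)
    obtain ⟨t, ht, ht0⟩ := (hev.and self_mem_nhdsWithin).exists
    exact ⟨y + t • z, add_mem hy (PointedCone.smul_mem σ (le_of_lt ht0) hz), ht⟩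

theorem IsBasisCone.eventually_add_smul_notMem {ι : Type*} [Finite ι] {B : Module.Basis ι ℝ V}
    (hη : IsBasisCone L B η) {p : V} (hp : p ∉ η) (y : V) :
    ∀ᶠ t in 𝓝[>] (0 : ℝ), p + t • y ∉ η := by
  obtain ⟨i, hi⟩ : ∃ i, B.coord i p < 0 := by
    by_contra! h
    exact hp (hη.mem_iff.2 h)
  have hcont : Continuous fun t : ℝ => B.coord i p + t * B.coord i y := by fun_prop
  have hlim : ∀ᶠ t in 𝓝 (0 : ℝ), B.coord i p + t * B.coord i y < 0 :=
    hcont.continuousAt.eventually_lt continuousAt_const (by simpa using hi)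
  filter_upwards [nhdsWithin_le_nhds hlim] with t ht hmem
  have hnonneg := hη.mem_iff.1 hmem i
  rw [map_add, map_smul, smul_eq_mul] at hnonneg
  exact hnonneg.not_gt ht

variable {F : Set (PointedCone ℝ V)} {σ : PointedCone ℝ V}

-- Near `p`, a segment from `p` in a generic direction of `σ` meets only full-dimensional cones.
theorem IsRegularFan.exists_mem_span_eq_top (hF : IsRegularFan L F)
    (hcov : (⋃ τ ∈ F, (τ : Set V)) = σ) (hσ : Submodule.span ℝ (σ : Set V) = ⊤) {p : V}
    (hp : p ∈ σ) : ∃ η ∈ F, Submodule.span ℝ (η : Set V) = ⊤ ∧ p ∈ η := by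
  obtain ⟨y, hy, hyF⟩ := exists_mem_forall_notMem hσ
    (S := (fun η : PointedCone ℝ V => Submodule.span ℝ (η : Set V)) '' F \ {⊤})
    ((hF.finite.image _).sdiff) fun h => h.2 rfl
  by_contra! h
  have hev : ∀ᶠ t in 𝓝[>] (0 : ℝ), ∀ η ∈ F, p + t • y ∉ η := by
    refine hF.finite.eventually_all.2 fun η hη => ?_
    by_cases htop : Submodule.span ℝ (η : Set V) = ⊤
    · obtain ⟨k, B, hB⟩ := (hF.regular η hη).exists_isBasisCone htop
      exact hB.eventually_add_smul_notMem (h η hη htop) y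
    · exact (eventually_add_smul_notMem fun _ => hyF _ ⟨⟨η, hη, rfl⟩, htop⟩).mono
        fun t ht hmem => ht (Submodule.subset_span hmem)
  obtain ⟨t, ht, ht0⟩ := (hev.and self_mem_nhdsWithin).exists
  have hmem : p + t • y ∈ (⋃ τ ∈ F, (τ : Set V)) :=
    hcov ▸ add_mem hp (PointedCone.smul_mem σ (le_of_lt ht0) hy)
  obtain ⟨η, hη, hmem⟩ := Set.mem_iUnion₂.1 hmem
  exact ht η hη hmem

theorem IsRegularFan.exists_le_span_eq_top (hF : IsRegularFan L F)
    (hcov : (⋃ τ ∈ F, (τ : Set V)) = σ) (hσ : Submodule.span ℝ (σ : Set V) = ⊤)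
    {τ : PointedCone ℝ V} (hτ : τ ∈ F) :
    ∃ η ∈ F, Submodule.span ℝ (η : Set V) = ⊤ ∧ τ ≤ η := by
  classical
  obtain ⟨k, B, s, -, rfl⟩ := hF.regular τ hτ
  have hgen : ∀ i : s, B i ∈ PointedCone.hull ℝ (B '' s) := fun i =>
    PointedCone.subset_hull ⟨i, i.2, rfl⟩
  have hsum : ∑ i : s, B i ∈ PointedCone.hull ℝ (B '' s) := sum_mem fun i _ => hgen i
  obtain ⟨η, hη, htop, hsumη⟩ := hF.exists_mem_span_eq_top hcov hσ
    (show ∑ i : s, B i ∈ (σ : Set V) from hcov ▸ Set.mem_biUnion hτ hsum)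
  refine ⟨η, hη, htop, Submodule.span_le.2 ?_⟩
  rintro _ ⟨i, hi, rfl⟩
  exact ((hF.inter_isFace η hη _ hτ).2.mem_of_sum_mem hgen ⟨hsumη, hsum⟩ ⟨i, hi⟩).1

end FullDimensional

section StarNeighborhood

variable {V : Type*} [AddCommGroup V] [Module ℝ V] {L : AddSubgroup V} {v : V}
  {F : Set (PointedCone ℝ V)} {σ ρ τ : PointedCone ℝ V}

theorem starNeighborhood_subset (hF : IsFan L F) (ρ : PointedCone ℝ V) :
    starNeighborhood F ρ ⊆ F := by
  rintro τ ⟨η, hη, -, -, hτ⟩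
  exact hF.face_mem η hη τ hτ

theorem mem_starNeighborhood_of_le (hF : IsRegularFan L F)
    (hcov : (⋃ τ ∈ F, (τ : Set V)) = σ) (hσ : Submodule.span ℝ (σ : Set V) = ⊤)
    (hρ : ρ ∈ F) (hτ : τ ∈ F) (h : ρ ≤ τ) : τ ∈ starNeighborhood F ρ := by
  obtain ⟨η, hη, htop, hle⟩ := hF.exists_le_span_eq_top hcov hσ hτ
  exact ⟨η, hη, by rw [htop, finrank_top], hF.isFaceOf_of_le hη hρ (h.trans hle),
    hF.isFaceOf_of_le hη hτ hle⟩

theorem IsFan.isFan_starNeighborhood (hF : IsFan L F) (h : (starNeighborhood F ρ).Nonempty) :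
    IsFan L (starNeighborhood F ρ) where
  finite := hF.finite.subset (starNeighborhood_subset hF ρ)
  nonempty := h
  rational σ hσ := hF.rational σ (starNeighborhood_subset hF ρ hσ)
  stronglyConvex σ hσ := hF.stronglyConvex σ (starNeighborhood_subset hF ρ hσ)
  face_mem := by
    rintro σ ⟨η, hη, hdim, hρ, hσ⟩ τ hτ
    exact ⟨η, hη, hdim, hρ, hτ.trans hσ⟩
  inter_isFace σ hσ τ hτ :=
    hF.inter_isFace σ (starNeighborhood_subset hF ρ hσ) τ (starNeighborhood_subset hF ρ hτ)

theorem IsRegularFan.isStarFan_starNeighborhood (hF : IsRegularFan L F)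
    (hcov : (⋃ τ ∈ F, (τ : Set V)) = σ) (hσ : Submodule.span ℝ (σ : Set V) = ⊤)
    (hv : v ∈ rayGenerators L F) :
    IsStarFan L (starNeighborhood F (PointedCone.hull ℝ {v})) v where
  toIsFan := hF.toIsFan.isFan_starNeighborhood
    ⟨_, mem_starNeighborhood_of_le hF hcov hσ hv.2.2.1 hv.2.2.1 le_rfl⟩
  regular τ hτ := hF.regular τ (starNeighborhood_subset hF.toIsFan _ hτ)
  exists_le_cone := by
    rintro τ ⟨η, hη, hdim, hρ, hτ⟩
    have : FiniteDimensional ℝ V := (hF.regular η hη).finiteDimensional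
    obtain ⟨k, B, hB⟩ :=
      (hF.regular η hη).exists_isBasisCone (Submodule.eq_top_of_finrank_eq hdim)
    obtain ⟨i, hi⟩ := hB.exists_basis_eq hF.toIsFan hη hv (hρ.le (PointedCone.subset_hull rfl))
    exact ⟨⟨⟨η, η, hη, hdim, hρ, .rfl⟩, k, B, i, hB, hi⟩, hτ.le⟩

end StarNeighborhood

section StarRays

variable {n : ℕ} {L : AddSubgroup (Fin n → ℝ)} {F : Set (PointedCone ℝ (Fin n → ℝ))}
  {v : Fin n → ℝ}

namespace StarChart

variable (c : StarChart L F v)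

theorem hull_pair_eq (i : Fin c.rank) :
    PointedCone.hull ℝ {v, c.basis i} = PointedCone.hull ℝ (c.basis '' {c.vertex, i}) := by
  rw [Set.image_pair, c.basis_vertex]

theorem hull_pair_isFaceOf (i : Fin c.rank) :
    (PointedCone.hull ℝ {v, c.basis i}).IsFaceOf c.cone.1 := by
  rw [c.hull_pair_eq]
  exact c.isBasisCone.hull_isFaceOf _

theorem hull_pair_mem (hF : IsFan L F) (i : Fin c.rank) : PointedCone.hull ℝ {v, c.basis i} ∈ F :=
  hF.face_mem _ c.cone.2 _ (c.hull_pair_isFaceOf i)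

theorem basis_mem_starRays (hF : IsFan L F) {i : Fin c.rank} (hi : i ≠ c.vertex) :
    c.basis i ∈ starRays L F v := by
  refine ⟨c.isBasisCone.basis_mem_rayGenerators hF c.cone.2 i, fun h => hi ?_, c.hull_pair_mem hF i⟩
  exact c.basis.injective (h.trans c.basis_vertex.symm)

theorem exists_basis_eq_of_mem_starRays (hF : IsFan L F) {u : Fin n → ℝ} (hu : u ∈ starRays L F v)
    (huc : u ∈ c.cone.1) : ∃ i ≠ c.vertex, c.basis i = u := by
  obtain ⟨i, rfl⟩ := c.isBasisCone.exists_basis_eq hF c.cone.2 hu.1 huc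
  exact ⟨i, fun hi => hu.2.1 (hi ▸ c.basis_vertex), rfl⟩

theorem mem_orbitClosure_pair_iff (hF : IsStarFan L F v) (i : Fin c.rank) {e : rayDivisor L F v}
    (he : e ∈ c.patch) :
    e.1 ∈ orbitClosure L F (PointedCone.hull ℝ {v, c.basis i}) ↔ c.divCoord i e = 0 := by
  obtain ⟨_, hv⟩ := e
  obtain ⟨γ, rfl⟩ := he
  rw [divCoord, coordFun_chart hF, IsBasisCone.chart_mem_orbitClosure_iff hF.toIsRegularFan
    (τ := ⟨_, c.hull_pair_mem hF.toIsFan i⟩) c.isBasisCone (c.hull_pair_isFaceOf i).le]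
  simp only [hull_pair_eq, basis_mem_hull_iff, Set.mem_insert_iff, Set.mem_singleton_iff,
    forall_eq_or_imp, forall_eq, (c.chart_mem_rayDivisor_iff hF γ).1 hv, true_and]

end StarChart

theorem isBoundary_starRays (hF : IsStarFan L F v) {w : Module.Dual ℝ (Fin n → ℝ)}
    {a : starRays L F v → ℤ} (ha : ∀ u, (a u : ℝ) = -w u.1) :
    IsBoundary w (fun u : starRays L F v =>
      (Subtype.val ⁻¹' orbitClosure L F (PointedCone.hull ℝ {v, u.1}) :
        Set (rayDivisor L F v))) a := by
  refine fun c => ⟨fun i => ⟨c.basis i, c.basis_mem_starRays hF.toIsFan i.2⟩,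
    fun i j h => Subtype.ext (c.basis.injective (congrArg Subtype.val h)),
    fun i e he => c.mem_orbitClosure_pair_iff hF i he, ?_, fun i => ha _⟩
  rintro u hu ⟨_, _⟩ ⟨γ, rfl⟩ he
  obtain ⟨i, hi, hiu⟩ := c.exists_basis_eq_of_mem_starRays hF.toIsFan u.2
    (hF.le_of_chart_mem_orbitClosure he (PointedCone.subset_hull (Set.mem_insert_of_mem v rfl)))
  exact hu ⟨⟨i, hi⟩, Subtype.ext hiu⟩

theorem finite_starRays (hF : F.Finite) : (starRays L F v).Finite :=
  (finite_rayGenerators hF).subset fun _ hu => hu.1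

end StarRays

section Lattice

theorem IsSmoothCone.isRegularCone {V : Type*} [NormedAddCommGroup V] [NormedSpace ℝ V]
    [FiniteDimensional ℝ V] {L : AddSubgroup V} [hdisc : DiscreteTopology L]
    (hspan : Submodule.span ℝ (L : Set V) = ⊤) {σ : PointedCone ℝ V} (hσ : IsSmoothCone L σ) :
    IsRegularCone L σ := by
  obtain ⟨k, b, s, rfl⟩ := hσ
  let L' : Submodule ℤ V := AddSubgroup.toIntSubmodule L
  have : DiscreteTopology L' := hdisc
  have : IsZLattice ℝ L' := ⟨hspan⟩
  let b' : Module.Basis (Fin k) ℤ L' :=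
    b.map (AddEquiv.toIntLinearEquiv (AddEquiv.refl L : L ≃+ L'))
  have hb' : ∀ i, b'.ofZLatticeBasis ℝ L' i = b i := fun i => b'.ofZLatticeBasis_apply ℝ L' i
  refine ⟨k, b'.ofZLatticeBasis ℝ L', s, ⟨fun i => hb' i ▸ (b i).2, fun i u hu =>
    ⟨b'.repr ⟨u, hu⟩ i, b'.ofZLatticeBasis_repr_apply ℝ L' ⟨u, hu⟩ i⟩⟩, ?_⟩
  simp only [hb']

theorem mem_dualLattice_closure {V : Type*} [AddCommGroup V] [Module ℝ V] {S : Set V}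
    {m : Module.Dual ℝ V} (h : ∀ u ∈ S, ∃ k : ℤ, m u = k) :
    m ∈ dualLattice (AddSubgroup.closure S) := by
  have hle : AddSubgroup.closure S ≤ (Int.castAddHom ℝ).range.comap m.toAddMonoidHom :=
    (AddSubgroup.closure_le _).2 fun u hu => (h u hu).imp fun _ hk => hk.symm
  exact fun u hu => (hle hu).imp fun _ hk => hk.symm

variable {n : ℕ} {G : Subgroup (Matrix.SpecialLinearGroup (Fin n) ℂ)} {ε : ℂ}
  {b : Module.Basis (Fin n) ℂ (Fin n → ℂ)}

theorem span_single_eq_top :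
    Submodule.span ℝ (Set.range fun i : Fin n => (Pi.single i 1 : Fin n → ℝ)) = ⊤ := by
  simp only [← Pi.basisFun_apply]
  exact (Pi.basisFun ℝ (Fin n)).span_eq

theorem span_lattice : Submodule.span ℝ (lattice G ε b : Set (Fin n → ℝ)) = ⊤ :=
  top_le_iff.1 <| span_single_eq_top.ge.trans <| Submodule.span_mono fun _ hx =>
    AddSubgroup.subset_closure (Or.inl hx)

theorem lattice_le_span [Finite G] : lattice G ε b ≤ (Submodule.span ℤ (Set.range fun i =>
    (Pi.single i (Nat.card G : ℝ)⁻¹ : Fin n → ℝ))).toAddSubgroup := by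
  have hr : (Nat.card G : ℝ) ≠ 0 := Nat.cast_ne_zero.2 Nat.card_pos.ne'
  have hmem : ∀ (i : Fin n) (k : ℕ), (Pi.single i ((k : ℝ) / Nat.card G) : Fin n → ℝ) ∈
      Submodule.span ℤ (Set.range fun i => (Pi.single i (Nat.card G : ℝ)⁻¹ : Fin n → ℝ)) :=
    fun i k => by
      rw [div_eq_mul_inv, ← nsmul_eq_mul, Pi.single_smul]
      exact nsmul_mem (Submodule.subset_span (Set.mem_range_self i)) k
  refine (AddSubgroup.closure_le _).2 ?_
  rintro x (⟨i, rfl⟩ | ⟨g, -, a, ha⟩)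
  · have hi := hmem i (Nat.card G)
    rwa [div_self hr] at hi
  · rw [← Finset.univ_sum_single x]
    exact sum_mem fun i _ => (ha i).2.2 ▸ hmem i (a i)

instance [Finite G] : DiscreteTopology (lattice G ε b) := by
  have hr : (Nat.card G : ℝ)⁻¹ ≠ 0 := inv_ne_zero (Nat.cast_ne_zero.2 Nat.card_pos.ne')
  let B : Module.Basis (Fin n) ℝ (Fin n → ℝ) :=
    (Pi.basisFun ℝ (Fin n)).isUnitSMul (w := fun _ => (Nat.card G : ℝ)⁻¹) fun _ => hr.isUnit
  have hB : ∀ i, B i = Pi.single i (Nat.card G : ℝ)⁻¹ := fun i => by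
    rw [Module.Basis.isUnitSMul_apply, Pi.basisFun_apply, ← Pi.single_smul, smul_eq_mul, mul_one]
  have hle : (lattice G ε b : Set (Fin n → ℝ)) ⊆ Submodule.span ℤ (Set.range B) := by
    rw [funext hB]
    exact lattice_le_span
  exact DiscreteTopology.of_subset (inferInstanceAs (DiscreteTopology (Submodule.span ℤ _))) hle

end Lattice

section Age

variable {n : ℕ}

theorem mem_orthant_iff {x : Fin n → ℝ} : x ∈ orthant n ↔ ∀ i, 0 ≤ x i := by
  have horthant : orthant n = PointedCone.hull ℝ (Pi.basisFun ℝ (Fin n) '' Set.univ) := by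
    simp only [orthant, Set.image_univ, ← Pi.basisFun_apply]
  rw [horthant, mem_hull_basis]
  simp

theorem span_orthant : Submodule.span ℝ (orthant n : Set (Fin n → ℝ)) = ⊤ :=
  top_le_iff.1 (span_single_eq_top.ge.trans (Submodule.span_mono PointedCone.subset_hull))

theorem IsFractionalExpression.mem_orthant {r : ℕ} {ε : ℂ} {b : Module.Basis (Fin n) ℂ (Fin n → ℂ)}
    {g : Matrix.SpecialLinearGroup (Fin n) ℂ} {v : Fin n → ℝ}
    (hv : IsFractionalExpression r ε b g v) : v ∈ orthant n := by
  obtain ⟨a, ha⟩ := hv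
  refine mem_orthant_iff.2 fun i => ?_
  rw [(ha i).2.2]
  positivity

/-- The age as a linear form on `ℝⁿ`. -/
noncomputable def ageForm (n : ℕ) : Module.Dual ℝ (Fin n → ℝ) := ∑ i, LinearMap.proj i

theorem ageForm_apply (x : Fin n → ℝ) : ageForm n x = age x := by
  simp [ageForm, age]

theorem det_eq_prod_of_mulVec_basis {R ι : Type*} [CommRing R] [Fintype ι] [DecidableEq ι]
    (b : Module.Basis ι R (ι → R)) {A : Matrix ι ι R} {c : ι → R}
    (h : ∀ i, A.mulVec (b i) = c i • b i) : A.det = ∏ i, c i := by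
  have hdiag : LinearMap.toMatrix b b (Matrix.toLin' A) = Matrix.diagonal c := by
    ext i j
    rw [LinearMap.toMatrix_apply, Matrix.toLin'_apply, h, map_smul, Module.Basis.repr_self,
      Finsupp.smul_single, smul_eq_mul, mul_one, Finsupp.single_apply, Matrix.diagonal_apply]
    split_ifs with hji hij hij
    · rw [hji]
    · exact absurd hji.symm hij
    · exact absurd hij.symm hji
    · rfl
  rw [← LinearMap.det_toLin', ← LinearMap.det_toMatrix b, hdiag, Matrix.det_diagonal]

theorem IsFractionalExpression.exists_age_eq {r : ℕ} (hr : r ≠ 0) {ε : ℂ}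
    (hε : IsPrimitiveRoot ε r) {b : Module.Basis (Fin n) ℂ (Fin n → ℂ)}
    {g : Matrix.SpecialLinearGroup (Fin n) ℂ} {v : Fin n → ℝ}
    (hv : IsFractionalExpression r ε b g v) : ∃ k : ℤ, age v = k := by
  obtain ⟨a, ha⟩ := hv
  have hpow : ε ^ ∑ i, a i = 1 := by
    rw [← Finset.prod_pow_eq_pow_sum, ← det_eq_prod_of_mulVec_basis b fun i => (ha i).2.1, g.2]
  obtain ⟨k, hk⟩ := hε.dvd_of_pow_eq_one _ hpow
  have hage : age v = ((∑ i, a i : ℕ) : ℝ) / r := by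
    rw [age, Nat.cast_sum, Finset.sum_div]
    exact Finset.sum_congr rfl fun i _ => (ha i).2.2
  refine ⟨k, ?_⟩
  rw [hage, hk, Nat.cast_mul, mul_div_cancel_left₀ _ (Nat.cast_ne_zero.2 hr), Int.cast_natCast]

theorem ageForm_mem_dualLattice {G : Subgroup (Matrix.SpecialLinearGroup (Fin n) ℂ)} [Finite G]
    {ε : ℂ} (hε : IsPrimitiveRoot ε (Nat.card G)) {b : Module.Basis (Fin n) ℂ (Fin n → ℂ)} :
    ageForm n ∈ dualLattice (lattice G ε b) := by
  refine mem_dualLattice_closure ?_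
  rintro x (⟨i, rfl⟩ | ⟨g, -, hg⟩)
  · exact ⟨1, by simp [ageForm_apply, age]⟩
  · rw [ageForm_apply]
    exact hg.exists_age_eq Nat.card_pos.ne' hε

theorem age_pos {x : Fin n → ℝ} (hx : x ∈ orthant n) (h : x ≠ 0) : 0 < age x := by
  rw [mem_orthant_iff] at hx
  obtain ⟨i, hi⟩ := Function.ne_iff.1 h
  exact Finset.sum_pos' (fun i _ => hx i) ⟨i, Finset.mem_univ i, (hx i).lt_of_ne' hi⟩

theorem mem_hilbertBasis_of_apply_eq_one {V : Type*} [AddCommGroup V] [Module ℝ V]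
    {L : AddSubgroup V} {σ : PointedCone ℝ V} {w : Module.Dual ℝ V} (hw : w ∈ dualLattice L)
    (hpos : ∀ x ∈ σ, x ≠ 0 → 0 < w x) {v : V} (hvL : v ∈ L) (hvσ : v ∈ σ) (hwv : w v = 1) :
    v ∈ hilbertBasis L σ := by
  have hnonneg : ∀ x ∈ σ, 0 ≤ w x := fun x hx => by
    rcases eq_or_ne x 0 with rfl | h
    · rw [map_zero]
    · exact (hpos x hx h).le
  have hone : ∀ x ∈ L, x ∈ σ → x ≠ 0 → 1 ≤ w x := fun x hxL hx h =>
    one_le_apply_of_ne_zero ⟨hw, hnonneg⟩ hxL hx (hpos x hx h).ne'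
  refine ⟨hvL, hvσ, ?_, fun x hxL y hyL hx hy hxy => ?_⟩
  · rintro rfl
    simp at hwv
  · by_contra! h
    rw [hxy, map_add] at hwv
    linarith [hone x hxL hx h.1, hone y hyL hy h.2]

theorem IsFractionalExpression.mem_hilbertBasis {G : Subgroup (Matrix.SpecialLinearGroup (Fin n) ℂ)}
    [Finite G] {ε : ℂ} (hε : IsPrimitiveRoot ε (Nat.card G))
    {b : Module.Basis (Fin n) ℂ (Fin n → ℂ)} {g : Matrix.SpecialLinearGroup (Fin n) ℂ} (hg : g ∈ G)
    {v : Fin n → ℝ} (hv : IsFractionalExpression (Nat.card G) ε b g v) (hage : age v = 1) :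
    v ∈ hilbertBasis (lattice G ε b) (orthant n) :=
  mem_hilbertBasis_of_apply_eq_one (ageForm_mem_dualLattice hε)
    (fun x hx h => ageForm_apply x ▸ age_pos hx h)
    (AddSubgroup.subset_closure (Or.inr ⟨g, hg, hv⟩)) hv.mem_orthant
    ((ageForm_apply v).trans hage)

end Age

end Toric

open SpaceWithFunctions Toric in
theorem theorem3p5_general {n : ℕ} {N : AddSubgroup (Fin n → ℝ)} [DiscreteTopology N]
    (hN : Submodule.span ℝ (N : Set (Fin n → ℝ)) = ⊤)
    {Ξ : Set (PointedCone ℝ (Fin n → ℝ))} {σ : PointedCone ℝ (Fin n → ℝ)}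
    (hσ : Submodule.span ℝ (σ : Set (Fin n → ℝ)) = ⊤) (hΞ : IsRefinement N Ξ σ)
    (hsmooth : ∀ τ ∈ Ξ, IsSmoothCone N τ) {v : Fin n → ℝ} (hv : v ∈ rayGenerators N Ξ)
    {w : Module.Dual ℝ (Fin n → ℝ)} (hw : w ∈ dualLattice N) (hwv : w v = 1)
    {Ξg : Set (PointedCone ℝ (Fin n → ℝ))}
    (hΞg : Ξg = starNeighborhood Ξ (PointedCone.hull ℝ {v})) :
    IsFan N Ξg ∧
    (∃ h : Ξg ⊆ Ξ, IsOpenImmersion (inclusion N h) ∧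
      inclusion N h '' rayDivisor N Ξg v = rayDivisor N Ξ v) ∧
    (∃ a : starRays N Ξg v → ℤ, (∀ u, (a u : ℝ) = -w u.1) ∧
      ∃ π : ToricVariety N Ξg → rayDivisor N Ξg v, IsTotalSpace π Subtype.val
        (fun u : starRays N Ξg v => Subtype.val ⁻¹' orbitClosure N Ξg (PointedCone.hull ℝ {v, u.1}))
        a) ∧
    @IsStrongDeformationRetract (ToricVariety N Ξg) (classicalTopology _) (rayDivisor N Ξg v) := by
  subst hΞg
  have hreg : IsRegularFan N Ξ := ⟨hΞ.1, fun τ hτ => (hsmooth τ hτ).isRegularCone hN⟩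
  have hsub := starNeighborhood_subset hΞ.1 (PointedCone.hull ℝ {v})
  have hstar := hreg.isStarFan_starNeighborhood hΞ.2 hσ hv
  have : Finite (starRays N (starNeighborhood Ξ (PointedCone.hull ℝ {v})) v) :=
    (finite_starRays hstar.finite).to_subtype
  have h_int : ∀ u : starRays N (starNeighborhood Ξ (PointedCone.hull ℝ {v})) v,
      ∃ k : ℤ, (k : ℝ) = -w u.1 := fun u =>
    ((neg_mem hw) u.1 u.2.1.1).imp fun _ hk => hk.symm
  choose a ha using h_int
  exact ⟨hstar.toIsFan,
    ⟨hsub, (hstar.isOpenEmb_inclusion hreg hsub).isOpenImmersion,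
      hstar.inclusion_image_orbitClosure hreg hsub hstar.ray_mem fun τ hτ hle =>
        mem_starNeighborhood_of_le hreg hΞ.2 hσ hv.2.2.1 hτ hle⟩,
    ⟨a, ha, hstar.proj, (isBoundary_starRays hstar ha).isTotalSpace hstar hw hwv⟩,
    hstar.isStrongDeformationRetract⟩

open SpaceWithFunctions Toric in
theorem theorem3p5 {n : ℕ} (G : Subgroup (Matrix.SpecialLinearGroup (Fin n) ℂ)) [Finite G]
    (hcomm : ∀ g ∈ G, ∀ h ∈ G, g * h = h * g)
    (ε : ℂ) (hε : IsPrimitiveRoot ε (Nat.card G))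
    -- a basis of `ℂⁿ` in which `G` is diagonal
    (b : Module.Basis (Fin n) ℂ (Fin n → ℂ))
    (hb : ∀ g ∈ G, ∀ i, ∃ c : ℂ, g.1.mulVec (b i) = c • b i)
    (N : AddSubgroup (Fin n → ℝ)) (hN : N = lattice G ε b)
    (Ξ : Set (PointedCone ℝ (Fin n → ℝ)))
    (hΞ : IsHilbertBasisResolution N Ξ (orthant n))
    -- a junior element `g` of `G` and its fractional expression `v`
    (g : Matrix.SpecialLinearGroup (Fin n) ℂ) (hg : g ∈ G)
    (v : Fin n → ℝ) (hv : IsFractionalExpression (Nat.card G) ε b g v) (hage : age v = 1)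
    (ρ : PointedCone ℝ (Fin n → ℝ)) (hρ : ρ = PointedCone.hull ℝ {v})
    (Ξg : Set (PointedCone ℝ (Fin n → ℝ))) (hΞg : Ξg = starNeighborhood Ξ ρ)
    (E : Set (ToricVariety N Ξg)) (hE : E = orbitClosure N Ξg ρ) :
    IsFan N Ξg ∧
    -- `X_Ξg` is an open subvariety of `X_Ξ`, and it contains the divisor of the ray `ρ` in `X_Ξ`
    (∃ h : Ξg ⊆ Ξ, IsOpenImmersion (inclusion N h) ∧ inclusion N h '' E = orbitClosure N Ξ ρ) ∧
    -- `X_Ξg` is the total space of `𝒪_E(-∑ age(u) D_u)`, with zero section the inclusion of `E`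
    (∃ a : starRays N Ξg v → ℤ, (∀ u, (a u : ℝ) = -age u.1) ∧
      ∃ π : ToricVariety N Ξg → E, IsTotalSpace π Subtype.val
        (fun u : starRays N Ξg v => Subtype.val ⁻¹' orbitClosure N Ξg (PointedCone.hull ℝ {v, u.1}))
        a) ∧
    @IsStrongDeformationRetract (ToricVariety N Ξg) (classicalTopology _) E := by
  subst hN hρ hE
  simpa only [ageForm_apply] using theorem3p5_general span_lattice span_orthant hΞ.1 hΞ.2.1
    (hΞ.2.2 ▸ hv.mem_hilbertBasis hε hg hage) (ageForm_mem_dualLattice hε)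
    ((ageForm_apply v).trans hage) hΞg
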